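/- Let $X$ be a nonzero complex Banach space, $\mathbb T=\mathbb R/\mathbb Z$ with normalized Haar measure, $e_n(t)=e^{2\pi i n t}$, and write $s'$ for the Hölder conjugate of $s\in[1,\infty]$, $a\wedge b=\min\{a,b\}$, $a\vee b=\max\{a,b\}$. For an $X$-valued trigonometric polynomial $f$ and an interval $I\subseteq\mathbb Z$ put $D_If=\sum_{n\in I}\widehat f(n)e_n$. For $p,q\in[1,\infty]$, $X$ has upper $\ell^q(L^p)$-decompositions if there is $U>0$ such that for every partition $\mathcal I$ of $\mathbb Z$ into intervals and every $X$-valued trigonometric polynomial $f$, $$\|f\|_{L^p(\mathbb T;X)}\le U\Big(\sum_{I\in\mathcal I}\|D_If\|_{L^p(\mathbb T;X)}^q\Big)^{1/q},$$ and lower $\ell^q(L^p)$-decompositions if there is $L>0$ such that for all such $\mathcal I$ and $f$, $$\Big(\sum_{I\in\mathcal I}\|D_If\|_{L^p(\mathbb T;X)}^q\Big)^{1/q}\le L\,\|f\|_{L^p(\mathbb T;X)}$$ (with the supremum over $I\in\mathcal I$ in place of the sum if $q=\infty$). $X$ has Fourier type $s\in[1,\infty]$ if there is $C>0$ with $\|\sum_{n\in\mathbb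 Z} e_nx_n\|_{L^{s'}(\mathbb T;X)}\le C\|(x_n)\|_{\ell^s(\mathbb Z;X)}$ for all finitely nonzero $(x_n)_{n\in\mathbb Z}$ in $X$. Let $(\varepsilon_k)_{k\ge1}$ be independent random variables uniformly distributed on the unit circle of $\mathbb C$. $X$ has type $s\in[1,\infty)$ if there is $C>0$ with $\|\sum_{k=1}^n\varepsilon_kx_k\|_{L^2(\Omega;X)}\le C(\sum_{k=1}^n\|x_k\|^s)^{1/s}$, and cotype $s\in[1,\infty]$ if there is $C>0$ with $(\sum_{k=1}^n\|x_k\|^s)^{1/s}\le C\|\sum_{k=1}^n\varepsilon_kx_k\|_{L^2(\Omega;X)}$ (the maximum on the left if $s=\infty$), for all $n$ and $x_1,\dots,x_n\in X$. (a) Let $p,q\in[1,\infty]$. If $X$ has upper $\ell^q(L^p)$-decompositions, then $q\le p'\wedge 2$, $X$ has type $q$, and $X$ has Fourier type $r'$ and cotype $r$ for every $r\in\big(\tfrac{2q'}{p\wedge 2},\infty\big)$. (b) Let $p\in(1,\infty)$ and $q\in[1,\infty]$. If $X$ has lower $\ell^q(L^p)$-decompositions, then $q\ge p'\vee 2$,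 $X$ has cotype $q$, and $X$ has Fourier type $r'$ and type $r'$ for every $r\in\big(\tfrac{2q}{p'\wedge 2},\infty\big)$. -/

import Mathlib

open scoped ENNReal NNReal

noncomputable section

namespace FourierDecomp

variable {X : Type*} [NormedAddCommGroup X] [NormedSpace ℂ X]

/-- The `ℓ^q`-norm of a family of extended nonnegative numbers, `q ∈ [1, ∞]`
(the supremum when `q = ∞`). -/
def ellNorm {ι : Type*} (q : ℝ≥0∞) (a : ι → ℝ≥0∞) : ℝ≥0∞ :=
  if q = ∞ then ⨆ i, a i else (∑' i, a i ^ q.toReal) ^ (1 / q.toReal)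

/-- The norm of `L^p(𝕋; X)`, where `𝕋 = ℝ / ℤ` carries its normalized Haar measure. -/
def circleNorm (p : ℝ≥0∞) (f : UnitAddCircle → X) : ℝ≥0∞ :=
  MeasureTheory.eLpNorm f p AddCircle.haarAddCircle

/-- The trigonometric polynomial `∑ n, e_n a_n` with `e_n(t) = exp(2πint)`, for a finitely nonzero
family `(a_n)` in `X`. -/
def trigPoly (a : ℤ →₀ X) : UnitAddCircle → X :=
  fun t => a.sum fun n x => fourier n t • x

/-- `f` is an `X`-valued trigonometric polynomial. -/
def IsTrigPoly (f : UnitAddCircle → X) : Prop :=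
  ∃ a : ℤ →₀ X, f = trigPoly a

/-- `D_I f`, the inverse Fourier transform of `1_I` times the Fourier coefficients of `f`. It is
used for trigonometric polynomials `f` only, for which the sum below is finite. -/
def freqProj (I : Set ℤ) (f : UnitAddCircle → X) : UnitAddCircle → X :=
  fun t => ∑ᶠ n : ℤ, fourier n t • I.indicator (fourierCoeff f) n

/-- A partition of `ℤ` into intervals (bounded or unbounded). -/
def IsIntervalPartition (P : Set (Set ℤ)) : Prop :=
  Setoid.IsPartition P ∧ ∀ I ∈ P, I.OrdConnected

variable (X)

/-- `X` has upper `ℓ^q(L^p)`-decompositions. -/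
def HasUpperDecompositions (q p : ℝ≥0∞) : Prop :=
  ∃ U : ℝ≥0, 0 < U ∧ ∀ P : Set (Set ℤ), IsIntervalPartition P →
    ∀ f : UnitAddCircle → X, IsTrigPoly f →
      circleNorm p f ≤ U * ellNorm q (fun I : P => circleNorm p (freqProj (I : Set ℤ) f))

/-- `X` has lower `ℓ^q(L^p)`-decompositions. -/
def HasLowerDecompositions (q p : ℝ≥0∞) : Prop :=
  ∃ L : ℝ≥0, 0 < L ∧ ∀ P : Set (Set ℤ), IsIntervalPartition P →
    ∀ f : UnitAddCircle → X, IsTrigPoly f →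
      ellNorm q (fun I : P => circleNorm p (freqProj (I : Set ℤ) f)) ≤ L * circleNorm p f

/-- `X` has Fourier type `p ∈ [1, ∞]`. -/
def HasFourierType (p : ℝ≥0∞) : Prop :=
  ∃ C : ℝ≥0, 0 < C ∧ ∀ a : ℤ →₀ X,
    circleNorm p.conjExponent (trigPoly a) ≤ C * ellNorm p (fun n : ℤ => ‖a n‖ₑ)

variable {X}

/-- The norm of `∑ k, ε_k x_k` in `L^2(Ω; X)`, where the `ε_k` are independent and uniformly
distributed on the unit circle of `ℂ` (a complex Rademacher sequence). They are realized on the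
product probability space `Ω = 𝕋^n` as `ε_k(ω) = exp(2πi ω_k)`; the norm depends only on the joint
law of the `ε_k`. -/
def rademacherNorm {n : ℕ} (x : Fin n → X) : ℝ≥0∞ :=
  MeasureTheory.eLpNorm (fun ω : Fin n → UnitAddCircle => ∑ k, fourier 1 (ω k) • x k) 2
    (MeasureTheory.Measure.pi fun _ : Fin n =>
      (AddCircle.haarAddCircle : MeasureTheory.Measure UnitAddCircle))

variable (X)

/-- `X` has (Rademacher) type `p ∈ [1, ∞)`. -/
def HasType (p : ℝ≥0∞) : Prop :=
  ∃ C : ℝ≥0, 0 < C ∧ ∀ (n : ℕ) (x : Fin n → X),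
    rademacherNorm x ≤ C * ellNorm p (fun k => ‖x k‖ₑ)

/-- `X` has (Rademacher) cotype `q ∈ [1, ∞]`. -/
def HasCotype (q : ℝ≥0∞) : Prop :=
  ∃ C : ℝ≥0, 0 < C ∧ ∀ (n : ℕ) (x : Fin n → X),
    ellNorm q (fun k => ‖x k‖ₑ) ≤ C * rademacherNorm x

end FourierDecomp

end

/-! Only the partition of `ℤ` into singletons is needed. It turns an upper decomposition into `‖∑
e_n x_n‖_p ≤ U ‖(x_n)‖_{ℓ^q}` and a lower one into the reverse inequality, for arbitrary finite sets
of frequencies.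

Fourier type in (a). Since `p ≥ 1`, the upper bound gives an `ℓ^q → L^1` bound for the Fourier
transform, and sampling at roots of unity gives the same bound on `ℤ/N`, uniformly in the prime `N`.
The core is `dft_weak_type`: this bound improves itself to weak type `(q, q')`. Let `S` be the set
where the transform of `y` has norm at least `c`, and take `M ≈ N / #S`. Multiplying `y` by
translates of a Fejér kernel of order `M`, dilated by `d`, mixes the values of the transform along
progressions with step `d`. The `L^1` bound loses only `M^{1-1/q}` in this operation, while a second
moment count shows that a positive proportion of the progressions of length about `M / 2` meet `S`.
Thus `S` acts like a set of positive density, which is the weak type bound. Marcinkiewicz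
interpolation with the trivial `ℓ^1 → ℓ^∞` bound gives strong type `(v, v')` for `v < q`, hence
Fourier type `r'` for every `r > q'`. The stated range lies inside this one, because `p ∧ 2 ≤ 2`.
Cotype `r` follows by applying the discrete inequality to a transform and using Fourier inversion.

Fourier type in (b). The lower bound, tested on combinations of Fejér kernels centred at roots of
unity, gives an `ℓ^∞ → ℓ^q` bound on `ℤ/N`. By duality this is an `ℓ^{q'} → ℓ^1` bound for the dual
space. The argument of (a) applies there, and `HasDiscreteFourierType.of_dual` brings the conclusion
back to `X`. Type follows from Fourier type.

Type `q` in (a) and cotype `q` in (b). Rotating the variables `ε_k` by `k t` turns a random sum into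
a trigonometric polynomial with the same coefficient norms, so the bounds transfer in `L^1` and in
high moments respectively. Kahane's inequality, proved here by hypercontractivity, moves to `L^2`.

The restrictions on `q` come from a single vector `x ≠ 0`: constant random sums compare `q` with
`2`, and Dirichlet or Fejér kernels compare it with `p'`. -/

noncomputable section
namespace FourierDecomp

open ZMod Finset

/-! ### Fejér kernels on `ℤ/N` -/

section DiscreteFejer

variable {N : ℕ} [NeZero N]

/-- The Fejér kernel of order `M` on `ZMod N`. -/
def discreteFejer (N M : ℕ) [NeZero N] (a : ZMod N) : ℝ :=
  ‖∑ i ∈ range M, stdAddChar ((i : ZMod N) * a)‖ ^ 2 / M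

lemma conj_stdAddChar (a : ZMod N) : (starRingEnd ℂ) (stdAddChar a) = stdAddChar (-a) := by
  rw [AddChar.map_neg_eq_conj]

lemma sum_stdAddChar_mul (a : ZMod N) :
    ∑ i, stdAddChar (a * i) = if a = 0 then (N : ℂ) else 0 := by
  split_ifs with h
  · simp [h, ZMod.card]
  · exact AddChar.sum_eq_zero_of_ne_one (isPrimitive_stdAddChar N h)

lemma discreteFejer_nonneg (M : ℕ) (a : ZMod N) : 0 ≤ discreteFejer N M a := by
  unfold discreteFejer; positivity

lemma discreteFejer_le (M : ℕ) (a : ZMod N) : discreteFejer N M a ≤ M := by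
  have h : ‖∑ i ∈ range M, stdAddChar ((i : ZMod N) * a)‖ ≤ M := by
    refine (norm_sum_le _ _).trans ?_
    simp
  unfold discreteFejer
  rcases Nat.eq_zero_or_pos M with rfl | hM
  · simp
  · rw [div_le_iff₀ (by exact_mod_cast hM), ← sq]
    gcongr

lemma coe_discreteFejer (M : ℕ) (a : ZMod N) :
    (discreteFejer N M a : ℂ) =
      (∑ x ∈ range M ×ˢ range M, stdAddChar (((x.1 : ZMod N) - (x.2 : ZMod N)) * a)) / M := by
  unfold discreteFejer
  push_cast
  rw [← Complex.mul_conj', map_sum, sum_mul_sum, ← sum_product']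
  congr 1
  refine sum_congr rfl fun x _ => ?_
  rw [conj_stdAddChar, ← AddChar.map_add_eq_mul]
  congr 1; ring

lemma sum_stdAddChar_mul_discreteFejer (M : ℕ) (l : ZMod N) :
    ∑ a, stdAddChar (-(l * a)) * (discreteFejer N M a : ℂ) =
      N / M * #{x ∈ range M ×ˢ range M | (x.1 : ZMod N) = x.2 + l} := by
  simp_rw [coe_discreteFejer, mul_div_assoc', mul_sum, ← AddChar.map_add_eq_mul, ← sum_div]
  rw [sum_comm]
  have : ∀ x : ℕ × ℕ, ∑ a : ZMod N, stdAddChar (-(l * a) + ((x.1 : ZMod N) - (x.2 : ZMod N)) * a) =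
      if (x.1 : ZMod N) = x.2 + l then (N : ℂ) else 0 := by
    intro x
    have h : ∀ a : ZMod N, -(l * a) + ((x.1 : ZMod N) - (x.2 : ZMod N)) * a =
        ((x.1 : ZMod N) - (x.2 + l)) * a := fun a => by ring
    simp_rw [h, sum_stdAddChar_mul, sub_eq_zero]
  simp_rw [this, ← sum_filter, sum_const, nsmul_eq_mul]
  ring

lemma sum_discreteFejer {M : ℕ} (hM : 0 < M) (hMN : M ≤ N) :
    ∑ a, discreteFejer N M a = N := by
  have h := sum_stdAddChar_mul_discreteFejer (N := N) M 0
  have hc : #{x ∈ range M ×ˢ range M | (x.1 : ZMod N) = x.2 + 0} = M := by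
    have : {x ∈ range M ×ˢ range M | (x.1 : ZMod N) = x.2 + 0} = (range M).diag := by
      ext x
      simp only [mem_filter, mem_product, mem_range, add_zero, mem_diag]
      constructor
      · rintro ⟨⟨h1, h2⟩, h3⟩
        refine ⟨h1, ?_⟩
        have := congrArg ZMod.val h3
        rwa [ZMod.val_cast_of_lt (h1.trans_le hMN), ZMod.val_cast_of_lt (h2.trans_le hMN)] at this
      · rintro ⟨h1, h2⟩
        exact ⟨⟨h1, h2 ▸ h1⟩, by rw [h2]⟩
    rw [this, diag_card, card_range]
  rw [hc] at h
  have hM' : (M : ℂ) ≠ 0 := by exact_mod_cast hM.ne'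
  simp only [zero_mul, neg_zero, AddChar.map_zero_eq_one, one_mul, div_mul_cancel₀ _ hM'] at h
  exact_mod_cast h

omit [NeZero N] in
lemma le_card_translates (M l : ℕ) :
    M - l ≤ #{x ∈ range M ×ˢ range M | (x.1 : ZMod N) = x.2 + l} := by
  rw [← card_range (M - l)]
  refine card_le_card_of_injOn (fun i => (i + l, i)) ?_ ?_
  · intro i hi
    have : i < M - l := by simpa using hi
    simp only [coe_filter, mem_product, mem_range, Set.mem_ofPred_eq]
    refine ⟨⟨by omega, by omega⟩, by push_cast; ring⟩
  · intro i _ j _ h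
    exact (Prod.mk.inj h).2

/-- Interpolation between the total mass `N` and the supremum `M` of the kernel. -/
lemma sum_discreteFejer_rpow_le {M : ℕ} (hM : 0 < M) (hMN : M ≤ N) {q : ℝ} (hq : 1 ≤ q) :
    ∑ a, discreteFejer N M a ^ q ≤ M ^ (q - 1) * N := by
  rw [← sum_discreteFejer hM hMN, mul_sum]
  refine sum_le_sum fun a _ => ?_
  rcases (discreteFejer_nonneg M a).eq_or_lt with h | h
  · rw [← h, Real.zero_rpow (by linarith), mul_zero]
  · calc discreteFejer N M a ^ q = discreteFejer N M a ^ (q - 1) * discreteFejer N M a := by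
          rw [← Real.rpow_add_one h.ne']; ring_nf
      _ ≤ _ := by
          exact mul_le_mul_of_nonneg_right
            (Real.rpow_le_rpow h.le (discreteFejer_le M a) (by linarith)) h.le

end DiscreteFejer

/-! ### Mixing the discrete Fourier transform along arithmetic progressions -/

section Weak

variable {E : Type*} [NormedAddCommGroup E] [NormedSpace ℂ E]

lemma sum_rpow_inv_le {ι : Type*} (s : Finset ι) {q : ℝ} (hq : 1 ≤ q) {f : ι → ℝ}
    (hf : ∀ i, 0 ≤ f i) :
    ∑ i ∈ s, f i ^ (1 / q) ≤ (#s : ℝ) ^ (1 - 1 / q) * (∑ i ∈ s, f i) ^ (1 / q) := by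
  have hq0 : 0 < q := by linarith
  have h := Real.rpow_sum_le_const_mul_sum_rpow_of_nonneg s hq
    (f := fun i => f i ^ (1 / q)) (fun i _ => Real.rpow_nonneg (hf i) _)
  have h2 : ∀ i, (f i ^ (1 / q)) ^ q = f i := fun i => by
    rw [← Real.rpow_mul (hf i), one_div_mul_cancel hq0.ne', Real.rpow_one]
  simp_rw [h2] at h
  have h0 : 0 ≤ ∑ i ∈ s, f i ^ (1 / q) := sum_nonneg fun i _ => Real.rpow_nonneg (hf i) _
  have hs : 0 ≤ ∑ i ∈ s, f i := sum_nonneg fun i _ => hf i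
  have := Real.rpow_le_rpow (Real.rpow_nonneg h0 _) h (by positivity : 0 ≤ 1 / q)
  rw [← Real.rpow_mul h0, mul_one_div_cancel hq0.ne', Real.rpow_one,
    Real.mul_rpow (by positivity) hs, ← Real.rpow_mul (by positivity)] at this
  convert this using 3
  field_simp

variable {N : ℕ} [NeZero N]

/-- The discrete Fourier transform of `y` modulated by a translate of the Fejér kernel. -/
def modulatedDFT (M : ℕ) (y : ZMod N → E) (η d t : ZMod N) : E :=
  dft (fun n => (discreteFejer N M (η - n * d) : ℂ) • y n) t

/-- The hypothesis is applied for each `η`, and concavity of `s ↦ s ^ (1 / q)` moves the sum over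
`η` inside. There each `‖y n‖ ^ q` meets the full sum of the `q`-th powers of the kernel, whatever
`d` is. The only loss against the unmodulated bound is `M ^ (1 - 1 / q)`. -/
lemma sum_norm_modulatedDFT_le {M : ℕ} (hM : 0 < M) (hMN : M ≤ N) {q U : ℝ} (hq : 1 ≤ q)
    (hU : 0 ≤ U)
    (H : ∀ y : ZMod N → E, ∑ k, ‖dft y k‖ ≤ U * N * (∑ j, ‖y j‖ ^ q) ^ (1 / q))
    (y : ZMod N → E) (d : ZMod N) :
    ∑ η, ∑ t, ‖modulatedDFT M y η d t‖ ≤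
      U * N ^ 2 * M ^ (1 - 1 / q) * (∑ j, ‖y j‖ ^ q) ^ (1 / q) := by
  have hq0 : 0 < q := by linarith
  have hN : (0 : ℝ) < N := by exact_mod_cast NeZero.pos N
  have hM0 : (0 : ℝ) < M := by exact_mod_cast hM
  have hy0 : 0 ≤ ∑ j, ‖y j‖ ^ q := sum_nonneg fun j _ => by positivity
  have h1 : ∀ η, ∑ t, ‖modulatedDFT M y η d t‖ ≤
      U * N * (∑ n, discreteFejer N M (η - n * d) ^ q * ‖y n‖ ^ q) ^ (1 / q) := by
    intro η
    refine (H _).trans_eq ?_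
    congr 2
    refine sum_congr rfl fun n _ => ?_
    rw [norm_smul, Complex.norm_real, Real.norm_of_nonneg (discreteFejer_nonneg _ _),
      Real.mul_rpow (discreteFejer_nonneg _ _) (norm_nonneg _)]
  have h2 : ∑ η, ∑ n, discreteFejer N M (η - n * d) ^ q * ‖y n‖ ^ q ≤
      M ^ (q - 1) * N * ∑ j, ‖y j‖ ^ q := by
    rw [sum_comm, mul_sum]
    refine sum_le_sum fun n _ => ?_
    rw [← sum_mul]
    gcongr
    exact ((Equiv.subRight (n * d)).sum_comp fun a => discreteFejer N M a ^ q).trans_le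
      (sum_discreteFejer_rpow_le hM hMN hq)
  calc ∑ η, ∑ t, ‖modulatedDFT M y η d t‖
      ≤ ∑ η, U * N * (∑ n, discreteFejer N M (η - n * d) ^ q * ‖y n‖ ^ q) ^ (1 / q) :=
        sum_le_sum fun η _ => h1 η
    _ = U * N * ∑ η, (∑ n, discreteFejer N M (η - n * d) ^ q * ‖y n‖ ^ q) ^ (1 / q) := by
        rw [mul_sum]
    _ ≤ U * N * ((N : ℝ) ^ (1 - 1 / q) * (M ^ (q - 1) * N * ∑ j, ‖y j‖ ^ q) ^ (1 / q)) := by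
        gcongr
        refine (sum_rpow_inv_le univ hq fun η => sum_nonneg fun n _ =>
          mul_nonneg (Real.rpow_nonneg (discreteFejer_nonneg _ _) _) (by positivity)).trans ?_
        rw [card_univ, ZMod.card]
        gcongr
        exact sum_nonneg fun η _ => sum_nonneg fun n _ =>
          mul_nonneg (Real.rpow_nonneg (discreteFejer_nonneg _ _) _) (by positivity)
    _ = U * N ^ 2 * M ^ (1 - 1 / q) * (∑ j, ‖y j‖ ^ q) ^ (1 / q) := by
        rw [Real.mul_rpow (by positivity) hy0, Real.mul_rpow (by positivity) hN.le,
          ← Real.rpow_mul hM0.le]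
        have e1 : (q - 1) * (1 / q) = 1 - 1 / q := by field_simp
        have e2 : (N : ℝ) ^ (1 - 1 / q) * (N : ℝ) ^ (1 / q) = N := by
          rw [← Real.rpow_add hN]; simp
        rw [e1]
        linear_combination (U * N * M ^ (1 - 1 / q) * (∑ j, ‖y j‖ ^ q) ^ (1 / q)) * e2

/-- As a function of `η`, the modulated transform at `t` is a trigonometric sum whose `l`-th
coefficient is the Fejér coefficient times `dft y (t + l * d)`. Its `L^1` norm in `η` dominates
every coefficient, and the Fejér coefficients with `2 * l ≤ M` are at least `1 / 2`. One sum over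
`η` therefore controls the transform on a whole progression. -/
lemma le_sum_norm_modulatedDFT {M : ℕ} (hM : 0 < M) (y : ZMod N → E) (d t : ZMod N) (l : ℕ)
    (hl : 2 * l ≤ M) :
    (N : ℝ) / 2 * ‖dft y (t + l * d)‖ ≤ ∑ η, ‖modulatedDFT M y η d t‖ := by
  have hM0 : (0 : ℝ) < M := by exact_mod_cast hM
  have key : ∑ η, stdAddChar (-((l : ZMod N) * η)) • modulatedDFT M y η d t =
      ((N : ℂ) / M * #{x ∈ range M ×ˢ range M | (x.1 : ZMod N) = x.2 + l}) •
        dft y (t + l * d) := by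
    simp_rw [modulatedDFT, dft_apply, smul_sum, smul_smul]
    rw [sum_comm]
    refine sum_congr rfl fun n _ => ?_
    rw [← sum_smul]
    congr 1
    rw [← sum_stdAddChar_mul_discreteFejer, sum_mul]
    refine Fintype.sum_equiv (Equiv.subRight (n * d)) _ _ fun η => ?_
    simp only [Equiv.subRight_apply]
    rw [← mul_assoc, ← AddChar.map_add_eq_mul, mul_right_comm, ← AddChar.map_add_eq_mul]
    congr 2
    ring
  have hc : (M : ℝ) / 2 ≤ #{x ∈ range M ×ˢ range M | (x.1 : ZMod N) = x.2 + l} := by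
    have h1 := le_card_translates (N := N) M l
    have h2 : M ≤ 2 * #{x ∈ range M ×ˢ range M | (x.1 : ZMod N) = x.2 + l} := by omega
    have h3 : (M : ℝ) ≤ 2 * #{x ∈ range M ×ˢ range M | (x.1 : ZMod N) = x.2 + l} := by
      exact_mod_cast h2
    linarith
  calc (N : ℝ) / 2 * ‖dft y (t + l * d)‖ = (N : ℝ) / M * (M / 2) * ‖dft y (t + l * d)‖ := by
        field_simp
    _ ≤ (N : ℝ) / M * #{x ∈ range M ×ˢ range M | (x.1 : ZMod N) = x.2 + l} *
          ‖dft y (t + l * d)‖ := by gcongr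
    _ = ‖∑ η, stdAddChar (-((l : ZMod N) * η)) • modulatedDFT M y η d t‖ := by
        rw [key, norm_smul]; simp
    _ ≤ _ := by
        refine (norm_sum_le _ _).trans_eq ?_
        simp [norm_smul]

end Weak

/-! ### How many progressions meet a given set -/

section Counting

variable {N : ℕ} [Fact N.Prime]

/-- Since `N` is prime, `a - b` is invertible and `(t, d) ↦ (t + a d, t + b d)` is injective: two
distinct terms of a random progression are independent. -/
lemma card_pairs_le (S : Finset (ZMod N)) {a b : ZMod N} (hab : a ≠ b) :
    #{x : ZMod N × ZMod N | x.1 + a * x.2 ∈ S ∧ x.1 + b * x.2 ∈ S} ≤ #S ^ 2 := by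
  rw [sq, ← card_product]
  refine card_le_card_of_injOn (fun x => (x.1 + a * x.2, x.1 + b * x.2)) ?_ ?_
  · intro x hx; simpa using hx
  · rintro ⟨t, d⟩ _ ⟨t', d'⟩ _ h
    obtain ⟨h1, h2⟩ := Prod.mk.inj h
    have h3 : (a - b) * (d - d') = 0 := by linear_combination h1 - h2
    rcases mul_eq_zero.1 h3 with h4 | h4
    · exact absurd (sub_eq_zero.1 h4) hab
    · have h5 : d = d' := sub_eq_zero.1 h4
      subst h5
      simpa using h1

lemma card_pairs_self (S : Finset (ZMod N)) (a : ZMod N) :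
    #{x : ZMod N × ZMod N | x.1 + a * x.2 ∈ S} = N * #S := by
  have : #{x : ZMod N × ZMod N | x.1 + a * x.2 ∈ S} = #((univ : Finset (ZMod N)) ×ˢ S) := by
    refine card_bij (fun x _ => (x.2, x.1 + a * x.2)) ?_ ?_ ?_
    · intro x hx; simpa using hx
    · rintro ⟨t, d⟩ _ ⟨t', d'⟩ _ h
      obtain ⟨h1, h2⟩ := Prod.mk.inj h
      simp only at h1 h2
      subst h1
      simpa using h2
    · rintro ⟨d, s⟩ h
      exact ⟨(s - a * d, d), by simpa using h, by simp⟩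
  rw [this, card_product, card_univ, ZMod.card]

/-- For a set `S` of density at most `1 / m`, the pairs `(s, d)` such that one of the first `m`
terms of the progression `s, s + d, s + 2d, …` lies in `S` number at least `m N #S / 2`. -/
lemma le_card_union_translates (S : Finset (ZMod N)) {m : ℕ} (hm : m ≤ N) (hmS : m * #S ≤ N) :
    (m * N * #S : ℝ) / 2 ≤
      #{x : ZMod N × ZMod N | ∃ l < m, x.1 + (l : ZMod N) * x.2 ∈ S} := by
  set n : ZMod N × ZMod N → ℝ := fun x =>
    ∑ l ∈ range m, if x.1 + (l : ZMod N) * x.2 ∈ S then 1 else 0 with hn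
  have h1 : ∑ x, n x = m * N * #S := by
    rw [hn, sum_comm]
    simp_rw [sum_boole, card_pairs_self]
    simp; ring
  have h2 : ∑ x, n x ^ 2 ≤ m * N * #S + m ^ 2 * #S ^ 2 := by
    have e : ∀ x, n x ^ 2 = ∑ l ∈ range m, ∑ l' ∈ range m,
        if x.1 + (l : ZMod N) * x.2 ∈ S ∧ x.1 + (l' : ZMod N) * x.2 ∈ S then 1 else 0 := by
      intro x
      rw [sq, hn, sum_mul_sum]
      refine sum_congr rfl fun l _ => sum_congr rfl fun l' _ => ?_
      rw [ite_and]; split_ifs <;> simp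
    simp_rw [e]
    rw [sum_comm]
    have : ∀ l ∈ range m, ∑ x : ZMod N × ZMod N, ∑ l' ∈ range m,
        (if x.1 + (l : ZMod N) * x.2 ∈ S ∧ x.1 + (l' : ZMod N) * x.2 ∈ S then (1 : ℝ) else 0) ≤
        N * #S + m * #S ^ 2 := by
      intro l hl
      rw [sum_comm]
      simp_rw [sum_boole]
      calc _ ≤ ∑ l' ∈ range m, ((if l' = l then (N * #S : ℝ) else 0) + #S ^ 2) := by
            refine sum_le_sum fun l' hl' => ?_
            split_ifs with h
            · subst h
              simp_rw [and_self, card_pairs_self]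
              push_cast
              nlinarith [sq_nonneg (#S : ℝ)]
            · rw [zero_add]
              refine mod_cast card_pairs_le S fun h' => h ?_
              have := congrArg ZMod.val h'
              rw [ZMod.val_cast_of_lt ((mem_range.1 hl).trans_le hm),
                ZMod.val_cast_of_lt ((mem_range.1 hl').trans_le hm)] at this
              exact this.symm
        _ = N * #S + m * #S ^ 2 := by
            rw [sum_add_distrib, sum_ite_eq' , if_pos hl]
            simp
    refine (sum_le_sum this).trans_eq ?_
    simp; ring
  -- This is `(n x - 2) ^ 2 ≥ 0`. The weight `1 / 4` leaves half of the first moment, as the second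
  -- moment is at most twice the first when `m * #S ≤ N`.
  have h3 : ∀ x, n x - n x ^ 2 / 4 ≤
      if ∃ l < m, x.1 + (l : ZMod N) * x.2 ∈ S then (1 : ℝ) else 0 := by
    intro x
    split_ifs with h
    · nlinarith [sq_nonneg (n x - 2)]
    · have : n x = 0 := sum_eq_zero fun l hl =>
        if_neg fun h' => h ⟨l, mem_range.1 hl, h'⟩
      simp [this]
  have h4 := sum_le_sum fun x (_ : x ∈ (univ : Finset (ZMod N × ZMod N))) => h3 x
  rw [sum_boole, sum_sub_distrib, ← sum_div, h1] at h4
  have h5 : (m : ℝ) * #S ≤ N := by exact_mod_cast hmS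
  have h6 : (m : ℝ) ^ 2 * #S ^ 2 ≤ m * N * #S := by
    have : 0 ≤ (m : ℝ) * #S := by positivity
    nlinarith
  linarith

end Counting

/-- An `ℓ^q → L^1` bound for the discrete Fourier transform improves to a weak type
`(q, q')` bound. -/
theorem dft_weak_type {E : Type*} [NormedAddCommGroup E] [NormedSpace ℂ E] {N : ℕ}
    [Fact N.Prime] {q U : ℝ} (hq : 1 ≤ q) (hU : 0 ≤ U)
    (H : ∀ y : ZMod N → E, ∑ k, ‖dft y k‖ ≤ U * N * (∑ j, ‖y j‖ ^ q) ^ (1 / q))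
    (y : ZMod N → E) {c : ℝ} (hc : 0 < c) (hS : 0 < #{k | c ≤ ‖dft y k‖}) :
    c ≤ 16 * U * ((N : ℝ) / #{k | c ≤ ‖dft y k‖}) ^ (1 - 1 / q) *
      (∑ j, ‖y j‖ ^ q) ^ (1 / q) := by
  set S : Finset (ZMod N) := {k | c ≤ ‖dft y k‖} with hSdef
  have hNp : 0 < N := NeZero.pos N
  have hN : (0 : ℝ) < N := by exact_mod_cast hNp
  have hSN : #S ≤ N := (card_le_univ S).trans_eq (by rw [ZMod.card])
  -- The order is the reciprocal density of `S`, so that progressions of about this length have a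
  -- good chance to meet `S`.
  set M := N / #S with hMdef
  have hM : 0 < M := Nat.div_pos hSN hS
  have hMN : M ≤ N := Nat.div_le_self _ _
  -- Rounding up keeps `m` positive when `M = 1`, and `l < m` still gives `2 * l ≤ M`.
  set m := (M + 1) / 2 with hm
  have hMS : M * #S ≤ N := Nat.div_mul_le_self _ _
  have hmM : m ≤ M := by omega
  have hmS : m * #S ≤ N := (Nat.mul_le_mul_right _ hmM).trans hMS
  have hNM : N ≤ 4 * (m * #S) := by
    have h1 : N < (M + 1) * #S := by
      have := Nat.lt_div_mul_add (a := N) hS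
      rw [add_mul, one_mul]; exact this
    have h2 : M + 1 ≤ 4 * m := by omega
    calc N ≤ (M + 1) * #S := h1.le
      _ ≤ 4 * m * #S := Nat.mul_le_mul_right _ h2
      _ = _ := by ring
  have hU1 := sum_le_sum fun d (_ : d ∈ (univ : Finset (ZMod N))) =>
    sum_norm_modulatedDFT_le hM hMN hq hU H y d
  rw [sum_const, card_univ, ZMod.card, nsmul_eq_mul] at hU1
  have hL1 : (N : ℝ) / 2 * c * #{x : ZMod N × ZMod N | ∃ l < m, x.1 + (l : ZMod N) * x.2 ∈ S} ≤
      ∑ d, ∑ η, ∑ t, ‖modulatedDFT M y η d t‖ := by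
    have : ∑ d, ∑ η, ∑ t, ‖modulatedDFT M y η d t‖ =
        ∑ x : ZMod N × ZMod N, ∑ η, ‖modulatedDFT M y η x.2 x.1‖ := by
      rw [Fintype.sum_prod_type_right]
      exact sum_congr rfl fun d _ => sum_comm
    rw [this, ← sum_boole, mul_sum]
    refine sum_le_sum fun x _ => ?_
    split_ifs with h
    · obtain ⟨l, hl, hlS⟩ := h
      have h1 := le_sum_norm_modulatedDFT hM y x.2 x.1 l (by omega)
      have h2 : c ≤ ‖dft y (x.1 + l * x.2)‖ := (mem_filter.1 hlS).2
      rw [mul_one]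
      refine le_trans ?_ h1
      gcongr
    · rw [mul_zero]
      exact sum_nonneg fun _ _ => norm_nonneg _
  have hL2 := le_card_union_translates S (hmM.trans hMN) hmS
  have hNM' : (N : ℝ) ≤ 4 * (m * #S) := by exact_mod_cast hNM
  -- At least `N ^ 2 / 8` of the pairs `(t, d)` give a progression that meets `S`, and each
  -- contributes at least `N * c / 2`.
  have h3 : c * N ^ 3 / 16 ≤
      (N : ℝ) / 2 * c * #{x : ZMod N × ZMod N | ∃ l < m, x.1 + (l : ZMod N) * x.2 ∈ S} := by
    calc c * N ^ 3 / 16 = N / 2 * c * (N / 2 * (N / 4)) := by ring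
      _ ≤ N / 2 * c * (N / 2 * (m * #S)) := by gcongr; linarith
      _ = N / 2 * c * (m * N * #S / 2) := by ring
      _ ≤ _ := by gcongr
  have h4 := (h3.trans hL1).trans hU1
  have h5 : c ≤ 16 * U * (M : ℝ) ^ (1 - 1 / q) * (∑ j, ‖y j‖ ^ q) ^ (1 / q) := by
    have h6 : (0 : ℝ) < N ^ 3 := by positivity
    refine le_of_mul_le_mul_left ?_ h6
    linarith
  refine h5.trans ?_
  have hS' : (0 : ℝ) < #S := by exact_mod_cast hS
  have h7 : (M : ℝ) ≤ N / #S := by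
    rw [le_div_iff₀ hS']; exact_mod_cast hMS
  have h8 : 0 ≤ 1 - 1 / q := by
    rw [sub_nonneg, div_le_one (by linarith)]; exact hq
  have h9 : 0 ≤ (∑ j, ‖y j‖ ^ q) ^ (1 / q) :=
    Real.rpow_nonneg (sum_nonneg fun j _ => by positivity) _
  gcongr

end FourierDecomp
end

/-! ### Layer-cake formula and Marcinkiewicz interpolation -/

noncomputable section
namespace FourierDecomp

open Finset MeasureTheory

lemma lintegral_Ioc_rpow {κ a : ℝ} (hκ : 0 < κ) (ha : 0 ≤ a) :
    ∫⁻ μ in Set.Ioc 0 a, ENNReal.ofReal (κ * μ ^ (κ - 1)) = ENNReal.ofReal (a ^ κ) := by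
  have hi : IntervalIntegrable (fun μ : ℝ => κ * μ ^ (κ - 1)) volume 0 a :=
    (intervalIntegral.intervalIntegrable_rpow' (by linarith)).const_mul κ
  rw [← ofReal_integral_eq_lintegral_ofReal, ← intervalIntegral.integral_of_le ha,
    intervalIntegral.integral_const_mul, integral_rpow (Or.inl (by linarith))]
  · congr 1
    rw [sub_add_cancel, Real.zero_rpow hκ.ne', sub_zero]
    field_simp
  · rwa [intervalIntegrable_iff_integrableOn_Ioc_of_le ha] at hi
  · filter_upwards [ae_restrict_mem measurableSet_Ioc] with μ hμ
    have := hμ.1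
    positivity

lemma lintegral_Ioo_rpow {κ a : ℝ} (hκ : 0 < κ) (ha : 0 ≤ a) :
    ∫⁻ μ in Set.Ioo 0 a, ENNReal.ofReal (κ * μ ^ (κ - 1)) = ENNReal.ofReal (a ^ κ) := by
  rw [← lintegral_Ioc_rpow hκ ha]
  exact setLIntegral_congr Ioo_ae_eq_Ioc

/-- Layer-cake comparison of two finite families. -/
lemma sum_rpow_le_of_card_le {ι κ : Type*} [Fintype ι] [Fintype κ] {r s : ℝ} (hr : 0 < r)
    (hs : 0 < s) {a : κ → ℝ} {b w : ι → ℝ} (ha : ∀ k, 0 ≤ a k) (hb : ∀ i, 0 ≤ b i)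
    (hw : ∀ i, 0 ≤ w i)
    (h : ∀ μ : ℝ, 0 < μ →
      (#{k | μ < a k} : ℝ) ≤ ∑ i, if μ ≤ b i then w i * μ ^ (s - r) else 0) :
    ∑ k, a k ^ r ≤ r / s * ∑ i, w i * b i ^ s := by
  have hR : ∀ i, 0 ≤ r / s * (w i * b i ^ s) := fun i =>
    mul_nonneg (by positivity) (mul_nonneg (hw i) (Real.rpow_nonneg (hb i) _))
  rw [mul_sum]
  refine (ENNReal.ofReal_le_ofReal_iff (sum_nonneg fun i _ => hR i)).1 ?_
  rw [ENNReal.ofReal_sum_of_nonneg fun k _ => Real.rpow_nonneg (ha k) _,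
    ENNReal.ofReal_sum_of_nonneg fun i _ => hR i]
  have meas : ∀ t : ℝ, Measurable fun μ : ℝ => ENNReal.ofReal (t * μ ^ (t - 1)) := fun t => by
    fun_prop
  have e1 : ∀ k, ENNReal.ofReal (a k ^ r) = ∫⁻ μ in Set.Ioi 0,
      (Set.Ioo 0 (a k)).indicator (fun μ => ENNReal.ofReal (r * μ ^ (r - 1))) μ := fun k => by
    rw [← lintegral_Ioo_rpow hr (ha k), setLIntegral_indicator measurableSet_Ioo,
      Set.inter_eq_left.2 Set.Ioo_subset_Ioi_self]
  have e2 : ∀ i, ENNReal.ofReal (r / s * (w i * b i ^ s)) = ∫⁻ μ in Set.Ioi 0,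
      ENNReal.ofReal (r / s * w i) *
      (Set.Ioc 0 (b i)).indicator (fun μ => ENNReal.ofReal (s * μ ^ (s - 1))) μ := fun i => by
    rw [lintegral_const_mul _ ((meas s).indicator measurableSet_Ioc),
      setLIntegral_indicator measurableSet_Ioc, Set.inter_eq_left.2 Set.Ioc_subset_Ioi_self,
      lintegral_Ioc_rpow hs (hb i), ← ENNReal.ofReal_mul (mul_nonneg (by positivity) (hw i)),
      mul_assoc]
  simp_rw [e1, e2]
  rw [← lintegral_finsetSum _ fun k _ => (meas r).indicator measurableSet_Ioo,
    ← lintegral_finsetSum _ fun i _ =>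
      ((meas s).indicator measurableSet_Ioc).const_mul _]
  refine setLIntegral_mono' measurableSet_Ioi fun μ hμ => ?_
  have hμ : 0 < μ := hμ
  have f1 : ∀ k, (Set.Ioo 0 (a k)).indicator (fun μ => ENNReal.ofReal (r * μ ^ (r - 1))) μ =
      ENNReal.ofReal (if μ < a k then r * μ ^ (r - 1) else 0) := fun k => by
    by_cases hk : μ < a k
    · rw [if_pos hk, Set.indicator_of_mem (by exact ⟨hμ, hk⟩)]
    · rw [if_neg hk, Set.indicator_of_notMem (fun h => hk h.2), ENNReal.ofReal_zero]
  have f2 : ∀ i, ENNReal.ofReal (r / s * w i) *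
      (Set.Ioc 0 (b i)).indicator (fun μ => ENNReal.ofReal (s * μ ^ (s - 1))) μ =
      ENNReal.ofReal (r * μ ^ (r - 1) * if μ ≤ b i then w i * μ ^ (s - r) else 0) := fun i => by
    by_cases hk : μ ≤ b i
    · rw [if_pos hk, Set.indicator_of_mem (by exact ⟨hμ, hk⟩),
        ← ENNReal.ofReal_mul (mul_nonneg (by positivity) (hw i))]
      congr 1
      have : μ ^ (s - 1) = μ ^ (r - 1) * μ ^ (s - r) := by
        rw [← Real.rpow_add hμ]; congr 1; ring
      rw [this]
      field_simp
    · rw [if_neg hk, Set.indicator_of_notMem (fun h => hk h.2)]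
      simp
  simp_rw [f1, f2]
  have hμr : 0 ≤ r * μ ^ (r - 1) := by positivity
  rw [← ENNReal.ofReal_sum_of_nonneg, ← ENNReal.ofReal_sum_of_nonneg]
  · refine ENNReal.ofReal_le_ofReal ?_
    rw [← mul_sum, ← sum_filter, sum_const, nsmul_eq_mul, mul_comm]
    exact mul_le_mul_of_nonneg_left (h μ hμ) hμr
  · intro i _
    refine mul_nonneg hμr ?_
    split_ifs
    · exact mul_nonneg (hw i) (by positivity)
    · rfl
  · intro k _
    split_ifs
    · exact hμr
    · rfl

section Marcinkiewicz

variable {ι κ E F : Type*} [Fintype ι] [Fintype κ] [NormedAddCommGroup E] [NormedSpace ℂ E]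
  [NormedAddCommGroup F] [NormedSpace ℂ F] (T : (ι → E) →ₗ[ℂ] (κ → F)) {v q B : ℝ}

/-- The usual splitting of `y` at a height depending on the level `μ`. The large coordinates have
`ℓ^1` norm at most `μ`, so their image is at most `μ` everywhere, and the weak type bound is applied
to the small coordinates. The right side is linear in the numbers `‖y j‖ ^ q`, which is the form
that the layer-cake comparison integrates. -/
lemma card_le_of_weak_type (hv : 1 < v) (hvq : v < q) (hq : q ≤ 2) (hB : 0 ≤ B)
    (hw : ∀ y, ∀ c : ℝ, 0 < c →
      #{k | c ≤ ‖T y k‖} * c ^ (q / (q - 1)) ≤ B * (∑ j, ‖y j‖ ^ q) ^ (1 / (q - 1)))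
    (h1 : ∀ y k, ‖T y k‖ ≤ ∑ j, ‖y j‖) (y : ι → E) (hy : ∑ j, ‖y j‖ ^ v ≤ 1) {μ : ℝ}
    (hμ : 0 < μ) :
    (#{k | μ < ‖T y k‖ / 2} : ℝ) ≤ ∑ j, if μ ≤ ‖y j‖ ^ (-(v - 1)) then
      B * ‖y j‖ ^ q * μ ^ ((q - v) / (v - 1) - v / (v - 1)) else 0 := by
  classical
  have hv1 : 0 < v - 1 := by linarith
  have hq1 : 0 < q - 1 := by linarith
  -- The small coordinates: for `y j ≠ 0` the condition says `‖y j‖ ≤ μ ^ (-1 / (v - 1))`. A zero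
  -- coordinate fails it, because `0 ^ (-(v - 1))` is `0` by convention, but contributes nothing to
  -- either part.
  set y₁ : ι → E := fun j => if μ ≤ ‖y j‖ ^ (-(v - 1)) then y j else 0 with hy₁
  set y₂ : ι → E := fun j => if μ ≤ ‖y j‖ ^ (-(v - 1)) then 0 else y j with hy₂
  have hsum : y = y₁ + y₂ := by
    ext j; simp only [hy₁, hy₂, Pi.add_apply]; split_ifs <;> simp
  have hbig : ∀ k, ‖T y₂ k‖ ≤ μ := by
    intro k
    refine (h1 y₂ k).trans ?_
    calc ∑ j, ‖y₂ j‖ ≤ ∑ j, μ * ‖y j‖ ^ v := by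
          refine sum_le_sum fun j _ => ?_
          simp only [hy₂]
          split_ifs with h
          · rw [norm_zero]; positivity
          · rcases (norm_nonneg (y j)).eq_or_lt with h0 | h0
            · rw [← h0]; positivity
            · rw [not_le, Real.rpow_neg h0.le] at h
              have h3 : 0 < ‖y j‖ ^ (v - 1) := Real.rpow_pos_of_pos h0 _
              have h4 : 1 ≤ μ * ‖y j‖ ^ (v - 1) := by
                rw [inv_lt_iff_one_lt_mul₀ h3] at h
                linarith
              have h5 : ‖y j‖ ^ v = ‖y j‖ ^ (v - 1) * ‖y j‖ := by
                rw [← Real.rpow_add_one h0.ne']; congr 1; ring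
              rw [h5]
              nlinarith
      _ ≤ μ := by
          rw [← mul_sum]
          nlinarith
  set S := ∑ j, ‖y₁ j‖ ^ q with hS
  have hS0 : 0 ≤ S := sum_nonneg fun j _ => by positivity
  set κ' := (q - v) / (v - 1) with hκ'
  have hSle : S ≤ μ ^ (-κ') := by
    calc S ≤ ∑ j, ‖y j‖ ^ v * μ ^ (-κ') := by
          refine sum_le_sum fun j _ => ?_
          simp only [hy₁]
          split_ifs with h
          · rcases (norm_nonneg (y j)).eq_or_lt with h0 | h0
            · rw [← h0, Real.zero_rpow (by linarith)]; positivity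
            · have h3 := Real.rpow_le_rpow hμ.le h
                (div_nonneg (by linarith) hv1.le : 0 ≤ κ')
              rw [← Real.rpow_mul h0.le] at h3
              have h4 : -(v - 1) * κ' = -(q - v) := by rw [hκ']; field_simp
              rw [h4, Real.rpow_neg h0.le] at h3
              have h5 : ‖y j‖ ^ q = ‖y j‖ ^ v * ‖y j‖ ^ (q - v) := by
                rw [← Real.rpow_add h0]; congr 1; ring
              rw [h5, Real.rpow_neg hμ.le]
              gcongr
              rw [le_inv_comm₀ (by positivity) (by positivity)]
              exact h3
          · rw [norm_zero, Real.zero_rpow (by linarith)]; positivity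
      _ ≤ μ ^ (-κ') := by
          rw [← sum_mul]
          exact mul_le_of_le_one_left (by positivity) hy
  have hsub : (#{k | μ < ‖T y k‖ / 2} : ℝ) ≤ #{k | μ ≤ ‖T y₁ k‖} := by
    have : #{k | μ < ‖T y k‖ / 2} ≤ #{k | μ ≤ ‖T y₁ k‖} := by
      refine card_le_card fun k hk => ?_
      simp only [mem_filter, mem_univ, true_and] at hk ⊢
      have h3 : ‖T y k‖ ≤ ‖T y₁ k‖ + ‖T y₂ k‖ := by
        rw [hsum, map_add]; exact norm_add_le _ _
      linarith [hbig k]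
    exact_mod_cast this
  -- One factor `S` is kept and the rest is bounded by `hSle`; the remaining exponent is nonnegative
  -- because `q ≤ 2`.
  have hpow : S ^ (1 / (q - 1)) ≤ S * μ ^ (-κ' * (1 / (q - 1) - 1)) := by
    rcases hS0.eq_or_lt with h0 | h0
    · rw [← h0, Real.zero_rpow (by positivity), zero_mul]
    · have : S ^ (1 / (q - 1)) = S * S ^ (1 / (q - 1) - 1) := by
        rw [mul_comm, ← Real.rpow_add_one h0.ne']; congr 1; ring
      rw [this, Real.rpow_mul hμ.le]
      gcongr
      rw [sub_nonneg, one_le_div hq1]; linarith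
  have h6 := (hw y₁ μ hμ).trans (mul_le_mul_of_nonneg_left hpow hB)
  have h7 : (#{k | μ ≤ ‖T y₁ k‖} : ℝ) ≤ B * S * μ ^ (κ' - v / (v - 1)) := by
    have h8 : 0 < μ ^ (q / (q - 1)) := Real.rpow_pos_of_pos hμ _
    refine le_of_mul_le_mul_right ?_ h8
    refine h6.trans_eq ?_
    rw [mul_assoc (B * S), ← Real.rpow_add hμ, ← mul_assoc B S]
    congr 2
    rw [hκ']
    field_simp
    ring
  refine (hsub.trans h7).trans_eq ?_
  rw [hS, mul_sum, sum_mul]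
  refine sum_congr rfl fun j _ => ?_
  simp only [hy₁]
  split_ifs
  · rfl
  · rw [norm_zero, Real.zero_rpow (by linarith)]; simp

/-- Marcinkiewicz interpolation between weak type `(q, q')` and strong type `(1, ∞)`. -/
theorem strong_type_of_weak_type (hv : 1 < v) (hvq : v < q) (hq : q ≤ 2) (hB : 0 ≤ B)
    (hw : ∀ y, ∀ c : ℝ, 0 < c →
      #{k | c ≤ ‖T y k‖} * c ^ (q / (q - 1)) ≤ B * (∑ j, ‖y j‖ ^ q) ^ (1 / (q - 1)))
    (h1 : ∀ y k, ‖T y k‖ ≤ ∑ j, ‖y j‖) (y : ι → E) :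
    ∑ k, ‖T y k‖ ^ (v / (v - 1)) ≤
      2 ^ (v / (v - 1)) * (v / (q - v)) * B * (∑ j, ‖y j‖ ^ v) ^ (1 / (v - 1)) := by
  have hv1 : 0 < v - 1 := by linarith
  have hv0 : 0 < v := by linarith
  have hqv : 0 < q - v := by linarith
  set r := v / (v - 1) with hr
  have hr0 : 0 < r := by positivity
  have normalized : ∀ y : ι → E, ∑ j, ‖y j‖ ^ v ≤ 1 →
      ∑ k, ‖T y k‖ ^ r ≤ 2 ^ r * (v / (q - v)) * B := by
    intro y hy
    have h2 := sum_rpow_le_of_card_le hr0 (by positivity : 0 < (q - v) / (v - 1))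
      (a := fun k => ‖T y k‖ / 2) (b := fun j => ‖y j‖ ^ (-(v - 1)))
      (w := fun j => B * ‖y j‖ ^ q) (fun k => by positivity) (fun j => by positivity)
      (fun j => by positivity)
      (fun μ hμ => card_le_of_weak_type T hv hvq hq hB hw h1 y hy hμ)
    have h3 : ∑ j, B * ‖y j‖ ^ q * (‖y j‖ ^ (-(v - 1))) ^ ((q - v) / (v - 1)) ≤ B := by
      calc _ ≤ ∑ j, B * ‖y j‖ ^ v := by
            refine sum_le_sum fun j _ => ?_
            rcases (norm_nonneg (y j)).eq_or_lt with h0 | h0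
            · rw [← h0, Real.zero_rpow (by linarith), Real.zero_rpow (by linarith)]; simp [Real.zero_rpow hv0.ne']
            · rw [← Real.rpow_mul h0.le, mul_assoc, ← Real.rpow_add h0]
              refine le_of_eq ?_
              congr 2
              field_simp
              ring
        _ ≤ B := by rw [← mul_sum]; exact mul_le_of_le_one_right hB hy
    have h4 : ∑ k, ‖T y k‖ ^ r = 2 ^ r * ∑ k, (‖T y k‖ / 2) ^ r := by
      rw [mul_sum]
      refine sum_congr rfl fun k _ => ?_
      rw [← Real.mul_rpow (by norm_num) (by positivity)]
      congr 1; ring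
    rw [h4, mul_assoc]
    gcongr
    refine h2.trans ?_
    have h5 : r / ((q - v) / (v - 1)) = v / (q - v) := by rw [hr]; field_simp
    rw [h5]
    gcongr
  set A := ∑ j, ‖y j‖ ^ v with hA
  have hA0 : 0 ≤ A := sum_nonneg fun j _ => by positivity
  rcases hA0.eq_or_lt with h0 | h0
  · have hy0 : ∑ j, ‖y j‖ = 0 := by
      refine sum_eq_zero fun j _ => ?_
      have := (sum_eq_zero_iff_of_nonneg (fun j _ => by positivity)).1 (hA ▸ h0.symm) j
        (mem_univ j)
      exact ((Real.rpow_eq_zero (norm_nonneg _) hv0.ne').1 this)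
    have : ∑ k, ‖T y k‖ ^ r = 0 := sum_eq_zero fun k _ => by
      rw [le_antisymm ((h1 y k).trans_eq hy0) (norm_nonneg _), Real.zero_rpow hr0.ne']
    rw [this]
    positivity
  · set s := A ^ (1 / v) with hs
    have hs0 : 0 < s := by positivity
    have hsv : s ^ v = A := by
      rw [hs, ← Real.rpow_mul hA0, one_div_mul_cancel hv0.ne', Real.rpow_one]
    have hsr : s ^ r = A ^ (1 / (v - 1)) := by
      rw [hs, ← Real.rpow_mul hA0, hr]; congr 1; field_simp
    have hn := normalized (((s⁻¹ : ℝ) : ℂ) • y) (by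
      have : ∀ j, ‖(((s⁻¹ : ℝ) : ℂ) • y) j‖ ^ v = A⁻¹ * ‖y j‖ ^ v := fun j => by
        rw [Pi.smul_apply, norm_smul, Complex.norm_real, Real.norm_of_nonneg (by positivity),
          Real.mul_rpow (by positivity) (by positivity), Real.inv_rpow hs0.le, hsv]
      simp_rw [this]
      rw [← mul_sum, ← hA, inv_mul_cancel₀ h0.ne'])
    have : ∀ k, ‖T (((s⁻¹ : ℝ) : ℂ) • y) k‖ ^ r = (A ^ (1 / (v - 1)))⁻¹ * ‖T y k‖ ^ r := by
      intro k
      rw [map_smul, Pi.smul_apply, norm_smul, Complex.norm_real,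
        Real.norm_of_nonneg (by positivity), Real.mul_rpow (by positivity) (by positivity),
        Real.inv_rpow hs0.le, hsr]
    simp_rw [this] at hn
    rw [← mul_sum, inv_mul_le_iff₀ (by positivity)] at hn
    linarith

end Marcinkiewicz

end FourierDecomp
end

/-! ### Fourier type on `ℤ/N`, uniformly in `N`, and duality -/

noncomputable section
namespace FourierDecomp

open ZMod Finset

/-- The discrete Fourier transforms on `ℤ/N`, `N` prime, are bounded from `ℓ^v` to
(normalized) `L^{v'}` uniformly in `N`. -/
def HasDiscreteFourierType (E : Type*) [NormedAddCommGroup E] [NormedSpace ℂ E] (v : ℝ) : Prop :=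
  ∃ C : ℝ, 0 ≤ C ∧ ∀ (N : ℕ) [Fact N.Prime] (y : ZMod N → E),
    ∑ k, ‖dft y k‖ ^ (v / (v - 1)) ≤ C * N * (∑ j, ‖y j‖ ^ v) ^ (1 / (v - 1))

section

variable {E : Type*} [NormedAddCommGroup E] [NormedSpace ℂ E]

lemma norm_dft_le {N : ℕ} [NeZero N] (y : ZMod N → E) (k : ZMod N) :
    ‖dft y k‖ ≤ ∑ j, ‖y j‖ := by
  rw [dft_apply]
  refine (norm_sum_le _ _).trans_eq ?_
  simp [norm_smul]

theorem hasDiscreteFourierType_of_l1 {q v U : ℝ} (hv : 1 < v) (hvq : v < q) (hq : q ≤ 2)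
    (hU : 0 ≤ U)
    (H : ∀ (N : ℕ) [Fact N.Prime] (y : ZMod N → E),
      ∑ k, ‖dft y k‖ ≤ U * N * (∑ j, ‖y j‖ ^ q) ^ (1 / q)) :
    HasDiscreteFourierType E v := by
  have hq1 : 0 < q - 1 := by linarith
  have hq0 : 0 < q := by linarith
  have hqv : 0 < q - v := by linarith
  have hv1 : 0 < v - 1 := by linarith
  have hv0 : 0 < v := by linarith
  refine ⟨2 ^ (v / (v - 1)) * (v / (q - v)) * (16 * U) ^ (q / (q - 1)), by positivity,
    fun N hN y => ?_⟩
  have hNp : (0 : ℝ) < N := by exact_mod_cast NeZero.pos N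
  have hweak : ∀ y : ZMod N → E, ∀ c : ℝ, 0 < c →
      #{k | c ≤ ‖dft y k‖} * c ^ (q / (q - 1)) ≤
        ((16 * U) ^ (q / (q - 1)) * N) * (∑ j, ‖y j‖ ^ q) ^ (1 / (q - 1)) := by
    intro y c hc
    have hA : 0 ≤ ∑ j, ‖y j‖ ^ q := sum_nonneg fun j _ => by positivity
    rcases Nat.eq_zero_or_pos #{k | c ≤ ‖dft y k‖} with h0 | h0
    · rw [h0]; simp only [Nat.cast_zero, zero_mul]; positivity
    · have h1 := dft_weak_type (by linarith) hU (H N) y hc h0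
      have h0' : (0 : ℝ) < #{k | c ≤ ‖dft y k‖} := by exact_mod_cast h0
      have h2 := Real.rpow_le_rpow hc.le h1 (by positivity : 0 ≤ q / (q - 1))
      rw [Real.mul_rpow (by positivity) (by positivity),
        Real.mul_rpow (by positivity) (by positivity), ← Real.rpow_mul (by positivity),
        ← Real.rpow_mul hA] at h2
      have e1 : (1 - 1 / q) * (q / (q - 1)) = 1 := by field_simp
      have e2 : 1 / q * (q / (q - 1)) = 1 / (q - 1) := by field_simp
      rw [e1, e2, Real.rpow_one] at h2
      calc _ ≤ (#{k | c ≤ ‖dft y k‖} : ℝ) * _ := mul_le_mul_of_nonneg_left h2 h0'.le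
        _ = _ := by field_simp
  have h := strong_type_of_weak_type (dft : (ZMod N → E) ≃ₗ[ℂ] (ZMod N → E)).toLinearMap hv hvq
    hq (by positivity) hweak (fun y k => norm_dft_le y k) y
  refine h.trans_eq ?_
  ring

/-- The kernel of the transform is symmetric in its two variables, so the transform is its own
transpose. -/
lemma sum_apply_dft {N : ℕ} [NeZero N] (φ : ZMod N → E →L[ℂ] ℂ) (u : ZMod N → E) :
    ∑ k, φ k (dft u k) = ∑ j, (dft φ j) (u j) := by
  simp_rw [dft_apply, map_sum, _root_.map_smul, _root_.sum_apply]
  rw [sum_comm]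
  refine sum_congr rfl fun j _ => sum_congr rfl fun k _ => ?_
  rw [_root_.smul_apply, mul_comm]

/-- The norm of a functional need not be attained; the factor `1 / 2` avoids an approximation
argument. -/
lemma exists_apply_ge (ψ : E →L[ℂ] ℂ) : ∃ u : E, ‖u‖ ≤ 1 ∧ ‖ψ‖ / 2 ≤ (ψ u).re := by
  rcases (norm_nonneg ψ).eq_or_lt with h | h
  · exact ⟨0, by simp, by simp [← h]⟩
  · obtain ⟨x, hx, hψ⟩ := ψ.exists_lt_apply_of_lt_opNorm (half_lt_self h)
    have h0 : ψ x ≠ 0 := fun h0 => by rw [h0, norm_zero] at hψ; linarith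
    refine ⟨((starRingEnd ℂ) (ψ x) / ‖ψ x‖) • x, ?_, ?_⟩
    · rw [norm_smul, norm_div, Complex.norm_conj, Complex.norm_real, norm_norm,
        div_self (norm_ne_zero_iff.2 h0), one_mul]
      exact hx.le
    · have h1 : (‖ψ x‖ : ℂ) ≠ 0 := by exact_mod_cast norm_ne_zero_iff.2 h0
      have : ψ (((starRingEnd ℂ) (ψ x) / ‖ψ x‖) • x) = (‖ψ x‖ : ℝ) := by
        rw [_root_.map_smul, smul_eq_mul, div_mul_eq_mul_div, mul_comm, Complex.mul_conj',
          div_eq_iff h1]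
        ring
      rw [this, Complex.ofReal_re]
      exact hψ.le

/-- Duality: `ℓ^∞ → ℓ^s` bounds on `E` give `ℓ^{s'} → ℓ^1` bounds on the dual. -/
lemma sum_norm_dft_dual_le {N : ℕ} [NeZero N] {s s' L : ℝ} (hs : s.HolderConjugate s')
    (h : ∀ u : ZMod N → E, (∀ j, ‖u j‖ ≤ 1) → (∑ k, ‖dft u k‖ ^ s) ^ (1 / s) ≤ L * N)
    (φ : ZMod N → E →L[ℂ] ℂ) :
    ∑ k, ‖dft φ k‖ ≤ 2 * L * N * (∑ j, ‖φ j‖ ^ s') ^ (1 / s') := by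
  choose u hu hψ using fun j => exists_apply_ge (dft φ j)
  have hA : 0 ≤ (∑ j, ‖φ j‖ ^ s') ^ (1 / s') :=
    Real.rpow_nonneg (sum_nonneg fun j _ => by positivity) _
  calc ∑ k, ‖dft φ k‖ = 2 * ∑ k, ‖dft φ k‖ / 2 := by rw [← sum_div]; ring
    _ ≤ 2 * ∑ k, (dft φ k (u k)).re := by gcongr with k; exact hψ k
    _ = 2 * (∑ k, φ k (dft u k)).re := by rw [sum_apply_dft, Complex.re_sum]
    _ ≤ 2 * ∑ k, ‖dft u k‖ * ‖φ k‖ := by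
        gcongr
        refine (Complex.re_le_norm _).trans ((norm_sum_le _ _).trans ?_)
        refine sum_le_sum fun k _ => ?_
        rw [mul_comm]
        exact (φ k).le_opNorm _
    _ ≤ 2 * ((∑ k, ‖dft u k‖ ^ s) ^ (1 / s) * (∑ j, ‖φ j‖ ^ s') ^ (1 / s')) := by
        gcongr
        exact Real.inner_le_Lp_mul_Lq_of_nonneg univ hs (fun _ _ => norm_nonneg _)
          (fun _ _ => norm_nonneg _)
    _ ≤ 2 * (L * N * (∑ j, ‖φ j‖ ^ s') ^ (1 / s')) := by
        gcongr
        exact h u hu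
    _ = _ := by ring

/-- The transform of `y` is tested against the functionals extremal in Hölder's inequality. With `Z
= ∑ ‖dft y k‖ ^ r`, moving the transform to the functionals and applying the hypothesis gives `Z ^ r
≤ C N Z ^ (r - 1) (∑ ‖y j‖ ^ v) ^ (1 / (v - 1))`, and `Z ^ (r - 1)` cancels. -/
lemma HasDiscreteFourierType.of_dual {v : ℝ} (hv : 1 < v)
    (h : HasDiscreteFourierType (E →L[ℂ] ℂ) v) : HasDiscreteFourierType E v := by
  obtain ⟨C, hC, h⟩ := h
  refine ⟨C, hC, fun N hN y => ?_⟩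
  have hv1 : 0 < v - 1 := by linarith
  have hv0 : 0 < v := by linarith
  have hNp : (0 : ℝ) < N := by exact_mod_cast NeZero.pos N
  set r := v / (v - 1) with hr
  have hr0 : 0 < r := by positivity
  have hrv : r - 1 = 1 / (v - 1) := by rw [hr]; field_simp; ring
  have hr1 : 0 < r - 1 := by rw [hrv]; positivity
  have hconj : r.HolderConjugate v := (Real.holderConjugate_iff_eq_conjExponent hv).2 hr |>.symm
  choose g hg1 hg using fun x : E => exists_dual_vector'' ℂ x
  set φ : ZMod N → E →L[ℂ] ℂ := fun k => ((‖dft y k‖ ^ (r - 1) : ℝ) : ℂ) • g (dft y k) with hφ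
  have hφn : ∀ k, ‖φ k‖ ^ v ≤ ‖dft y k‖ ^ r := by
    intro k
    have h1 : ‖φ k‖ ≤ ‖dft y k‖ ^ (r - 1) := by
      simp only [hφ]
      rw [norm_smul, Complex.norm_real, Real.norm_of_nonneg (by positivity)]
      exact mul_le_of_le_one_right (by positivity) (hg1 _)
    calc ‖φ k‖ ^ v ≤ (‖dft y k‖ ^ (r - 1)) ^ v := by gcongr
      _ = ‖dft y k‖ ^ r := by
          rw [← Real.rpow_mul (norm_nonneg _)]
          congr 1
          rw [hrv, hr]; field_simp
  set Z := ∑ k, ‖dft y k‖ ^ r with hZ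
  have hZ0 : 0 ≤ Z := sum_nonneg fun k _ => by positivity
  have hY0 : 0 ≤ ∑ j, ‖y j‖ ^ v := sum_nonneg fun k _ => by positivity
  have hpair : ∑ k, φ k (dft y k) = (Z : ℂ) := by
    rw [hZ]; push_cast
    refine sum_congr rfl fun k _ => ?_
    simp only [hφ]
    rw [_root_.smul_apply, hg, smul_eq_mul]
    rcases (norm_nonneg (dft y k)).eq_or_lt with h0 | h0
    · rw [← h0, Real.zero_rpow hr0.ne']; simp
    · rw [show r = r - 1 + 1 by ring, Real.rpow_add_one h0.ne', show r - 1 + 1 - 1 = r - 1 by ring]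
      push_cast
      rfl
  have h1 : Z ≤ (∑ j, ‖dft φ j‖ ^ r) ^ (1 / r) * (∑ j, ‖y j‖ ^ v) ^ (1 / v) := by
    calc Z = ‖(Z : ℂ)‖ := by rw [Complex.norm_real, Real.norm_of_nonneg hZ0]
      _ ≤ ∑ j, ‖dft φ j‖ * ‖y j‖ := by
          rw [← hpair, sum_apply_dft]
          exact (norm_sum_le _ _).trans (sum_le_sum fun j _ => (dft φ j).le_opNorm _)
      _ ≤ _ := Real.inner_le_Lp_mul_Lq_of_nonneg univ hconj (fun _ _ => norm_nonneg _)
          (fun _ _ => norm_nonneg _)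
  have h2 : ∑ j, ‖dft φ j‖ ^ r ≤ C * N * Z ^ (1 / (v - 1)) := by
    refine (h N φ).trans ?_
    gcongr
    exact sum_le_sum fun k _ => hφn k
  rcases hZ0.eq_or_lt with h0 | h0
  · rw [← h0]; positivity
  · have h3 : Z ^ r ≤ C * N * Z ^ (1 / (v - 1)) * (∑ j, ‖y j‖ ^ v) ^ (1 / (v - 1)) := by
      calc Z ^ r ≤ ((∑ j, ‖dft φ j‖ ^ r) ^ (1 / r) * (∑ j, ‖y j‖ ^ v) ^ (1 / v)) ^ r := by
            gcongr
        _ = (∑ j, ‖dft φ j‖ ^ r) * (∑ j, ‖y j‖ ^ v) ^ (1 / (v - 1)) := by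
            have h4 : 0 ≤ ∑ j, ‖dft φ j‖ ^ r := sum_nonneg fun k _ => by positivity
            rw [Real.mul_rpow (by positivity) (by positivity), ← Real.rpow_mul h4,
              ← Real.rpow_mul hY0, one_div_mul_cancel hr0.ne', Real.rpow_one]
            congr 2
            rw [hr]; field_simp
        _ ≤ _ := by gcongr
    have h5 : Z ^ r = Z ^ (1 / (v - 1)) * Z := by
      rw [← hrv, ← Real.rpow_add_one h0.ne']; congr 1; ring
    rw [h5] at h3
    have h6 : 0 < Z ^ (1 / (v - 1)) := by positivity
    refine le_of_mul_le_mul_left (h3.trans_eq ?_) h6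
    ring

end

end FourierDecomp
end

/-! ### Sequence norms, trigonometric polynomials and the singleton partition -/

noncomputable section
namespace FourierDecomp

open Finset MeasureTheory AddCircle

section EllNorm

variable {ι κ : Type*}

lemma ellNorm_comp_le {g : ι → κ} (hg : Function.Injective g) (q : ℝ≥0∞) (a : κ → ℝ≥0∞) :
    ellNorm q (fun i => a (g i)) ≤ ellNorm q a := by
  unfold ellNorm
  split_ifs
  · exact iSup_le fun i => le_iSup a (g i)
  · exact ENNReal.rpow_le_rpow (ENNReal.tsum_comp_le_tsum_of_injective hg fun k => a k ^ q.toReal)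
      (by positivity)

lemma ellNorm_comp_eq {g : ι → κ} (hg : Function.Injective g) {q : ℝ≥0∞} (hq : q ≠ 0)
    {a : κ → ℝ≥0∞} (ha : ∀ k, k ∉ Set.range g → a k = 0) :
    ellNorm q (fun i => a (g i)) = ellNorm q a := by
  refine le_antisymm (ellNorm_comp_le hg q a) ?_
  unfold ellNorm
  split_ifs with h
  · refine iSup_le fun k => ?_
    by_cases hk : k ∈ Set.range g
    · obtain ⟨i, rfl⟩ := hk
      exact le_iSup (fun i => a (g i)) i
    · rw [ha k hk]; exact zero_le
  · have h0 : 0 < q.toReal := ENNReal.toReal_pos hq h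
    refine ENNReal.rpow_le_rpow (le_of_eq ?_) (by positivity)
    refine (hg.tsum_eq fun k hk => ?_).symm
    by_contra hk'
    exact hk (by simp only [ha k hk', ENNReal.zero_rpow_of_pos h0])

lemma ellNorm_mono (q : ℝ≥0∞) {a b : ι → ℝ≥0∞} (h : ∀ i, a i ≤ b i) :
    ellNorm q a ≤ ellNorm q b := by
  unfold ellNorm
  split_ifs
  · exact iSup_mono h
  · exact ENNReal.rpow_le_rpow (ENNReal.tsum_le_tsum fun i =>
      ENNReal.rpow_le_rpow (h i) ENNReal.toReal_nonneg) (by positivity)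

lemma ellNorm_enorm_eq_ofReal {E : Type*} [NormedAddCommGroup E] [Fintype ι] {q : ℝ≥0∞}
    (hq : q ≠ ∞) (x : ι → E) :
    ellNorm q (fun i => ‖x i‖ₑ) =
      ENNReal.ofReal ((∑ i, ‖x i‖ ^ q.toReal) ^ (1 / q.toReal)) := by
  unfold ellNorm
  rw [if_neg hq, tsum_fintype, ← ENNReal.ofReal_rpow_of_nonneg
    (sum_nonneg fun i _ => by positivity) (by positivity),
    ENNReal.ofReal_sum_of_nonneg fun i _ => by positivity]
  congr 1
  refine sum_congr rfl fun i _ => ?_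
  rw [← ENNReal.ofReal_rpow_of_nonneg (norm_nonneg _) ENNReal.toReal_nonneg, ofReal_norm]

end EllNorm

variable {X : Type*} [NormedAddCommGroup X] [NormedSpace ℂ X]

lemma exists_trigPoly_eq {ι : Type*} [Fintype ι] {n : ι → ℤ} (hn : Function.Injective n)
    (x : ι → X) : ∃ a : ℤ →₀ X, (trigPoly a = fun t => ∑ i, fourier (n i) t • x i) ∧
      (∀ i, a (n i) = x i) ∧
      ∀ q : ℝ≥0∞, q ≠ 0 → ellNorm q (fun m => ‖a m‖ₑ) = ellNorm q (fun i => ‖x i‖ₑ) := by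
  classical
  have hval : ∀ i, (Finsupp.mapDomain n (Finsupp.equivFunOnFinite.symm x)) (n i) = x i := fun i => by
    rw [Finsupp.mapDomain_apply hn]; rfl
  refine ⟨Finsupp.mapDomain n (Finsupp.equivFunOnFinite.symm x), ?_, hval, fun q hq => ?_⟩
  · ext t
    unfold trigPoly
    rw [Finsupp.sum_mapDomain_index (by simp) (by simp),
      Finsupp.sum_fintype _ _ (by simp)]
    rfl
  · rw [← ellNorm_comp_eq hn hq]
    · simp_rw [hval]
    · intro k hk
      rw [Finsupp.mapDomain_of_notMem_range _ _ hk, enorm_zero]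

lemma integral_fourier (n : ℤ) :
    ∫ t : UnitAddCircle, fourier n t ∂haarAddCircle = if n = 0 then 1 else 0 := by
  have h := congrFun (fourierCoeff_fourier (T := 1) n) 0
  rw [fourierCoeff] at h
  simp only [neg_zero, fourier_zero, one_smul] at h
  rw [h, Pi.single_apply]
  simp only [eq_comm]

lemma Continuous.integrable_haar {E : Type*} [NormedAddCommGroup E] {f : UnitAddCircle → E}
    (hf : Continuous f) : Integrable f haarAddCircle :=
  hf.integrable_of_hasCompactSupport (HasCompactSupport.of_compactSpace f)

lemma continuous_trigSum {ι : Type*} (s : Finset ι) (n : ι → ℤ) (x : ι → X) :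
    Continuous fun t : UnitAddCircle => ∑ i ∈ s, fourier (n i) t • x i :=
  continuous_finsetSum _ fun i _ => (fourier (n i)).continuous.smul continuous_const

lemma fourierCoeff_trigPoly [CompleteSpace X] (a : ℤ →₀ X) : fourierCoeff (trigPoly a) = a := by
  ext m
  have h : ∀ t : UnitAddCircle, fourier (-m) t • trigPoly a t =
      ∑ n ∈ a.support, fourier (n - m) t • a n := fun t => by
    rw [trigPoly, Finsupp.sum, smul_sum]
    refine sum_congr rfl fun n _ => ?_
    rw [smul_smul, ← fourier_add, neg_add_eq_sub]
  rw [fourierCoeff]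
  simp_rw [h]
  rw [integral_finsetSum _ fun n _ =>
    Continuous.integrable_haar (f := fun t => fourier (n - m) t • a n)
      ((fourier (n - m)).continuous.smul continuous_const)]
  simp_rw [integral_smul_const, integral_fourier, sub_eq_zero, ite_smul, one_smul, zero_smul]
  rw [sum_ite_eq']
  split_ifs with hm
  · rfl
  · exact (Finsupp.notMem_support_iff.1 hm).symm

lemma freqProj_singleton [CompleteSpace X] (n : ℤ) (a : ℤ →₀ X) :
    freqProj {n} (trigPoly a) = fun t => fourier n t • a n := by
  ext t
  unfold freqProj
  rw [finsum_eq_single _ n fun m hm => by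
    rw [Set.indicator_of_notMem (by simpa using hm), smul_zero]]
  rw [Set.indicator_of_mem (Set.mem_singleton n), fourierCoeff_trigPoly]

lemma circleNorm_fourier_smul {p : ℝ≥0∞} (hp : p ≠ 0) (n : ℤ) (x : X) :
    circleNorm p (fun t => fourier n t • x) = ‖x‖ₑ := by
  unfold circleNorm
  rw [eLpNorm_congr_norm_ae (g := fun _ => x), eLpNorm_const _ hp (NeZero.ne _), measure_univ,
    ENNReal.one_rpow, mul_one]
  refine Filter.Eventually.of_forall fun t => ?_
  rw [norm_smul, fourier_apply, Circle.norm_coe, one_mul]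

/-- The partition of `ℤ` into singletons. -/
def singletonPartition : Set (Set ℤ) := Set.range fun n : ℤ => ({n} : Set ℤ)

lemma isIntervalPartition_singletons : IsIntervalPartition singletonPartition := by
  refine ⟨⟨?_, fun n => ⟨{n}, ⟨⟨n, rfl⟩, rfl⟩, ?_⟩⟩, ?_⟩
  · rintro ⟨n, hn⟩
    exact Set.singleton_ne_empty n hn
  · rintro _ ⟨⟨m, rfl⟩, hm⟩
    simp only [Set.mem_singleton_iff] at hm
    rw [hm]
  · rintro _ ⟨n, rfl⟩
    exact Set.ordConnected_singleton

lemma ellNorm_singletons [CompleteSpace X] {p q : ℝ≥0∞} (hp : p ≠ 0) (hq : q ≠ 0)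
    (a : ℤ →₀ X) :
    ellNorm q (fun I : singletonPartition => circleNorm p (freqProj (I : Set ℤ) (trigPoly a))) =
      ellNorm q (fun n => ‖a n‖ₑ) := by
  have hinj : Function.Injective
      (fun n : ℤ => (⟨{n}, n, rfl⟩ : singletonPartition)) := fun m n h => by
    simpa using congrArg Subtype.val h
  rw [← ellNorm_comp_eq hinj hq]
  · simp_rw [freqProj_singleton, circleNorm_fourier_smul hp]
  · rintro ⟨_, n, rfl⟩ hk
    exact absurd ⟨n, rfl⟩ hk

/-- For singletons each `D_I f` is a single term `e_n x_n`, whose `L^p` norm is `‖x_n‖`. This and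
its lower counterpart are all that is extracted from the decomposition hypotheses. -/
theorem HasUpperDecompositions.circleNorm_le [CompleteSpace X] {p q : ℝ≥0∞} (hp : p ≠ 0)
    (hq : q ≠ 0) (h : HasUpperDecompositions X q p) :
    ∃ U : ℝ≥0, ∀ {ι : Type} [Fintype ι] {n : ι → ℤ}, Function.Injective n → ∀ x : ι → X,
      circleNorm p (fun t => ∑ i, fourier (n i) t • x i) ≤ U * ellNorm q (fun i => ‖x i‖ₑ) := by
  obtain ⟨U, -, hU⟩ := h
  refine ⟨U, fun {ι} _ n hn x => ?_⟩
  obtain ⟨a, ha, -, hnorm⟩ := exists_trigPoly_eq hn x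
  rw [← ha, ← hnorm q hq, ← ellNorm_singletons hp hq]
  exact hU _ isIntervalPartition_singletons _ ⟨a, rfl⟩

theorem HasLowerDecompositions.le_circleNorm [CompleteSpace X] {p q : ℝ≥0∞} (hp : p ≠ 0)
    (hq : q ≠ 0) (h : HasLowerDecompositions X q p) :
    ∃ L : ℝ≥0, ∀ {ι : Type} [Fintype ι] {n : ι → ℤ}, Function.Injective n → ∀ x : ι → X,
      ellNorm q (fun i => ‖x i‖ₑ) ≤ L * circleNorm p (fun t => ∑ i, fourier (n i) t • x i) := by
  obtain ⟨L, -, hL⟩ := h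
  refine ⟨L, fun {ι} _ n hn x => ?_⟩
  obtain ⟨a, ha, -, hnorm⟩ := exists_trigPoly_eq hn x
  rw [← ha, ← hnorm q hq, ← ellNorm_singletons hp hq]
  exact hL _ isIntervalPartition_singletons _ ⟨a, rfl⟩

/-! ### Fejér kernels on the circle -/

section Fejer

/-- The Fejér kernel on the circle. -/
def circleFejer (M : ℕ) (t : UnitAddCircle) : ℝ :=
  ‖∑ i ∈ range M, fourier (i : ℤ) t‖ ^ 2 / M

/-- The Fourier coefficients of the Fejér kernel. -/
def fejerCoeff (M : ℕ) (n : ℤ) : ℝ :=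
  #{x ∈ range M ×ˢ range M | (x.1 : ℤ) - x.2 = n} / M

lemma norm_fourier_apply (n : ℤ) (t : UnitAddCircle) : ‖fourier n t‖ = 1 := by
  rw [fourier_apply, Circle.norm_coe]

lemma fourier_apply_add (n : ℤ) (s t : UnitAddCircle) :
    (fourier n (s + t) : ℂ) = fourier n s * fourier n t := by
  simp only [fourier_apply, smul_add, toCircle_add, Circle.coe_mul]

lemma fourier_apply_neg (n : ℤ) (t : UnitAddCircle) :
    (fourier n (-t) : ℂ) = fourier (-n) t := by
  simp only [fourier_apply, smul_neg, neg_smul]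

lemma circleFejer_nonneg (M : ℕ) (t : UnitAddCircle) : 0 ≤ circleFejer M t := by
  unfold circleFejer; positivity

lemma circleFejer_le (M : ℕ) (t : UnitAddCircle) : circleFejer M t ≤ M := by
  have h : ‖∑ i ∈ range M, (fourier (i : ℤ) t : ℂ)‖ ≤ M := by
    refine (norm_sum_le _ _).trans ?_
    simp only [norm_fourier_apply, sum_const, card_range, nsmul_eq_mul, mul_one, le_refl]
  unfold circleFejer
  rcases Nat.eq_zero_or_pos M with rfl | hM
  · simp
  · rw [div_le_iff₀ (by exact_mod_cast hM), ← sq]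
    gcongr

lemma continuous_circleFejer (M : ℕ) : Continuous (circleFejer M) := by
  unfold circleFejer
  fun_prop

lemma coe_circleFejer (M : ℕ) (t : UnitAddCircle) :
    (circleFejer M t : ℂ) =
      (∑ x ∈ range M ×ˢ range M, fourier ((x.1 : ℤ) - x.2) t) / M := by
  unfold circleFejer
  push_cast
  rw [← Complex.mul_conj', map_sum, sum_mul_sum, ← sum_product']
  congr 1
  refine sum_congr rfl fun x _ => ?_
  rw [← fourier_neg, ← fourier_add, sub_eq_add_neg]

lemma integral_fourier_mul_circleFejer (M : ℕ) (n : ℤ) :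
    ∫ t, fourier (-n) t * (circleFejer M t : ℂ) ∂haarAddCircle = fejerCoeff M n := by
  have h : ∀ t : UnitAddCircle, fourier (-n) t * (circleFejer M t : ℂ) =
      (∑ x ∈ range M ×ˢ range M, fourier ((x.1 : ℤ) - x.2 - n) t) / M := fun t => by
    rw [coe_circleFejer, mul_div_assoc', mul_sum]
    congr 1
    refine sum_congr rfl fun x _ => ?_
    rw [← fourier_add, neg_add_eq_sub]
  simp_rw [h]
  rw [integral_div, integral_finsetSum _ fun x _ =>
    Continuous.integrable_haar (fourier _).continuous]
  simp_rw [integral_fourier, sub_eq_zero]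
  rw [sum_boole, fejerCoeff]
  push_cast
  rfl

lemma integral_circleFejer {M : ℕ} (hM : 0 < M) :
    ∫ t, circleFejer M t ∂haarAddCircle = 1 := by
  have h := integral_fourier_mul_circleFejer M 0
  simp only [neg_zero, fourier_zero, one_mul] at h
  rw [integral_complex_ofReal] at h
  have hc : #{x ∈ range M ×ˢ range M | (x.1 : ℤ) - x.2 = 0} = M := by
    have : {x ∈ range M ×ˢ range M | (x.1 : ℤ) - x.2 = 0} = (range M).diag := by
      ext x
      simp only [mem_filter, mem_product, mem_range, mem_diag]
      omega
    rw [this, diag_card, card_range]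
  have h' : ∫ t, circleFejer M t ∂haarAddCircle = fejerCoeff M 0 := by exact_mod_cast h
  rw [h', fejerCoeff, hc, div_self (by exact_mod_cast hM.ne')]

lemma le_fejerCoeff {M n : ℕ} (h : 2 * n ≤ M) (hM : 0 < M) : 1 / 2 ≤ fejerCoeff M n := by
  have hc : M - n ≤ #{x ∈ range M ×ˢ range M | (x.1 : ℤ) - x.2 = n} := by
    rw [← card_range (M - n)]
    refine card_le_card_of_injOn (fun i => (i + n, i)) ?_ ?_
    · intro i hi
      have : i < M - n := by simpa using hi
      simp only [coe_filter, mem_product, mem_range, Set.mem_ofPred_eq]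
      refine ⟨⟨by omega, by omega⟩, by push_cast; ring⟩
    · intro i _ j _ h
      exact (Prod.mk.inj h).2
  have h2 : M ≤ 2 * #{x ∈ range M ×ˢ range M | (x.1 : ℤ) - x.2 = n} := by omega
  have h3 : (M : ℝ) ≤ 2 * #{x ∈ range M ×ˢ range M | (x.1 : ℤ) - x.2 = n} := by
    exact_mod_cast h2
  have hM' : (0 : ℝ) < M := by exact_mod_cast hM
  rw [fejerCoeff, le_div_iff₀ hM']
  linarith

lemma circleFejer_eq_sum (M : ℕ) (t : UnitAddCircle) :
    (circleFejer M t : ℂ) = ∑ n ∈ Ioo (-M : ℤ) M, fourier n t * fejerCoeff M n := by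
  rw [coe_circleFejer, ← sum_fiberwise_of_maps_to (t := Ioo (-M : ℤ) M)
    (g := fun x : ℕ × ℕ => (x.1 : ℤ) - x.2), sum_div]
  · refine sum_congr rfl fun n _ => ?_
    rw [sum_congr rfl (fun x hx => by rw [(mem_filter.1 hx).2]), sum_const, fejerCoeff,
      nsmul_eq_mul]
    push_cast
    ring
  · intro x hx
    simp only [mem_product, mem_range] at hx
    simp only [mem_Ioo]
    omega

lemma integral_circleFejer_sub_mul (M : ℕ) (n : ℤ) (s : UnitAddCircle) :
    ∫ t, (circleFejer M (s - t) : ℂ) * fourier n t ∂haarAddCircle =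
      fejerCoeff M n * fourier n s := by
  rw [← integral_sub_left_eq_self (fun t => (circleFejer M (s - t) : ℂ) * fourier n t)
    haarAddCircle s, ← integral_fourier_mul_circleFejer, ← integral_mul_const]
  refine integral_congr_ae (Filter.Eventually.of_forall fun t => ?_)
  simp only [sub_sub_cancel]
  rw [sub_eq_add_neg, fourier_apply_add, fourier_apply_neg]
  ring

open ZMod in
lemma fourier_toAddCircle {N : ℕ} [NeZero N] (n : ℤ) (k : ZMod N) :
    (fourier n (toAddCircle k) : ℂ) = stdAddChar ((n : ZMod N) * k) := by
  rw [fourier_apply, ← map_zsmul, zsmul_eq_mul, stdAddChar_apply]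
  rfl

/-- Summing over translates by the `N`-th roots of unity keeps only the frequencies divisible by
`N`. Among pairs in `[0, 2N)²` at most `4N` are congruent modulo `N`, and the normalization
contributes the factor `N / (2N)`. -/
lemma sum_circleFejer_add_le {N : ℕ} [NeZero N] (t : UnitAddCircle) :
    ∑ k : ZMod N, circleFejer (2 * N) (t + ZMod.toAddCircle k) ≤ 2 * N := by
  have hN : (0 : ℝ) < N := by exact_mod_cast NeZero.pos N
  set P := range (2 * N) ×ˢ range (2 * N)
  have h : ((∑ k : ZMod N, circleFejer (2 * N) (t + ZMod.toAddCircle k) : ℝ) : ℂ) =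
      (∑ x ∈ P with (x.1 : ZMod N) = x.2, fourier ((x.1 : ℤ) - x.2) t) / 2 := by
    push_cast
    simp_rw [coe_circleFejer, fourier_apply_add, fourier_toAddCircle]
    rw [← sum_div, sum_comm]
    simp_rw [← mul_sum, sum_stdAddChar_mul]
    push_cast
    simp_rw [sub_eq_zero, mul_ite, mul_zero, ← sum_filter, ← sum_mul]
    have : (N : ℂ) ≠ 0 := by exact_mod_cast hN.ne'
    field_simp
    rfl
  have hcard : #{x ∈ P | (x.1 : ZMod N) = x.2} ≤ 4 * N := by
    have : #{x ∈ P | (x.1 : ZMod N) = x.2} ≤ #(range (2 * N) ×ˢ range 2) := by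
      refine card_le_card_of_injOn (fun x => (x.1, x.2 / N)) ?_ ?_
      · intro x hx
        simp only [P, coe_filter, mem_product, mem_range, Set.mem_ofPred_eq, coe_product,
          Set.mem_prod, mem_coe] at hx ⊢
        exact ⟨hx.1.1, Nat.div_lt_of_lt_mul (by linarith [hx.1.2])⟩
      · rintro ⟨i, j⟩ hx ⟨i', j'⟩ hx' he
        obtain ⟨h1, h2⟩ := Prod.mk.inj he
        simp only at h1 h2
        simp only [coe_filter, Set.mem_ofPred_eq] at hx hx'
        have h3 : (j : ZMod N) = j' := by rw [← hx.2, ← hx'.2, h1]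
        rw [ZMod.natCast_eq_natCast_iff] at h3
        have h4 : j = j' := by
          rw [← Nat.div_add_mod j N, ← Nat.div_add_mod j' N, h2, h3]
        rw [h1, h4]
    refine this.trans_eq ?_
    rw [card_product, card_range, card_range]; ring
  have hcard' : (#{x ∈ P | (x.1 : ZMod N) = x.2} : ℝ) ≤ 4 * N := by exact_mod_cast hcard
  have hnn : 0 ≤ ∑ k : ZMod N, circleFejer (2 * N) (t + ZMod.toAddCircle k) :=
    sum_nonneg fun k _ => circleFejer_nonneg _ _
  rw [← Real.norm_of_nonneg hnn, ← Complex.norm_real, h, norm_div]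
  have : ‖∑ x ∈ P with (x.1 : ZMod N) = x.2, (fourier ((x.1 : ℤ) - x.2) t : ℂ)‖ ≤
      #{x ∈ P | (x.1 : ZMod N) = x.2} := by
    refine (norm_sum_le _ _).trans_eq ?_
    simp only [norm_fourier_apply, sum_const, nsmul_eq_mul, mul_one]
  rw [Complex.norm_ofNat]
  linarith

end Fejer

end FourierDecomp
end

/-! ### From estimates on the circle to estimates on `ℤ/N` -/

noncomputable section
namespace FourierDecomp

open Finset MeasureTheory AddCircle

variable {X : Type*} [NormedAddCommGroup X] [NormedSpace ℂ X]

omit [NormedSpace ℂ X] in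
lemma circleNorm_one_eq {f : UnitAddCircle → X} (hf : Continuous f) :
    circleNorm 1 f = ENNReal.ofReal (∫ t, ‖f t‖ ∂haarAddCircle) := by
  unfold circleNorm
  rw [eLpNorm_one_eq_lintegral_enorm, ofReal_integral_norm_eq_lintegral_enorm]
  exact Continuous.integrable_haar hf

omit [NormedSpace ℂ X] in
lemma circleNorm_mono {p p' : ℝ≥0∞} (h : p ≤ p') {f : UnitAddCircle → X} (hf : Continuous f) :
    circleNorm p f ≤ circleNorm p' f :=
  eLpNorm_le_eLpNorm_of_exponent_le h hf.aestronglyMeasurable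

lemma val_intCast {N : ℕ} [NeZero N] (j : ZMod N) : (((j.val : ℕ) : ℤ) : ZMod N) = j := by
  simp

lemma val_injective {N : ℕ} [NeZero N] : Function.Injective fun j : ZMod N => ((j.val : ℕ) : ℤ) :=
  fun _ _ h => ZMod.val_injective N (Int.ofNat_inj.1 h)

lemma fourier_val_toAddCircle {N : ℕ} [NeZero N] (j k : ZMod N) :
    (fourier (j.val : ℤ) (-ZMod.toAddCircle k) : ℂ) = ZMod.stdAddChar (-(j * k)) := by
  rw [← map_neg, fourier_toAddCircle, val_intCast, mul_neg]

/-- A trigonometric polynomial of degree less than `N` is controlled in `L^1` at the `N`-th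
roots of unity. -/
lemma sum_norm_dft_le_of_l1 [CompleteSpace X] {q U : ℝ} (hU : 0 ≤ U) (hq : 1 ≤ q)
    {N : ℕ} [NeZero N]
    (h : ∀ x : ZMod N → X, ∫ t : UnitAddCircle, ‖∑ j, fourier (j.val : ℤ) t • x j‖ ∂haarAddCircle ≤
      U * (∑ j, ‖x j‖ ^ q) ^ (1 / q)) (y : ZMod N → X) :
    ∑ k, ‖ZMod.dft y k‖ ≤ 4 * U * N * (∑ j, ‖y j‖ ^ q) ^ (1 / q) := by
  have hNp : 0 < N := NeZero.pos N
  -- Order `2 * N` makes the coefficients at `0, …, N - 1` at least `1 / 2`. Dividing `y` by them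
  -- costs a factor `2`, and then `dft y` is exactly the set of samples of `circleFejer (2 * N) * f`
  -- (convolution) at the roots of unity.
  set c : ZMod N → ℝ := fun j => fejerCoeff (2 * N) j.val with hc
  have hc2 : ∀ j, 1 / 2 ≤ c j := fun j =>
    le_fejerCoeff (Nat.mul_le_mul_left 2 (ZMod.val_lt j).le) (by omega)
  have hc0 : ∀ j, 0 < c j := fun j => by linarith [hc2 j]
  set x : ZMod N → X := fun j => (((c j)⁻¹ : ℝ) : ℂ) • y j with hx
  have hxn : ∀ j, ‖x j‖ ≤ 2 * ‖y j‖ := fun j => by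
    simp only [hx]
    rw [norm_smul, Complex.norm_real, Real.norm_of_nonneg (inv_pos.2 (hc0 j)).le]
    gcongr
    rw [inv_le_comm₀ (hc0 j) (by norm_num)]
    linarith [hc2 j]
  set f : UnitAddCircle → X := fun t => ∑ j, fourier (j.val : ℤ) t • x j with hf
  have hfc : Continuous f := continuous_trigSum _ _ _
  have hK : ∀ s : UnitAddCircle, Continuous fun t => circleFejer (2 * N) (s - t) := fun s =>
    (continuous_circleFejer _).comp (continuous_const.sub continuous_id)
  have hrep : ∀ k : ZMod N, ZMod.dft y k = ∫ t, (circleFejer (2 * N) (-ZMod.toAddCircle k - t) : ℂ) • f t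
      ∂haarAddCircle := by
    intro k
    simp only [hf, smul_sum, smul_smul]
    rw [integral_finsetSum _ fun j _ => Continuous.integrable_haar
      (f := fun t => ((circleFejer (2 * N) (-ZMod.toAddCircle k - t) : ℂ) *
        fourier (j.val : ℤ) t) • x j)
      (((Complex.continuous_ofReal.comp (hK _)).mul (fourier _).continuous).smul
        continuous_const), ZMod.dft_apply]
    refine sum_congr rfl fun j _ => ?_
    rw [integral_smul_const, integral_circleFejer_sub_mul, fourier_val_toAddCircle]
    simp only [hx]
    rw [smul_smul]
    congr 1
    have : (c j : ℂ) ≠ 0 := by exact_mod_cast (hc0 j).ne'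
    change _ = (c j : ℂ) * _ * _
    push_cast
    field_simp
  have hint : ∀ k : ZMod N, Integrable (fun t => circleFejer (2 * N) (-ZMod.toAddCircle k - t) * ‖f t‖)
      haarAddCircle := fun k => Continuous.integrable_haar ((hK _).mul hfc.norm)
  calc ∑ k, ‖ZMod.dft y k‖
      ≤ ∑ k : ZMod N, ∫ t, circleFejer (2 * N) (-ZMod.toAddCircle k - t) * ‖f t‖
          ∂haarAddCircle := by
        refine sum_le_sum fun k _ => ?_
        rw [hrep]
        refine (norm_integral_le_integral_norm _).trans_eq ?_
        refine integral_congr_ae (Filter.Eventually.of_forall fun t => ?_)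
        simp only [norm_smul, Complex.norm_real]
        rw [Real.norm_of_nonneg (circleFejer_nonneg _ _)]
    _ = ∫ t, (∑ k : ZMod N, circleFejer (2 * N) (-t + ZMod.toAddCircle k)) * ‖f t‖
          ∂haarAddCircle := by
        rw [← integral_finsetSum _ fun k _ => hint k]
        refine integral_congr_ae (Filter.Eventually.of_forall fun t => ?_)
        simp only
        rw [← sum_mul]
        congr 1
        refine Fintype.sum_equiv (Equiv.neg _) _ _ fun k => ?_
        rw [Equiv.neg_apply, map_neg, neg_add_eq_sub]
    _ ≤ ∫ t, 2 * N * ‖f t‖ ∂haarAddCircle := by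
        refine integral_mono (Continuous.integrable_haar ?_)
          (Continuous.integrable_haar (continuous_const.mul hfc.norm)) fun t => ?_
        · exact (continuous_finsetSum _ fun k _ => (continuous_circleFejer _).comp
            (continuous_neg.add continuous_const)).mul hfc.norm
        · exact mul_le_mul_of_nonneg_right (sum_circleFejer_add_le _) (norm_nonneg _)
    _ = 2 * N * ∫ t, ‖f t‖ ∂haarAddCircle := integral_const_mul _ _
    _ ≤ 2 * N * (U * (∑ j, ‖x j‖ ^ q) ^ (1 / q)) := by gcongr; exact h x
    _ ≤ 2 * N * (U * (2 * (∑ j, ‖y j‖ ^ q) ^ (1 / q))) := by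
        gcongr
        have hA : 0 ≤ ∑ j, ‖y j‖ ^ q := sum_nonneg fun j _ => by positivity
        calc (∑ j, ‖x j‖ ^ q) ^ (1 / q) ≤ (2 ^ q * ∑ j, ‖y j‖ ^ q) ^ (1 / q) := by
              gcongr
              rw [mul_sum]
              refine sum_le_sum fun j _ => ?_
              rw [← Real.mul_rpow (by norm_num) (norm_nonneg _)]
              gcongr
              exact hxn j
          _ = 2 * (∑ j, ‖y j‖ ^ q) ^ (1 / q) := by
              rw [Real.mul_rpow (by positivity) hA, ← Real.rpow_mul (by norm_num),
                mul_one_div_cancel (by linarith), Real.rpow_one]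
    _ = _ := by ring

theorem sum_norm_dft_le_of_circleNorm_le [CompleteSpace X] {p q : ℝ≥0∞} (hp : 1 ≤ p)
    (hq : 1 ≤ q) (hq' : q ≠ ∞) {U : ℝ≥0}
    (h : ∀ {ι : Type} [Fintype ι] {n : ι → ℤ}, Function.Injective n → ∀ x : ι → X,
      circleNorm p (fun t => ∑ i, fourier (n i) t • x i) ≤ U * ellNorm q (fun i => ‖x i‖ₑ))
    {N : ℕ} [NeZero N] (y : ZMod N → X) :
    ∑ k, ‖ZMod.dft y k‖ ≤ 4 * U * N * (∑ j, ‖y j‖ ^ q.toReal) ^ (1 / q.toReal) := by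
  have hq1 : 1 ≤ q.toReal := by
    rw [← ENNReal.toReal_one]; exact ENNReal.toReal_mono hq' hq
  refine sum_norm_dft_le_of_l1 U.coe_nonneg hq1 (fun x => ?_) y
  have hc : Continuous fun t : UnitAddCircle => ∑ j : ZMod N, fourier (j.val : ℤ) t • x j :=
    continuous_trigSum _ _ _
  have h1 := (circleNorm_mono hp hc).trans (h val_injective x)
  rw [circleNorm_one_eq hc, ellNorm_enorm_eq_ofReal hq', ← ENNReal.ofReal_coe_nnreal,
    ← ENNReal.ofReal_mul U.coe_nonneg] at h1
  refine (ENNReal.ofReal_le_ofReal_iff ?_).1 h1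
  exact mul_nonneg U.coe_nonneg (Real.rpow_nonneg (sum_nonneg fun j _ => by positivity) _)

lemma ellNorm_smul_le {ι : Type*} {q : ℝ≥0∞} (hq : q ≠ 0) (c : ℝ≥0) (a : ι → ℝ≥0∞) :
    c * ellNorm q a = ellNorm q (fun i => c * a i) := by
  unfold ellNorm
  split_ifs with h
  · exact ENNReal.mul_iSup _ _
  · have h0 : 0 < q.toReal := ENNReal.toReal_pos hq h
    simp_rw [ENNReal.mul_rpow_of_nonneg _ _ h0.le]
    rw [ENNReal.tsum_mul_left, ENNReal.mul_rpow_of_nonneg _ _ (by positivity),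
      ← ENNReal.rpow_mul, mul_one_div_cancel h0.ne', ENNReal.rpow_one]

/-- Fejér bumps centred at the `N`-th roots of unity with coefficients `u` form a polynomial whose
coefficients are damped values of `dft u`, extended periodically. It is the test function for lower
decompositions, bounded by `2 * N` when all `‖u j‖ ≤ 1`. -/
lemma sum_circleFejer_sub_smul {N : ℕ} [NeZero N] (u : ZMod N → X) (t : UnitAddCircle) :
    ∑ j : ZMod N, (circleFejer (2 * N) (t - ZMod.toAddCircle j) : ℂ) • u j =
      ∑ n : Ioo (-(2 * N : ℕ) : ℤ) (2 * N : ℕ), fourier (n : ℤ) t •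
        ((fejerCoeff (2 * N) n : ℂ) • ZMod.dft u ((n : ℤ) : ZMod N)) := by
  rw [sum_coe_sort (Ioo (-(2 * N : ℕ) : ℤ) (2 * N : ℕ)) fun n : ℤ => (fourier n t : ℂ) •
    ((fejerCoeff (2 * N) n : ℂ) • ZMod.dft u (n : ZMod N))]
  simp_rw [circleFejer_eq_sum, ZMod.dft_apply, smul_sum, sum_smul]
  rw [sum_comm]
  refine sum_congr rfl fun n _ => sum_congr rfl fun j _ => ?_
  rw [smul_smul, smul_smul]
  congr 1
  rw [sub_eq_add_neg, fourier_apply_add, ← map_neg, fourier_toAddCircle, mul_neg, mul_comm j]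
  ring

lemma norm_sum_circleFejer_smul_le {N : ℕ} [NeZero N] (u : ZMod N → X) (hu : ∀ j, ‖u j‖ ≤ 1)
    (t : UnitAddCircle) :
    ‖∑ j : ZMod N, (circleFejer (2 * N) (t - ZMod.toAddCircle j) : ℂ) • u j‖ ≤ 2 * N := by
  refine (norm_sum_le _ _).trans ?_
  refine le_trans (sum_le_sum (g := fun j => circleFejer (2 * N) (t - ZMod.toAddCircle j))
    fun j _ => ?_) ?_
  · rw [norm_smul, Complex.norm_real, Real.norm_of_nonneg (circleFejer_nonneg _ _)]
    exact mul_le_of_le_one_right (circleFejer_nonneg _ _) (hu j)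
  · refine le_trans (le_of_eq ?_) (sum_circleFejer_add_le (N := N) t)
    refine Fintype.sum_equiv (Equiv.neg _) _ _ fun k => ?_
    rw [Equiv.neg_apply, map_neg, sub_eq_add_neg]

/-- The bump polynomial has `L^p` norm at most `2 * N` for every `p`, and at the frequencies `0, …,
N - 1` its coefficients have at least half the norm of `dft u`. These two factors `2` make up the
constant. -/
theorem ellNorm_dft_le_of_le_circleNorm {p q : ℝ≥0∞} (hq : 1 ≤ q) (hq' : q ≠ ∞) {L : ℝ≥0}
    (h : ∀ {ι : Type} [Fintype ι] {n : ι → ℤ}, Function.Injective n → ∀ x : ι → X,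
      ellNorm q (fun i => ‖x i‖ₑ) ≤ L * circleNorm p (fun t => ∑ i, fourier (n i) t • x i))
    {N : ℕ} [NeZero N] (u : ZMod N → X) (hu : ∀ j, ‖u j‖ ≤ 1) :
    (∑ k, ‖ZMod.dft u k‖ ^ q.toReal) ^ (1 / q.toReal) ≤ 4 * L * N := by
  have hNp : 0 < N := NeZero.pos N
  have hq0 : q ≠ 0 := (zero_lt_one.trans_le hq).ne'
  have h1 := h (ι := Ioo (-(2 * N : ℕ) : ℤ) (2 * N : ℕ)) (n := fun n => (n : ℤ))
    Subtype.val_injective fun n => (fejerCoeff (2 * N) n : ℂ) • ZMod.dft u ((n : ℤ) : ZMod N)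
  simp_rw [← sum_circleFejer_sub_smul] at h1
  have h2 : circleNorm p (fun t => ∑ j : ZMod N,
      (circleFejer (2 * N) (t - ZMod.toAddCircle j) : ℂ) • u j) ≤
      ENNReal.ofReal (2 * N) := by
    unfold circleNorm
    refine (eLpNorm_le_of_ae_bound (Filter.Eventually.of_forall
      (norm_sum_circleFejer_smul_le u hu))).trans_eq ?_
    simp
  have hmem : ∀ k : ZMod N, ((k.val : ℕ) : ℤ) ∈ Ioo (-(2 * N : ℕ) : ℤ) (2 * N : ℕ) := fun k => by
    have := ZMod.val_lt k
    rw [mem_Ioo]; constructor <;> omega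
  have h3 : ellNorm q (fun k : ZMod N => ((1 / 2 : ℝ≥0) : ℝ≥0∞) * ‖ZMod.dft u k‖ₑ) ≤
      ellNorm q (fun n : Ioo (-(2 * N : ℕ) : ℤ) (2 * N : ℕ) =>
        ‖(fejerCoeff (2 * N) n : ℂ) • ZMod.dft u ((n : ℤ) : ZMod N)‖ₑ) := by
    refine le_trans (ellNorm_mono q fun k => ?_) (ellNorm_comp_le
      (g := fun k : ZMod N => (⟨((k.val : ℕ) : ℤ), hmem k⟩ :
        Ioo (-(2 * N : ℕ) : ℤ) (2 * N : ℕ)))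
      (fun i j hij => val_injective (congrArg Subtype.val hij)) q _)
    simp only [val_intCast]
    rw [enorm_smul]
    gcongr
    rw [← ofReal_norm, Complex.norm_real, ← ENNReal.ofReal_coe_nnreal]
    refine ENNReal.ofReal_le_ofReal ((le_fejerCoeff (n := k.val) ?_ ?_).trans (le_abs_self _))
    · exact Nat.mul_le_mul_left 2 (ZMod.val_lt k).le
    · omega
  rw [← ellNorm_smul_le hq0, ellNorm_enorm_eq_ofReal hq'] at h3
  have h4 := h3.trans (h1.trans (mul_le_mul_right h2 _))
  rw [← ENNReal.ofReal_coe_nnreal, ← ENNReal.ofReal_coe_nnreal (p := L),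
    ← ENNReal.ofReal_mul (NNReal.coe_nonneg _), ← ENNReal.ofReal_mul (NNReal.coe_nonneg _),
    ENNReal.ofReal_le_ofReal_iff (by positivity)] at h4
  push_cast at h4
  linarith

end FourierDecomp
end

/-! ### Steinhaus sums; Fourier type, type and cotype from `ℤ/N` -/

noncomputable section
namespace FourierDecomp

open Finset MeasureTheory AddCircle

variable {X : Type*} [NormedAddCommGroup X] [NormedSpace ℂ X]

/-- The normalized Haar measure on the torus `𝕋^n`. -/
abbrev torusHaar (n : ℕ) : Measure (Fin n → UnitAddCircle) :=
  Measure.pi fun _ : Fin n => haarAddCircle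

/-- The random sum `∑ k, ε_k x_k`. -/
def steinhausSum {n : ℕ} (x : Fin n → X) (ω : Fin n → UnitAddCircle) : X :=
  ∑ k, fourier 1 (ω k) • x k

lemma rademacherNorm_eq {n : ℕ} (x : Fin n → X) :
    rademacherNorm x = eLpNorm (steinhausSum x) 2 (torusHaar n) := rfl

lemma continuous_steinhausSum {n : ℕ} (x : Fin n → X) : Continuous (steinhausSum x) :=
  continuous_finsetSum _ fun k _ =>
    ((fourier 1).continuous.comp (continuous_apply k)).smul continuous_const

lemma steinhausSum_add {n : ℕ} (x : Fin n → X) (ω τ : Fin n → UnitAddCircle) :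
    steinhausSum x (ω + τ) = ∑ k, (fourier 1 (ω k) * fourier 1 (τ k) : ℂ) • x k := by
  simp only [steinhausSum, Pi.add_apply, fourier_apply_add]

lemma lintegral_torus_add_right {n : ℕ} (G : (Fin n → UnitAddCircle) → ℝ≥0∞)
    (τ : Fin n → UnitAddCircle) : ∫⁻ ω, G (ω + τ) ∂torusHaar n = ∫⁻ ω, G ω ∂torusHaar n :=
  lintegral_add_right_eq_self G τ

lemma steinhausSum_add_zsmul {n : ℕ} (x : Fin n → X) (ω : Fin n → UnitAddCircle)
    (t : UnitAddCircle) : steinhausSum x (ω + fun k : Fin n => (k : ℤ) • t) =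
      ∑ k : Fin n, fourier (k : ℤ) t • (fourier 1 (ω k) : ℂ) • x k := by
  rw [steinhausSum_add]
  refine sum_congr rfl fun k _ => ?_
  rw [smul_smul, mul_comm]
  congr 2
  simp only [fourier_apply, one_smul]

/-- The translation `ω_k ↦ ω_k + k t` preserves Haar measure on the torus and multiplies `ε_k` by
`e_k(t)`. Averaging over `t` shows, for each fixed `ω`, a trigonometric polynomial whose
coefficients have norms `‖x k‖`. -/
lemma lintegral_rotate {n : ℕ} (x : Fin n → X) (s : ℝ) :
    ∫⁻ ω, ∫⁻ t : UnitAddCircle, ‖∑ k : Fin n, fourier (k : ℤ) t • (fourier 1 (ω k) : ℂ) • x k‖ₑ ^ s ∂haarAddCircle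
      ∂torusHaar n = ∫⁻ ω, ‖steinhausSum x ω‖ₑ ^ s ∂torusHaar n := by
  simp_rw [← steinhausSum_add_zsmul]
  rw [lintegral_lintegral_swap]
  · simp_rw [lintegral_torus_add_right fun ω => ‖steinhausSum x ω‖ₑ ^ s]
    simp
  · refine Continuous.aemeasurable ?_
    refine ENNReal.continuous_rpow_const.comp (Continuous.enorm ?_)
    refine (continuous_steinhausSum x).comp (continuous_fst.add ?_)
    exact continuous_pi fun k => (continuous_zsmul (k : ℤ)).comp continuous_snd

lemma natCast_injective_fin {n : ℕ} : Function.Injective fun k : Fin n => (k : ℤ) :=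
  fun _ _ h => Fin.ext (Int.ofNat_inj.1 h)

omit [NormedSpace ℂ X] in
lemma circleNorm_rpow_eq {s : ℝ} (hs : 0 < s) (f : UnitAddCircle → X) :
    circleNorm (ENNReal.ofReal s) f ^ s = ∫⁻ t, ‖f t‖ₑ ^ s ∂haarAddCircle := by
  unfold circleNorm
  rw [eLpNorm_eq_lintegral_rpow_enorm_toReal (by simpa using hs) ENNReal.ofReal_ne_top,
    ENNReal.toReal_ofReal hs.le, ← ENNReal.rpow_mul, one_div_mul_cancel hs.ne',
    ENNReal.rpow_one]

lemma eLpNorm_steinhausSum_rpow_eq {s : ℝ} (hs : 0 < s) {n : ℕ} (x : Fin n → X) :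
    eLpNorm (steinhausSum x) (ENNReal.ofReal s) (torusHaar n) ^ s =
      ∫⁻ ω, ‖steinhausSum x ω‖ₑ ^ s ∂torusHaar n := by
  rw [eLpNorm_eq_lintegral_rpow_enorm_toReal (by simpa using hs) ENNReal.ofReal_ne_top,
    ENNReal.toReal_ofReal hs.le, ← ENNReal.rpow_mul, one_div_mul_cancel hs.ne',
    ENNReal.rpow_one]

/-- Upper estimates for trigonometric polynomials transfer to Steinhaus sums. -/
lemma eLpNorm_steinhausSum_le {s : ℝ} (hs : 0 < s) {n : ℕ} (x : Fin n → X) {A : ℝ≥0∞}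
    (h : ∀ c : Fin n → ℂ, (∀ k, ‖c k‖ = 1) →
      circleNorm (ENNReal.ofReal s) (fun t => ∑ k : Fin n, fourier (k : ℤ) t • c k • x k) ≤ A) :
    eLpNorm (steinhausSum x) (ENNReal.ofReal s) (torusHaar n) ≤ A := by
  rw [← ENNReal.rpow_le_rpow_iff hs, eLpNorm_steinhausSum_rpow_eq hs, ← lintegral_rotate]
  calc _ ≤ ∫⁻ _, A ^ s ∂torusHaar n := by
        refine lintegral_mono fun ω => ?_
        rw [← circleNorm_rpow_eq hs]
        exact ENNReal.rpow_le_rpow (h _ fun k => norm_fourier_apply _ _) hs.le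
    _ = A ^ s := by simp

/-- Lower estimates for trigonometric polynomials transfer to Steinhaus sums. -/
lemma le_eLpNorm_steinhausSum {s : ℝ} (hs : 0 < s) {n : ℕ} (x : Fin n → X) {A : ℝ≥0∞} {L : ℝ≥0}
    (h : ∀ c : Fin n → ℂ, (∀ k, ‖c k‖ = 1) →
      A ≤ L * circleNorm (ENNReal.ofReal s) (fun t => ∑ k : Fin n, fourier (k : ℤ) t • c k • x k)) :
    A ≤ L * eLpNorm (steinhausSum x) (ENNReal.ofReal s) (torusHaar n) := by
  rw [← ENNReal.rpow_le_rpow_iff hs, ENNReal.mul_rpow_of_nonneg _ _ hs.le,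
    eLpNorm_steinhausSum_rpow_eq hs, ← lintegral_rotate,
    ← lintegral_const_mul' _ _ (ENNReal.rpow_ne_top_of_nonneg hs.le ENNReal.coe_ne_top)]
  calc A ^ s = ∫⁻ _, A ^ s ∂torusHaar n := by simp
    _ ≤ _ := by
        refine lintegral_mono fun ω => ?_
        rw [← circleNorm_rpow_eq hs, ← ENNReal.mul_rpow_of_nonneg _ _ hs.le]
        exact ENNReal.rpow_le_rpow (h _ fun k => norm_fourier_apply _ _) hs.le

section ConjExponent

variable {r : ℝ≥0∞}

lemma conjExponent_conjExponent (hr : 1 ≤ r) : r.conjExponent.conjExponent = r :=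
  have := ENNReal.HolderConjugate.conjExponent hr
  ENNReal.HolderConjugate.conjExponent_eq (h := this.symm)

lemma conjExponent_toReal (hr : 1 < r) (hr' : r < ∞) :
    r.conjExponent = ENNReal.ofReal (r.toReal / (r.toReal - 1)) := by
  lift r to ℝ≥0 using hr'.ne
  have h1 : 1 < r := by exact_mod_cast hr
  rw [← ENNReal.coe_conjExponent h1, ENNReal.coe_toReal]
  have : (r.conjExponent : ℝ) = r / (r - 1) := by
    rw [NNReal.conjExponent, NNReal.coe_div, NNReal.coe_sub h1.le, NNReal.coe_one]
  rw [← this, ENNReal.ofReal_coe_nnreal]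

end ConjExponent

lemma exists_prime_fact (n : ℕ) : ∃ N, n ≤ N ∧ Fact N.Prime := by
  obtain ⟨N, h1, h2⟩ := Nat.exists_infinite_primes n
  exact ⟨N, h1, ⟨h2⟩⟩

lemma trigPoly_eq_sum_valMinAbs {N : ℕ} [NeZero N] {a : ℤ →₀ X}
    (ha : ∀ n ∈ a.support, 2 * n.natAbs < N) (t : UnitAddCircle) :
    trigPoly a t = ∑ j : ZMod N, fourier j.valMinAbs t • a j.valMinAbs := by
  rw [trigPoly, Finsupp.sum_of_support_subset (s := univ.image (ZMod.valMinAbs (n := N))),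
    sum_image fun i _ j _ h => ZMod.injective_valMinAbs h]
  · intro n hn
    have := ha n hn
    refine mem_image.2 ⟨(n : ZMod N), mem_univ _, ?_⟩
    rw [ZMod.valMinAbs_spec]
    refine ⟨rfl, ?_, ?_⟩ <;> omega
  · simp

omit [NormedSpace ℂ X] in
lemma ellNorm_valMinAbs {N : ℕ} [NeZero N] {a : ℤ →₀ X}
    (ha : ∀ n ∈ a.support, 2 * n.natAbs < N) {q : ℝ≥0∞} (hq : q ≠ 0) :
    ellNorm q (fun j : ZMod N => ‖a j.valMinAbs‖ₑ) = ellNorm q (fun n => ‖a n‖ₑ) := by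
  refine ellNorm_comp_eq (a := fun n => ‖a n‖ₑ) ZMod.injective_valMinAbs hq fun k hk => ?_
  by_contra h
  have hk' : k ∈ a.support := by
    rw [Finsupp.mem_support_iff]
    exact fun h0 => h (by rw [h0, enorm_zero])
  refine hk ⟨(k : ZMod N), ?_⟩
  have := ha k hk'
  rw [ZMod.valMinAbs_spec]
  refine ⟨rfl, ?_, ?_⟩ <;> omega

/-- If `N` exceeds twice the degree, the frequencies embed in `ℤ/N` and the values of the polynomial
on a coset `t + (1/N)ℤ` form a discrete transform of the modulated coefficients. The discrete bound
holds on every coset; averaging over `t` gives the integral exactly, without a limit in `N`. -/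
theorem HasDiscreteFourierType.hasFourierType {v : ℝ} (hv : 1 < v)
    (h : HasDiscreteFourierType X v) :
    ∃ C : ℝ≥0, 0 < C ∧ ∀ a : ℤ →₀ X,
      circleNorm (ENNReal.ofReal (v / (v - 1))) (trigPoly a) ≤
        C * ellNorm (ENNReal.ofReal v) (fun n => ‖a n‖ₑ) := by
  obtain ⟨C, hC, h⟩ := h
  have hv1 : 0 < v - 1 := by linarith
  have hv0 : 0 < v := by linarith
  set r := v / (v - 1) with hr
  have hr0 : 0 < r := by positivity
  refine ⟨(C ^ (1 / r)).toNNReal + 1, by positivity, fun a => ?_⟩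
  obtain ⟨N, hN, hNp⟩ := exists_prime_fact (2 * (a.support.sup Int.natAbs) + 1)
  have ha : ∀ n ∈ a.support, 2 * n.natAbs < N := fun n hn => by
    have := le_sup (f := Int.natAbs) hn
    omega
  have hN0 : (0 : ℝ) < N := by exact_mod_cast NeZero.pos N
  set A := ∑ j : ZMod N, ‖a j.valMinAbs‖ ^ v with hA
  have hA0 : 0 ≤ A := sum_nonneg fun j _ => by positivity
  have hshift : ∀ t, ∑ k : ZMod N, ‖trigPoly a (t + ZMod.toAddCircle k)‖ ^ r ≤
      C * N * A ^ (1 / (v - 1)) := by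
    intro t
    have h1 := h N fun j => (fourier j.valMinAbs t : ℂ) • a j.valMinAbs
    simp_rw [norm_smul, norm_fourier_apply, one_mul] at h1
    refine le_trans (le_of_eq ?_) h1
    refine Fintype.sum_equiv (Equiv.neg _) _ _ fun k => ?_
    congr 2
    rw [trigPoly_eq_sum_valMinAbs ha, ZMod.dft_apply]
    refine sum_congr rfl fun j _ => ?_
    rw [smul_smul, fourier_apply_add, fourier_toAddCircle, ZMod.coe_valMinAbs, Equiv.neg_apply,
      mul_neg, neg_neg, mul_comm]
  have hcont : Continuous (trigPoly a) := by
    exact continuous_trigSum a.support (fun n => n) a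
  have key : ∫⁻ t, ‖trigPoly a t‖ₑ ^ r ∂haarAddCircle ≤
      ENNReal.ofReal (C * A ^ (1 / (v - 1))) := by
    have h2 : (N : ℝ≥0∞) * ∫⁻ t, ‖trigPoly a t‖ₑ ^ r ∂haarAddCircle =
        ∫⁻ t, ∑ k : ZMod N, ‖trigPoly a (t + ZMod.toAddCircle k)‖ₑ ^ r ∂haarAddCircle := by
      rw [lintegral_finsetSum']
      · simp_rw [lintegral_add_right_eq_self fun t => ‖trigPoly a t‖ₑ ^ r]
        simp [ZMod.card]
      · intro k _
        exact (ENNReal.continuous_rpow_const.comp (Continuous.enorm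
          (hcont.comp (continuous_id.add continuous_const)))).aemeasurable
    have h3 : (N : ℝ≥0∞) * ∫⁻ t, ‖trigPoly a t‖ₑ ^ r ∂haarAddCircle ≤
        N * ENNReal.ofReal (C * A ^ (1 / (v - 1))) := by
      rw [h2, ← ENNReal.ofReal_natCast, ← ENNReal.ofReal_mul hN0.le]
      refine (lintegral_mono (g := fun _ => ENNReal.ofReal (C * N * A ^ (1 / (v - 1))))
        fun t => ?_).trans_eq ?_
      · refine le_trans (le_of_eq ?_) (ENNReal.ofReal_le_ofReal (hshift t))
        rw [ENNReal.ofReal_sum_of_nonneg fun k _ => by positivity]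
        refine sum_congr rfl fun k _ => ?_
        rw [← ENNReal.ofReal_rpow_of_nonneg (norm_nonneg _) hr0.le, ofReal_norm]
      · rw [lintegral_const, measure_univ, mul_one]; congr 1; ring
    refine (ENNReal.mul_le_mul_iff_right ?_ ?_).1 h3
    · exact_mod_cast (NeZero.ne N)
    · exact ENNReal.natCast_ne_top N
  rw [← ENNReal.rpow_le_rpow_iff hr0, circleNorm_rpow_eq hr0]
  refine key.trans ?_
  rw [← ellNorm_valMinAbs ha (by simpa using hv0), ellNorm_enorm_eq_ofReal ENNReal.ofReal_ne_top,
    ENNReal.toReal_ofReal hv0.le, ← ENNReal.ofReal_coe_nnreal,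
    ← ENNReal.ofReal_mul (NNReal.coe_nonneg _), ENNReal.ofReal_rpow_of_nonneg
      (mul_nonneg (NNReal.coe_nonneg _) (by positivity)) hr0.le]
  refine ENNReal.ofReal_le_ofReal ?_
  rw [Real.mul_rpow (NNReal.coe_nonneg _) (by positivity), ← Real.rpow_mul hA0]
  have e1 : 1 / v * r = 1 / (v - 1) := by rw [hr]; field_simp
  rw [e1]
  gcongr
  calc C = (C ^ (1 / r)) ^ r := by
        rw [← Real.rpow_mul hC, one_div_mul_cancel hr0.ne', Real.rpow_one]
    _ ≤ _ := by
        gcongr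
        rw [NNReal.coe_add, Real.coe_toNNReal _ (by positivity)]
        simp

/-- The discrete inequality is applied to the transform of `(ε_k x_k)`: by inversion its left side
is a multiple of `∑ ‖x k‖ ^ r`. Each value of that transform is the Steinhaus sum at a translated
point of the torus, so integrating makes all `N` terms equal. The result is a bound by the `L^v`
norm, and `v ≤ 2` allows passing to `L^2`. -/
theorem HasDiscreteFourierType.hasCotype {v : ℝ} (hv : 1 < v) (hv2 : v ≤ 2)
    (h : HasDiscreteFourierType X v) : HasCotype X (ENNReal.ofReal (v / (v - 1))) := by
  obtain ⟨C, hC, h⟩ := h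
  have hv1 : 0 < v - 1 := by linarith
  have hv0 : 0 < v := by linarith
  set r := v / (v - 1) with hr
  have hr0 : 0 < r := by positivity
  refine ⟨(C ^ (1 / r)).toNNReal + 1, by positivity, fun n x => ?_⟩
  obtain ⟨N, hN, hNp⟩ := exists_prime_fact n
  have hN0 : (0 : ℝ) < N := by exact_mod_cast NeZero.pos N
  set ι : Fin n → ZMod N := fun k => ((k : ℕ) : ZMod N) with hι
  have hιinj : Function.Injective ι := fun i j hij => by
    have := congrArg ZMod.val hij
    simp only [hι] at this
    rw [ZMod.val_cast_of_lt (i.2.trans_le hN), ZMod.val_cast_of_lt (j.2.trans_le hN)] at this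
    exact Fin.ext this
  set A := ∑ k, ‖x k‖ ^ r with hA
  have hA0 : 0 ≤ A := sum_nonneg fun j _ => by positivity
  set z : (Fin n → UnitAddCircle) → ZMod N → X := fun ω m =>
    ∑ k, if ι k = m then (fourier 1 (ω k) : ℂ) • x k else 0 with hz
  have hzι : ∀ ω k, z ω (ι k) = (fourier 1 (ω k) : ℂ) • x k := fun ω k => by
    simp only [hz, hιinj.eq_iff, sum_ite_eq', mem_univ, if_true]
  have hdft : ∀ ω j, ZMod.dft (z ω) j =
      steinhausSum x (ω + fun k => ZMod.toAddCircle (-(ι k * j))) := by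
    intro ω j
    rw [steinhausSum_add, ZMod.dft_apply]
    simp only [hz, smul_sum, smul_ite, smul_zero]
    rw [sum_comm]
    refine sum_congr rfl fun k _ => ?_
    rw [sum_ite_eq, if_pos (mem_univ _), smul_smul, fourier_toAddCircle, Int.cast_one, one_mul,
      mul_comm]
  have hpt : ∀ ω, A ^ (v - 1) ≤ C ^ (v - 1) * (N : ℝ)⁻¹ * ∑ j, ‖ZMod.dft (z ω) j‖ ^ v := by
    intro ω
    have h1 := h N (ZMod.dft (z ω))
    rw [ZMod.dft_dft] at h1
    have hB : 0 ≤ ∑ j, ‖ZMod.dft (z ω) j‖ ^ v := sum_nonneg fun j _ => by positivity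
    have h2 : (N : ℝ) ^ r * A ≤ ∑ k : ZMod N, ‖(N : ℂ) • z ω (-k)‖ ^ r := by
      calc (N : ℝ) ^ r * A = ∑ k, ‖(N : ℂ) • z ω (ι k)‖ ^ r := by
            rw [hA, mul_sum]
            refine sum_congr rfl fun k _ => ?_
            rw [hzι, norm_smul, norm_smul, norm_fourier_apply, one_mul, Complex.norm_natCast,
              Real.mul_rpow hN0.le (norm_nonneg _)]
        _ = ∑ m ∈ univ.image ι, ‖(N : ℂ) • z ω m‖ ^ r :=
            (sum_image (f := fun m => ‖(N : ℂ) • z ω m‖ ^ r) fun i _ j _ hij => hιinj hij).symm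
        _ ≤ ∑ m, ‖(N : ℂ) • z ω m‖ ^ r :=
            sum_le_sum_of_subset_of_nonneg (subset_univ _) fun _ _ _ => by positivity
        _ = _ := (Equiv.sum_comp (Equiv.neg _) fun m => ‖(N : ℂ) • z ω m‖ ^ r).symm
    have h3 := Real.rpow_le_rpow (by positivity) (h2.trans h1) hv1.le
    rw [Real.mul_rpow (by positivity) hA0, Real.mul_rpow (by positivity) (by positivity),
      Real.mul_rpow hC hN0.le, ← Real.rpow_mul hB, one_div_mul_cancel hv1.ne', Real.rpow_one,
      ← Real.rpow_mul hN0.le, hr, div_mul_cancel₀ _ hv1.ne'] at h3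
    have e : (N : ℝ) ^ v = (N : ℝ) ^ (v - 1) * N := by
      rw [← Real.rpow_add_one hN0.ne']; congr 1; ring
    have h4 : 0 < (N : ℝ) ^ (v - 1) := by positivity
    rw [e] at h3
    have h5 : N * A ^ (v - 1) ≤ C ^ (v - 1) * ∑ j, ‖ZMod.dft (z ω) j‖ ^ v :=
      le_of_mul_le_mul_left (by linarith) h4
    rw [mul_assoc, mul_left_comm, ← div_eq_inv_mul, le_div_iff₀ hN0]
    linarith
  have hint : ENNReal.ofReal (A ^ (v - 1)) ≤
      ENNReal.ofReal (C ^ (v - 1)) * ∫⁻ ω, ‖steinhausSum x ω‖ₑ ^ v ∂torusHaar n := by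
    calc ENNReal.ofReal (A ^ (v - 1)) = ∫⁻ _, ENNReal.ofReal (A ^ (v - 1)) ∂torusHaar n := by simp
      _ ≤ ∫⁻ ω, ENNReal.ofReal (C ^ (v - 1) * (N : ℝ)⁻¹) * ∑ j : ZMod N, ‖steinhausSum x
            (ω + fun k => ZMod.toAddCircle (-(ι k * j)))‖ₑ ^ v ∂torusHaar n := by
          refine lintegral_mono fun ω => (ENNReal.ofReal_le_ofReal (hpt ω)).trans_eq ?_
          rw [ENNReal.ofReal_mul (by positivity),
            ENNReal.ofReal_sum_of_nonneg fun j _ => by positivity]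
          congr 1
          refine sum_congr rfl fun j _ => ?_
          rw [← ENNReal.ofReal_rpow_of_nonneg (norm_nonneg _) hv0.le, ofReal_norm, hdft]
      _ = ENNReal.ofReal (C ^ (v - 1) * (N : ℝ)⁻¹) *
            (N * ∫⁻ ω, ‖steinhausSum x ω‖ₑ ^ v ∂torusHaar n) := by
          rw [lintegral_const_mul' _ _ ENNReal.ofReal_ne_top, lintegral_finsetSum']
          · simp_rw [lintegral_torus_add_right fun ω => ‖steinhausSum x ω‖ₑ ^ v]
            simp [ZMod.card]
          · intro j _
            exact (ENNReal.continuous_rpow_const.comp (Continuous.enorm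
              ((continuous_steinhausSum x).comp
                (continuous_id.add continuous_const)))).aemeasurable
      _ = _ := by
          rw [← mul_assoc, ← ENNReal.ofReal_natCast, ← ENNReal.ofReal_mul (by positivity)]
          congr 2
          field_simp
  rw [← eLpNorm_steinhausSum_rpow_eq hv0] at hint
  have hrv : (v - 1) * (1 / v) = 1 / r := by rw [hr]; field_simp
  have h6 := ENNReal.rpow_le_rpow hint (by positivity : 0 ≤ 1 / v)
  rw [ENNReal.mul_rpow_of_nonneg _ _ (by positivity), ← ENNReal.rpow_mul,
    mul_one_div_cancel hv0.ne', ENNReal.rpow_one,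
    ENNReal.ofReal_rpow_of_nonneg (by positivity) (by positivity),
    ENNReal.ofReal_rpow_of_nonneg (by positivity) (by positivity),
    ← Real.rpow_mul hA0, ← Real.rpow_mul hC, hrv] at h6
  rw [ellNorm_enorm_eq_ofReal ENNReal.ofReal_ne_top, ENNReal.toReal_ofReal hr0.le]
  refine h6.trans ?_
  rw [rademacherNorm_eq]
  gcongr
  · rw [ENNReal.coe_add]
    exact le_self_add
  · refine eLpNorm_le_eLpNorm_of_exponent_le ?_ (continuous_steinhausSum x).aestronglyMeasurable
    rw [← ENNReal.ofReal_ofNat]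
    exact ENNReal.ofReal_le_ofReal hv2

/-- After rotation, Fourier type bounds the `L^{v'}` norm for every choice of unimodular factors;
`v' ≥ 2` makes it dominate the `L^2` norm. -/
theorem HasFourierType.hasType {v : ℝ≥0∞} (hv : v ≠ 0) (hv2 : 2 ≤ v.conjExponent)
    (h : HasFourierType X v) : HasType X v := by
  obtain ⟨C, hC, h⟩ := h
  refine ⟨C, hC, fun n x => ?_⟩
  have h2 : (2 : ℝ≥0∞) = ENNReal.ofReal 2 := by simp
  rw [rademacherNorm_eq, h2]
  refine eLpNorm_steinhausSum_le two_pos x fun c hc => ?_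
  obtain ⟨a, ha, -, hn⟩ := exists_trigPoly_eq natCast_injective_fin fun k => c k • x k
  have e : ∀ k, ‖c k • x k‖ₑ = ‖x k‖ₑ := fun k => by
    rw [← ofReal_norm, ← ofReal_norm, norm_smul, hc, one_mul]
  simp_rw [e] at hn
  rw [← ha, ← hn v hv]
  refine le_trans (circleNorm_mono (by rwa [← h2]) ?_) (h a)
  rw [ha]
  exact continuous_trigSum _ _ _

end FourierDecomp
end

/-! ### Hypercontractivity and Kahane's inequality -/

noncomputable section
namespace FourierDecomp

open Finset MeasureTheory AddCircle

lemma sq_integral_le {f : UnitAddCircle → ℝ} (hf : Continuous f) :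
    (∫ t, f t ∂haarAddCircle) ^ 2 ≤ ∫ t, f t ^ 2 ∂haarAddCircle := by
  set m := ∫ t, f t ∂haarAddCircle with hm
  have h : ∫ t, (f t - m) ^ 2 ∂haarAddCircle = (∫ t, f t ^ 2 ∂haarAddCircle) - m ^ 2 := by
    have e : ∀ t, (f t - m) ^ 2 = f t ^ 2 - 2 * m * f t + m ^ 2 := fun t => by ring
    simp_rw [e]
    rw [integral_add, integral_sub, integral_const_mul, ← hm]
    · simp; ring
    all_goals exact Continuous.integrable_haar (by fun_prop)
  have h0 : 0 ≤ ∫ t, (f t - m) ^ 2 ∂haarAddCircle := integral_nonneg fun t => sq_nonneg _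
  linarith

/-- A Taylor remainder of second order. The linear term is kept apart because it will be integrated
against a function of mean zero. -/
lemma abs_add_pow_sub_le (A w : ℝ) (hA : 0 ≤ A) (n : ℕ) :
    |(A + w) ^ (n + 2) - A ^ (n + 2) - (n + 2) * A ^ (n + 1) * w| ≤
      (n + 2) ^ 2 * w ^ 2 * (A + |w|) ^ n := by
  induction n with
  | zero =>
    have : (A + w) ^ (0 + 2) - A ^ (0 + 2) - (((0 : ℕ) : ℝ) + 2) * A ^ (0 + 1) * w = w ^ 2 := by
      push_cast; ring
    rw [this, abs_of_nonneg (sq_nonneg w)]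
    push_cast
    nlinarith [sq_nonneg w]
  | succ n ih =>
    have e : (A + w) ^ (n + 1 + 2) - A ^ (n + 1 + 2) - (((n + 1 : ℕ) : ℝ) + 2) * A ^ (n + 1 + 1) * w =
        (A + w) * ((A + w) ^ (n + 2) - A ^ (n + 2) - (n + 2) * A ^ (n + 1) * w) +
          (n + 2) * A ^ (n + 1) * w ^ 2 := by push_cast; ring
    rw [e]
    have h1 : |A + w| ≤ A + |w| := (abs_add_le _ _).trans_eq (by rw [abs_of_nonneg hA])
    have h2 : A ^ (n + 1) ≤ (A + |w|) ^ (n + 1) :=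
      pow_le_pow_left₀ hA (le_add_of_nonneg_right (abs_nonneg w)) _
    have h3 : 0 ≤ (A + |w|) ^ (n + 1) := by positivity
    calc _ ≤ |A + w| * |(A + w) ^ (n + 2) - A ^ (n + 2) - (n + 2) * A ^ (n + 1) * w| +
          (n + 2) * A ^ (n + 1) * w ^ 2 := by
          refine (abs_add_le _ _).trans_eq ?_
          rw [abs_mul, abs_of_nonneg (by positivity : 0 ≤ ((n : ℝ) + 2) * A ^ (n + 1) * w ^ 2)]
      _ ≤ (A + |w|) * ((n + 2) ^ 2 * w ^ 2 * (A + |w|) ^ n) +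
          (n + 2) * (A + |w|) ^ (n + 1) * w ^ 2 := by gcongr
      _ = ((n + 2) ^ 2 + (n + 2)) * w ^ 2 * (A + |w|) ^ (n + 1) := by ring
      _ ≤ _ := by
          gcongr
          push_cast
          nlinarith [(Nat.cast_nonneg n : (0 : ℝ) ≤ n)]

/-- The contraction constant in the hypercontractive inequality. -/
def hyperConst (k : ℕ) : ℝ := 1 / (4 * (k + 1) * 2 ^ (k + 1))

lemma hyperConst_pos (k : ℕ) : 0 < hyperConst k := by unfold hyperConst; positivity

lemma hyperConst_le (k : ℕ) : hyperConst k ≤ 1 / 4 := by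
  unfold hyperConst
  refine one_div_le_one_div_of_le (by norm_num) ?_
  have : (1 : ℝ) ≤ 2 ^ (k + 1) := one_le_pow₀ (by norm_num)
  nlinarith [(Nat.cast_nonneg k : (0 : ℝ) ≤ k)]

/-- A pointwise inequality behind hypercontractivity. -/
lemma add_pow_le_hyper {A v w : ℝ} (hA : 0 ≤ A) (hv : 0 ≤ v) (k : ℕ)
    (hw : |w| ≤ 2 * hyperConst k * v) :
    (A + w) ^ (2 * (k + 1)) ≤
      (A ^ 2 + v ^ 2) ^ (k + 1) + (2 * (k + 1)) * A ^ (2 * k + 1) * w := by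
  have h := (abs_le.1 (abs_add_pow_sub_le A w hA (2 * k))).2
  have hρ := hyperConst_pos k
  have hwv : |w| ≤ v := hw.trans (by nlinarith [hyperConst_le k])
  have h1 : w ^ 2 ≤ 4 * hyperConst k ^ 2 * v ^ 2 := by
    rw [← sq_abs]
    calc |w| ^ 2 ≤ (2 * hyperConst k * v) ^ 2 := by gcongr
      _ = _ := by ring
  have h2 : (A + |w|) ^ (2 * k) ≤ 2 ^ k * (A ^ 2 + v ^ 2) ^ k := by
    rw [pow_mul, ← mul_pow]
    gcongr
    calc (A + |w|) ^ 2 ≤ (A + v) ^ 2 := by gcongr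
      _ ≤ 2 * (A ^ 2 + v ^ 2) := by nlinarith [sq_nonneg (A - v)]
  -- The definition of `hyperConst` is made for this inequality; the left side equals `2 ^ k / 4 ^
  -- (k + 1)`.
  have h3 : ((2 * (k + 1) : ℝ)) ^ 2 * (4 * hyperConst k ^ 2) * 2 ^ k ≤ 1 := by
    have e : ((2 * (k + 1) : ℝ)) ^ 2 * (4 * hyperConst k ^ 2) * 2 ^ k =
        2 ^ k / (2 ^ (k + 1)) ^ 2 := by
      unfold hyperConst
      field_simp
      ring
    rw [e, div_le_one (by positivity), ← pow_mul]
    exact pow_le_pow_right₀ (by norm_num) (by omega)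
  have hB : 0 ≤ A ^ 2 + v ^ 2 := by positivity
  have h4 : ((2 * k : ℕ) + 2 : ℝ) ^ 2 * w ^ 2 * (A + |w|) ^ (2 * k) ≤
      v ^ 2 * (A ^ 2 + v ^ 2) ^ k := by
    calc ((2 * k : ℕ) + 2 : ℝ) ^ 2 * w ^ 2 * (A + |w|) ^ (2 * k)
        ≤ ((2 * k : ℕ) + 2 : ℝ) ^ 2 * (4 * hyperConst k ^ 2 * v ^ 2) *
            (2 ^ k * (A ^ 2 + v ^ 2) ^ k) := by gcongr
      _ = (((2 * (k + 1) : ℝ)) ^ 2 * (4 * hyperConst k ^ 2) * 2 ^ k) *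
            (v ^ 2 * (A ^ 2 + v ^ 2) ^ k) := by push_cast; ring
      _ ≤ _ := mul_le_of_le_one_left (by positivity) h3
  have h5 : A ^ (2 * k + 2) ≤ A ^ 2 * (A ^ 2 + v ^ 2) ^ k := by
    rw [show A ^ (2 * k + 2) = A ^ 2 * (A ^ 2) ^ k by rw [← pow_mul]; ring]
    gcongr
    nlinarith [sq_nonneg v]
  have h6 : (A ^ 2 + v ^ 2) ^ (k + 1) =
      A ^ 2 * (A ^ 2 + v ^ 2) ^ k + v ^ 2 * (A ^ 2 + v ^ 2) ^ k := by ring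
  rw [h6, show 2 * (k + 1) = 2 * k + 2 by ring]
  push_cast at h h4 ⊢
  linarith

section OneVariable

variable {X : Type*} [NormedAddCommGroup X] [NormedSpace ℂ X] [CompleteSpace X]

/-- Damping the first harmonic by `ρ` is convolution with `1 + 2ρ cos`, a probability density when
`ρ ≤ 1 / 2`; the triangle inequality then reduces the vector-valued problem to the scalar function
`‖x + e(t) y‖`. -/
lemma norm_add_smul_le_integral {ρ : ℝ} (hρ : 0 ≤ ρ) (hρ2 : ρ ≤ 1 / 2) (x y : X)
    (t : UnitAddCircle) :
    ‖x + (ρ : ℂ) • (fourier 1 t : ℂ) • y‖ ≤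
      ∫ s : UnitAddCircle, (1 + 2 * ρ * (fourier 1 s : ℂ).re) *
        ‖x + (fourier 1 (t + s) : ℂ) • y‖ ∂haarAddCircle := by
  have hκ : ∀ s : UnitAddCircle, ((1 + 2 * ρ * (fourier 1 s : ℂ).re : ℝ) : ℂ) =
      1 + ρ * (fourier 1 s + fourier (-1) s) := fun s => by
    rw [fourier_neg, Complex.add_conj]; push_cast; ring
  have hκ0 : ∀ s : UnitAddCircle, 0 ≤ 1 + 2 * ρ * (fourier 1 s : ℂ).re := fun s => by
    have h := Complex.abs_re_le_norm (fourier 1 s : ℂ)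
    rw [norm_fourier_apply] at h
    nlinarith [(abs_le.1 h).1]
  have hrep : x + (ρ : ℂ) • (fourier 1 t : ℂ) • y = ∫ s : UnitAddCircle,
      ((1 + 2 * ρ * (fourier 1 s : ℂ).re : ℝ) : ℂ) • (x + (fourier 1 (t + s) : ℂ) • y)
        ∂haarAddCircle := by
    have e : ∀ s : UnitAddCircle, ((1 + 2 * ρ * (fourier 1 s : ℂ).re : ℝ) : ℂ) •
        (x + (fourier 1 (t + s) : ℂ) • y) =
        (1 + ρ * (fourier 1 s + fourier (-1) s) : ℂ) • x +
        ((fourier 1 s + ρ * (fourier 2 s + fourier 0 s)) * fourier 1 t : ℂ) • y := fun s => by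
      rw [hκ, smul_add, smul_smul, fourier_apply_add, show (2 : ℤ) = 1 + 1 by norm_num,
        show (0 : ℤ) = -1 + 1 by norm_num, fourier_add, fourier_add]
      congr 2
      ring
    have c : ∀ n : ℤ, Integrable (fun s : UnitAddCircle => (fourier n s : ℂ)) haarAddCircle :=
      fun n => Continuous.integrable_haar (fourier n).continuous
    have i1 : ∫ s : UnitAddCircle, (1 + ρ * (fourier 1 s + fourier (-1) s) : ℂ) ∂haarAddCircle
        = 1 := by
      rw [integral_add, integral_const_mul, integral_add (c 1) (c (-1)), integral_fourier,
        integral_fourier]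
      · simp
      all_goals exact Continuous.integrable_haar (by fun_prop)
    have i2 : ∫ s : UnitAddCircle, (fourier 1 s + ρ * (fourier 2 s + fourier 0 s) : ℂ)
        ∂haarAddCircle = ρ := by
      rw [integral_add, integral_const_mul, integral_add (c 2) (c 0), integral_fourier,
        integral_fourier, integral_fourier]
      · simp
      all_goals exact Continuous.integrable_haar (by fun_prop)
    simp_rw [e]
    rw [integral_add, integral_smul_const, integral_smul_const, integral_mul_const, i1, i2,
      one_smul, smul_smul]
    · exact Continuous.integrable_haar (by fun_prop)
    · exact Continuous.integrable_haar (by fun_prop)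
  rw [hrep]
  refine (norm_integral_le_integral_norm _).trans_eq ?_
  refine integral_congr_ae (Filter.Eventually.of_forall fun s => ?_)
  simp only
  rw [norm_smul, Complex.norm_real, Real.norm_of_nonneg (hκ0 s)]

/-- Let `u(t) = ‖x + e(t) y‖` have mean `A` and variance `V`. The damped norm is at most `A + 2ρ
b(t)`, where `b` correlates `u` with the cosine: it has mean zero and is bounded by `√V`. In the
expansion of the power the linear term integrates to zero, and the rest is at most `(A ^ 2 + V) ^ (k
+ 1)`, where `A ^ 2 + V = ∫ u ^ 2`. -/
theorem integral_norm_pow_le_one_variable (k : ℕ) (x y : X) :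
    ∫ t : UnitAddCircle, ‖x + (hyperConst k : ℂ) • (fourier 1 t : ℂ) • y‖ ^ (2 * (k + 1))
        ∂haarAddCircle ≤
      (∫ t : UnitAddCircle, ‖x + (fourier 1 t : ℂ) • y‖ ^ 2 ∂haarAddCircle) ^ (k + 1) := by
  set ρ := hyperConst k with hρ
  have hρ0 : 0 ≤ ρ := (hyperConst_pos k).le
  have hρ2 : ρ ≤ 1 / 2 := (hyperConst_le k).trans (by norm_num)
  set u : UnitAddCircle → ℝ := fun t => ‖x + (fourier 1 t : ℂ) • y‖ with hu
  have huc : Continuous u := by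
    simp only [hu]; fun_prop
  set γ : UnitAddCircle → ℝ := fun s => (fourier 1 s : ℂ).re with hγ
  have hγc : Continuous γ := Complex.continuous_re.comp (fourier 1).continuous
  have hγ1 : ∀ s, |γ s| ≤ 1 := fun s =>
    (Complex.abs_re_le_norm _).trans_eq (norm_fourier_apply _ _)
  have hγ0 : ∫ s, γ s ∂haarAddCircle = 0 := by
    have h := integral_re (𝕜 := ℂ) (f := fun s : UnitAddCircle => (fourier 1 s : ℂ))
      (μ := haarAddCircle) (Continuous.integrable_haar (fourier 1).continuous)
    rw [integral_fourier] at h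
    exact h.trans (by simp)
  set A := ∫ t, u t ∂haarAddCircle with hA
  have hA0 : 0 ≤ A := integral_nonneg fun t => norm_nonneg _
  set V := ∫ t, (u t - A) ^ 2 ∂haarAddCircle with hV
  have hV0 : 0 ≤ V := integral_nonneg fun t => sq_nonneg _
  have hAV : ∫ t, u t ^ 2 ∂haarAddCircle = A ^ 2 + V := by
    have e : ∀ t, (u t - A) ^ 2 = u t ^ 2 - 2 * A * u t + A ^ 2 := fun t => by ring
    rw [hV]
    simp_rw [e]
    rw [integral_add, integral_sub, integral_const_mul, ← hA]
    · simp; ring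
    all_goals exact Continuous.integrable_haar (by fun_prop)
  set v := √V with hv
  have hv0 : 0 ≤ v := Real.sqrt_nonneg _
  have hv2 : v ^ 2 = V := Real.sq_sqrt hV0
  have hl1 : ∫ t, |u t - A| ∂haarAddCircle ≤ v := by
    refine Real.le_sqrt_of_sq_le ?_
    refine (sq_integral_le (by fun_prop)).trans_eq ?_
    simp_rw [sq_abs]
    rfl
  set b : UnitAddCircle → ℝ := fun t => ∫ s, γ s * u (t + s) ∂haarAddCircle with hb
  have hjoint : Continuous (Function.uncurry fun t s : UnitAddCircle => γ s * u (t + s)) := by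
    simp only [Function.uncurry_def]
    exact (hγc.comp continuous_snd).mul (huc.comp continuous_add)
  have hbc : Continuous b := by
    have := continuous_parametric_integral_of_continuous (μ := haarAddCircle) hjoint
      (isCompact_univ : IsCompact (Set.univ : Set UnitAddCircle))
    simpa only [Measure.restrict_univ] using this
  have hb0 : ∫ t, b t ∂haarAddCircle = 0 := by
    simp only [hb]
    rw [integral_integral_swap]
    · simp_rw [integral_const_mul]
      have : ∀ s, ∫ t, u (t + s) ∂haarAddCircle = A := fun s =>
        integral_add_right_eq_self u s
      simp_rw [this, integral_mul_const, hγ0, zero_mul]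
    · exact hjoint.integrable_of_hasCompactSupport (HasCompactSupport.of_compactSpace _)
  have hbb : ∀ t, |b t| ≤ v := by
    intro t
    have e : b t = ∫ s, γ s * (u (t + s) - A) ∂haarAddCircle := by
      simp_rw [mul_sub]
      rw [integral_sub, integral_mul_const, hγ0, zero_mul, sub_zero]
      all_goals exact Continuous.integrable_haar (by fun_prop)
    rw [e]
    refine (abs_integral_le_integral_abs).trans (le_trans ?_ hl1)
    rw [← integral_add_left_eq_self (fun s => |u s - A|) t]
    refine integral_mono (Continuous.integrable_haar (by fun_prop))
      (Continuous.integrable_haar (by fun_prop)) fun s => ?_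
    simp only
    rw [abs_mul]
    exact mul_le_of_le_one_left (abs_nonneg _) (hγ1 s)
  have hpt : ∀ t, ‖x + (ρ : ℂ) • (fourier 1 t : ℂ) • y‖ ^ (2 * (k + 1)) ≤
      (A ^ 2 + V) ^ (k + 1) + (2 * (k + 1)) * A ^ (2 * k + 1) * (2 * ρ * b t) := by
    intro t
    rw [← hv2]
    refine le_trans ?_ (add_pow_le_hyper hA0 hv0 k ?_)
    · refine pow_le_pow_left₀ (norm_nonneg _) ?_ _
      refine (norm_add_smul_le_integral hρ0 hρ2 x y t).trans_eq ?_
      have e : ∀ s : UnitAddCircle, (1 + 2 * ρ * (fourier 1 s : ℂ).re) *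
          ‖x + (fourier 1 (t + s) : ℂ) • y‖ = u (t + s) + 2 * ρ * (γ s * u (t + s)) :=
        fun s => by simp only [hu, hγ]; ring
      simp_rw [e]
      rw [integral_add, integral_const_mul, integral_add_left_eq_self u t]
      all_goals exact Continuous.integrable_haar (by fun_prop)
    · rw [abs_mul, abs_of_nonneg (by positivity : 0 ≤ 2 * ρ)]
      gcongr
      exact hbb t
  calc _ ≤ ∫ t, ((A ^ 2 + V) ^ (k + 1) + (2 * (k + 1)) * A ^ (2 * k + 1) * (2 * ρ * b t))
        ∂haarAddCircle := by
        refine integral_mono (Continuous.integrable_haar (by fun_prop))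
          (Continuous.integrable_haar (by fun_prop)) hpt
    _ = (A ^ 2 + V) ^ (k + 1) := by
        rw [integral_add, integral_const_mul, integral_const_mul, hb0]
        · simp
        all_goals exact Continuous.integrable_haar (by fun_prop)
    _ = _ := by rw [← hAV]

omit [NormedSpace ℂ X] [CompleteSpace X] in
lemma ofReal_integral_norm_pow {f : UnitAddCircle → X} (hf : Continuous f) (m : ℕ) :
    ENNReal.ofReal (∫ t, ‖f t‖ ^ m ∂haarAddCircle) = ∫⁻ t, ‖f t‖ₑ ^ m ∂haarAddCircle := by
  rw [ofReal_integral_eq_lintegral_ofReal (Continuous.integrable_haar (by fun_prop))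
    (Filter.Eventually.of_forall fun t => by positivity)]
  simp_rw [ENNReal.ofReal_pow (norm_nonneg _), ofReal_norm]

theorem lintegral_enorm_pow_le_one_variable (k : ℕ) (x y : X) :
    ∫⁻ t : UnitAddCircle, ‖x + (hyperConst k : ℂ) • (fourier 1 t : ℂ) • y‖ₑ ^ (2 * (k + 1))
        ∂haarAddCircle ≤
      (∫⁻ t : UnitAddCircle, ‖x + (fourier 1 t : ℂ) • y‖ₑ ^ 2 ∂haarAddCircle) ^ (k + 1) := by
  rw [← ofReal_integral_norm_pow (by fun_prop), ← ofReal_integral_norm_pow (by fun_prop),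
    ← ENNReal.ofReal_pow (integral_nonneg fun t => by positivity)]
  exact ENNReal.ofReal_le_ofReal (integral_norm_pow_le_one_variable k x y)

end OneVariable

variable {X : Type*} [NormedAddCommGroup X] [NormedSpace ℂ X]

lemma lintegral_torus_succ {n : ℕ} {H : UnitAddCircle × (Fin n → UnitAddCircle) → ℝ≥0∞}
    (hH : Continuous H) :
    ∫⁻ ω, H (ω 0, fun j => ω j.succ) ∂torusHaar (n + 1) =
      ∫⁻ t, ∫⁻ ω, H (t, ω) ∂torusHaar n ∂haarAddCircle := by
  have hmp := measurePreserving_piFinSuccAbove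
    (fun _ : Fin (n + 1) => (haarAddCircle : Measure UnitAddCircle)) 0
  have h := hmp.lintegral_comp hH.measurable
  rw [lintegral_prod _ hH.aemeasurable] at h
  exact h

lemma steinhausSum_succ {n : ℕ} (y : Fin (n + 1) → X) (ω : Fin (n + 1) → UnitAddCircle) :
    steinhausSum y ω = (fourier 1 (ω 0) : ℂ) • y 0 +
      steinhausSum (fun j => y j.succ) (fun j => ω j.succ) := by
  simp only [steinhausSum, Fin.sum_univ_succ]

/-- Hypercontractivity for vector-valued Steinhaus sums. -/
theorem lintegral_enorm_steinhausSum_pow_le [CompleteSpace X] (k n : ℕ) (x : X)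
    (y : Fin n → X) :
    ∫⁻ ω, ‖x + (hyperConst k : ℂ) • steinhausSum y ω‖ₑ ^ (2 * (k + 1)) ∂torusHaar n ≤
      (∫⁻ ω, ‖x + steinhausSum y ω‖ₑ ^ 2 ∂torusHaar n) ^ (k + 1) := by
  induction n generalizing x with
  | zero =>
    simp [steinhausSum, pow_mul]
  | succ n ih =>
    set ρ : ℂ := (hyperConst k : ℂ) with hρ
    set y' : Fin n → X := fun j => y j.succ with hy'
    have hS : Continuous (steinhausSum y') := continuous_steinhausSum y'
    have h1 : ∀ ω : Fin (n + 1) → UnitAddCircle, x + ρ • steinhausSum y ω =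
        (x + ρ • (fourier 1 (ω 0) : ℂ) • y 0) + ρ • steinhausSum y' fun j => ω j.succ :=
      fun ω => by rw [steinhausSum_succ, smul_add, add_assoc]
    have h2 : ∀ ω : Fin (n + 1) → UnitAddCircle, x + steinhausSum y ω =
        (x + (fourier 1 (ω 0) : ℂ) • y 0) + steinhausSum y' fun j => ω j.succ :=
      fun ω => by rw [steinhausSum_succ, add_assoc]
    simp_rw [h1, h2]
    rw [lintegral_torus_succ (H := fun p => ‖(x + ρ • (fourier 1 p.1 : ℂ) • y 0) +
        ρ • steinhausSum y' p.2‖ₑ ^ (2 * (k + 1))) (by fun_prop),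
      lintegral_torus_succ (H := fun p => ‖(x + (fourier 1 p.1 : ℂ) • y 0) +
        steinhausSum y' p.2‖ₑ ^ 2) (by fun_prop)]
    -- After the induction hypothesis in the last `n` variables, the inner integral is a squared
    -- norm in the Banach space `L^2(𝕋^n; X)`. The one-variable inequality in that space handles the
    -- first variable and takes the place of Minkowski's inequality.
    have hmem : MemLp (fun ω => x + steinhausSum y' ω) 2 (torusHaar n) :=
      (continuous_const.add hS).memLp_of_hasCompactSupport (HasCompactSupport.of_compactSpace _)
    have hmem0 : MemLp (fun _ : Fin n → UnitAddCircle => y 0) 2 (torusHaar n) := memLp_const _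
    have hL : ∀ c : ℂ, ‖hmem.toLp + c • hmem0.toLp‖ₑ ^ 2 =
        ∫⁻ ω, ‖(x + c • y 0) + steinhausSum y' ω‖ₑ ^ 2 ∂torusHaar n := by
      intro c
      rw [← MemLp.toLp_const_smul, ← MemLp.toLp_add, Lp.enorm_toLp]
      have := eLpNorm_nnreal_pow_eq_lintegral (p := 2) (μ := torusHaar n)
        (f := (fun ω => x + steinhausSum y' ω) + c • fun _ => y 0) two_ne_zero
      norm_num at this
      rw [this]
      refine lintegral_congr fun ω => ?_
      rw [add_right_comm]
    calc _ ≤ ∫⁻ t, (∫⁻ ω, ‖(x + ρ • (fourier 1 t : ℂ) • y 0) + steinhausSum y' ω‖ₑ ^ 2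
          ∂torusHaar n) ^ (k + 1) ∂haarAddCircle := lintegral_mono fun t => ih _ _
      _ = ∫⁻ t : UnitAddCircle, ‖hmem.toLp + ρ • (fourier 1 t : ℂ) • hmem0.toLp‖ₑ ^ (2 * (k + 1))
          ∂haarAddCircle := by
          refine lintegral_congr fun t => ?_
          have h := hL (ρ * fourier 1 t)
          rw [mul_smul, mul_smul] at h
          rw [pow_mul, h]
      _ ≤ (∫⁻ t : UnitAddCircle, ‖hmem.toLp + (fourier 1 t : ℂ) • hmem0.toLp‖ₑ ^ 2
          ∂haarAddCircle) ^ (k + 1) := lintegral_enorm_pow_le_one_variable k _ _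
      _ = _ := by simp_rw [hL]

/-- Kahane's inequality: the even moments of a Steinhaus sum are bounded by the second one. -/
theorem lintegral_enorm_steinhausSum_pow_le_second [CompleteSpace X] (k : ℕ) :
    ∃ K : ℝ≥0, ∀ (n : ℕ) (y : Fin n → X),
      ∫⁻ ω, ‖steinhausSum y ω‖ₑ ^ (2 * (k + 1)) ∂torusHaar n ≤
        K * (∫⁻ ω, ‖steinhausSum y ω‖ₑ ^ 2 ∂torusHaar n) ^ (k + 1) := by
  have hρ := hyperConst_pos k
  refine ⟨((hyperConst k)⁻¹ ^ (2 * (k + 1))).toNNReal, fun n y => ?_⟩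
  have h := lintegral_enorm_steinhausSum_pow_le k n 0 y
  simp_rw [zero_add, enorm_smul, mul_pow] at h
  rw [lintegral_const_mul' _ _ (by finiteness)] at h
  have h1 : ((((hyperConst k)⁻¹ ^ (2 * (k + 1))).toNNReal : ℝ≥0) : ℝ≥0∞) *
      ‖(hyperConst k : ℂ)‖ₑ ^ (2 * (k + 1)) = 1 := by
    rw [← ofReal_norm, Complex.norm_real, Real.norm_of_nonneg hρ.le,
      ← ENNReal.ofReal_pow hρ.le]
    change ENNReal.ofReal _ * _ = 1
    rw [← ENNReal.ofReal_mul (by positivity), ← mul_pow, inv_mul_cancel₀ hρ.ne', one_pow,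
      ENNReal.ofReal_one]
  calc _ = _ * ‖(hyperConst k : ℂ)‖ₑ ^ (2 * (k + 1)) *
        ∫⁻ ω, ‖steinhausSum y ω‖ₑ ^ (2 * (k + 1)) ∂torusHaar n := by rw [h1, one_mul]
    _ ≤ _ := by rw [mul_assoc]; gcongr

theorem eLpNorm_steinhausSum_le_rademacherNorm [CompleteSpace X] {p : ℝ≥0∞} (hp : p ≠ ∞) :
    ∃ (s : ℝ) (K : ℝ≥0), 0 < s ∧ p ≤ ENNReal.ofReal s ∧ ∀ (n : ℕ) (y : Fin n → X),
      eLpNorm (steinhausSum y) (ENNReal.ofReal s) (torusHaar n) ≤ K * rademacherNorm y := by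
  obtain ⟨k, hk⟩ := ENNReal.exists_nat_gt hp
  obtain ⟨K, hK⟩ := lintegral_enorm_steinhausSum_pow_le_second (X := X) k
  set s : ℝ := ((2 * (k + 1) : ℕ) : ℝ) with hs
  have hs0 : 0 < s := by positivity
  refine ⟨s, K ^ (1 / s), hs0, hk.le.trans ?_, fun n y => ?_⟩
  · rw [hs, ENNReal.ofReal_natCast]
    exact_mod_cast (by omega : k ≤ 2 * (k + 1))
  · rw [← ENNReal.rpow_le_rpow_iff hs0, eLpNorm_steinhausSum_rpow_eq hs0,
      ENNReal.mul_rpow_of_nonneg _ _ hs0.le, ← ENNReal.coe_rpow_of_nonneg _ hs0.le,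
      ← NNReal.rpow_mul, one_div_mul_cancel hs0.ne', NNReal.rpow_one]
    have h := hK n y
    have e2 : rademacherNorm y ^ s = (∫⁻ ω, ‖steinhausSum y ω‖ₑ ^ 2 ∂torusHaar n) ^ (k + 1) := by
      have h2 := eLpNorm_nnreal_pow_eq_lintegral (p := 2) (μ := torusHaar n)
        (f := steinhausSum y) two_ne_zero
      norm_num at h2
      rw [← h2, ← pow_mul, hs, ENNReal.rpow_natCast, rademacherNorm_eq]
    rw [e2]
    simpa only [hs, ENNReal.rpow_natCast] using h

/-- Hölder's inequality bounds the second moment by the first and the fourth, and the fourth is at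
most a constant times the square of the second. Cubing and cancelling the square of the second
moment leaves the first. -/
theorem rademacherNorm_le_eLpNorm_one [CompleteSpace X] :
    ∃ K : ℝ≥0, ∀ (n : ℕ) (y : Fin n → X),
      rademacherNorm y ≤ K * eLpNorm (steinhausSum y) 1 (torusHaar n) := by
  obtain ⟨K, hK⟩ := lintegral_enorm_steinhausSum_pow_le_second (X := X) 1
  refine ⟨K ^ (1 / 2 : ℝ), fun n y => ?_⟩
  have hc := continuous_steinhausSum y
  set a1 := ∫⁻ ω, ‖steinhausSum y ω‖ₑ ∂torusHaar n with ha1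
  set a2 := ∫⁻ ω, ‖steinhausSum y ω‖ₑ ^ 2 ∂torusHaar n with ha2
  have h2 := eLpNorm_nnreal_pow_eq_lintegral (p := 2) (μ := torusHaar n)
    (f := steinhausSum y) two_ne_zero
  norm_num at h2
  have hfin : a2 ≠ ∞ := by
    rw [ha2, ← h2]
    have : MemLp (steinhausSum y) 2 (torusHaar n) :=
      hc.memLp_of_hasCompactSupport (HasCompactSupport.of_compactSpace _)
    exact ENNReal.pow_ne_top this.2.ne
  have hconj : (3 / 2 : ℝ).HolderConjugate 3 := by
    rw [Real.holderConjugate_iff]; norm_num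
  have hH : a2 ≤ a1 ^ (2 / 3 : ℝ) * (K * a2 ^ 2) ^ (1 / 3 : ℝ) := by
    have h := ENNReal.lintegral_mul_le_Lp_mul_Lq (torusHaar n) hconj
      (f := fun ω => ‖steinhausSum y ω‖ₑ ^ (2 / 3 : ℝ))
      (g := fun ω => ‖steinhausSum y ω‖ₑ ^ (4 / 3 : ℝ))
      (ENNReal.continuous_rpow_const.comp hc.enorm).aemeasurable
      (ENNReal.continuous_rpow_const.comp hc.enorm).aemeasurable
    have e1 : ∀ z : ℝ≥0∞, z ^ (2 / 3 : ℝ) * z ^ (4 / 3 : ℝ) = z ^ 2 := fun z => by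
      rw [← ENNReal.rpow_add_of_nonneg _ _ (by norm_num) (by norm_num), ← ENNReal.rpow_two]
      norm_num
    have e2 : ∀ z : ℝ≥0∞, (z ^ (2 / 3 : ℝ)) ^ (3 / 2 : ℝ) = z := fun z => by
      rw [← ENNReal.rpow_mul]; norm_num
    have e3 : ∀ z : ℝ≥0∞, (z ^ (4 / 3 : ℝ)) ^ (3 : ℝ) = z ^ 4 := fun z => by
      rw [← ENNReal.rpow_mul, ← ENNReal.rpow_natCast]; norm_num
    simp only [Pi.mul_apply, e1, e2, e3] at h
    refine h.trans ?_
    rw [show (1 / (3 / 2) : ℝ) = 2 / 3 by norm_num]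
    gcongr
    exact hK n y
  have hfinal : a2 ≤ K * a1 ^ 2 := by
    rcases eq_or_ne a2 0 with h0 | h0
    · rw [h0]; exact zero_le
    · have h3 := ENNReal.rpow_le_rpow hH (by norm_num : (0 : ℝ) ≤ 3)
      rw [ENNReal.mul_rpow_of_nonneg _ _ (by norm_num), ← ENNReal.rpow_mul, ← ENNReal.rpow_mul] at h3
      norm_num at h3
      have h4 : a2 ^ 2 * a2 ≤ a2 ^ 2 * (K * a1 ^ 2) := by
        calc a2 ^ 2 * a2 = a2 ^ 3 := by ring
          _ ≤ a1 ^ 2 * (K * a2 ^ 2) := h3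
          _ = _ := by ring
      exact (ENNReal.mul_le_mul_iff_right (pow_ne_zero 2 h0) (ENNReal.pow_ne_top hfin)).1 h4
  rw [eLpNorm_one_eq_lintegral_enorm, ← ha1, rademacherNorm_eq]
  have h5 : eLpNorm (steinhausSum y) 2 (torusHaar n) ^ 2 ≤
      (((K ^ (1 / 2 : ℝ) : ℝ≥0) : ℝ≥0∞) * a1) ^ 2 := by
    rw [h2, mul_pow, ← ENNReal.coe_pow, ← NNReal.rpow_natCast, ← NNReal.rpow_mul]
    norm_num
    exact hfinal
  rwa [← ENNReal.rpow_two, ← ENNReal.rpow_two, ENNReal.rpow_le_rpow_iff two_pos] at h5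

end FourierDecomp
end

/-! ### Test functions that restrict the exponents -/

noncomputable section
namespace FourierDecomp

open Finset MeasureTheory AddCircle

lemma le_of_forall_natCast_rpow_le {a b : ℝ} {C : ℝ≥0∞} (hC : C ≠ ∞)
    (h : ∀ N : ℕ, 1 ≤ N → (N : ℝ≥0∞) ^ a ≤ C * (N : ℝ≥0∞) ^ b) : a ≤ b := by
  by_contra! hab
  lift C to ℝ≥0 using hC
  have ht : Filter.Tendsto (fun N : ℕ => (N : ℝ) ^ (a - b)) Filter.atTop Filter.atTop :=
    (tendsto_rpow_atTop (sub_pos.2 hab)).comp tendsto_natCast_atTop_atTop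
  obtain ⟨N, hN, hN1⟩ := ((ht.eventually_gt_atTop (C : ℝ)).and
    (Filter.eventually_ge_atTop 1)).exists
  have hN0 : (0 : ℝ) < N := by exact_mod_cast hN1
  have h1 := h N hN1
  rw [← ENNReal.ofReal_natCast, ENNReal.ofReal_rpow_of_pos hN0, ENNReal.ofReal_rpow_of_pos hN0,
    ← ENNReal.ofReal_coe_nnreal, ← ENNReal.ofReal_mul C.coe_nonneg,
    ENNReal.ofReal_le_ofReal_iff (by positivity)] at h1
  have h2 : (N : ℝ) ^ a = (N : ℝ) ^ (a - b) * (N : ℝ) ^ b := by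
    rw [← Real.rpow_add hN0]; congr 1; ring
  rw [h2] at h1
  have h3 : 0 < (N : ℝ) ^ b := by positivity
  exact absurd (le_of_mul_le_mul_right h1 h3) (not_le.2 hN)

lemma toReal_inv_le_toReal_inv {p q : ℝ≥0∞} (hp : p ≠ 0) (h : p⁻¹.toReal ≤ q⁻¹.toReal)
    (hq : q ≠ 0) : q ≤ p := by
  rwa [ENNReal.toReal_le_toReal (ENNReal.inv_ne_top.2 hp) (ENNReal.inv_ne_top.2 hq),
    ENNReal.inv_le_inv] at h

lemma ellNorm_const {n : ℕ} (hn : 1 ≤ n) {q : ℝ≥0∞} (hq : q ≠ 0) (a : ℝ≥0∞) :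
    ellNorm q (fun _ : Fin n => a) = (n : ℝ≥0∞) ^ q⁻¹.toReal * a := by
  unfold ellNorm
  split_ifs with h
  · have : Nonempty (Fin n) := ⟨⟨0, hn⟩⟩
    simp [h]
  · have h0 : 0 < q.toReal := ENNReal.toReal_pos hq h
    rw [tsum_fintype, sum_const, card_univ, Fintype.card_fin, nsmul_eq_mul,
      ENNReal.mul_rpow_of_nonneg _ _ (by positivity), ← ENNReal.rpow_mul,
      mul_one_div_cancel h0.ne', ENNReal.rpow_one, ENNReal.toReal_inv, one_div]

lemma toReal_inv_conjExponent {p : ℝ≥0∞} (hp : 1 ≤ p) :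
    p.conjExponent⁻¹.toReal = 1 - p⁻¹.toReal := by
  have hc := ENNReal.HolderConjugate.conjExponent hp
  have h := ENNReal.HolderConjugate.inv_add_inv_eq_one p p.conjExponent
  have h1 : p⁻¹ ≠ ∞ := ENNReal.inv_ne_top.2 (zero_lt_one.trans_le hp).ne'
  have h2 : p.conjExponent⁻¹ ≠ ∞ := fun h2 => by rw [h2, add_top] at h; exact ENNReal.top_ne_one h
  have h3 := congrArg ENNReal.toReal h
  rw [ENNReal.toReal_add h1 h2, ENNReal.toReal_one] at h3
  linarith

section Parseval

variable {X : Type*} [NormedAddCommGroup X] [NormedSpace ℂ X]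

lemma integral_norm_sq_unimodular {n : ℕ} {c : Fin n → ℂ} (hc : ∀ k, ‖c k‖ = 1) :
    ∫ t : UnitAddCircle, ‖∑ k : Fin n, (fourier (k : ℤ) t * c k : ℂ)‖ ^ 2 ∂haarAddCircle = n := by
  have h : ∀ t : UnitAddCircle,
      ((‖∑ k : Fin n, (fourier (k : ℤ) t * c k : ℂ)‖ ^ 2 : ℝ) : ℂ) =
      ∑ k : Fin n, ∑ l : Fin n,
        (fourier ((k : ℤ) - l) t * (c k * (starRingEnd ℂ) (c l)) : ℂ) := fun t => by
    push_cast
    rw [← Complex.mul_conj', map_sum, sum_mul_sum]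
    refine sum_congr rfl fun k _ => sum_congr rfl fun l _ => ?_
    rw [map_mul, ← fourier_neg, sub_eq_add_neg, fourier_add]
    ring
  have h2 : ((∫ t : UnitAddCircle, ‖∑ k : Fin n, (fourier (k : ℤ) t * c k : ℂ)‖ ^ 2
      ∂haarAddCircle : ℝ) : ℂ) = n := by
    rw [← integral_complex_ofReal]
    simp_rw [h]
    rw [integral_finsetSum _ fun k _ => Continuous.integrable_haar (by fun_prop)]
    calc _ = ∑ k : Fin n, (1 : ℂ) := by
          refine sum_congr rfl fun k _ => ?_
          rw [integral_finsetSum _ fun l _ => Continuous.integrable_haar (by fun_prop)]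
          simp_rw [integral_mul_const, integral_fourier, sub_eq_zero, natCast_injective_fin.eq_iff,
            ite_mul, zero_mul, one_mul]
          rw [sum_ite_eq, if_pos (mem_univ _), Complex.mul_conj', hc]
          norm_num
      _ = n := by simp
  exact_mod_cast h2

lemma circleNorm_two_unimodular {n : ℕ} {c : Fin n → ℂ} (hc : ∀ k, ‖c k‖ = 1) (x : X) :
    circleNorm (ENNReal.ofReal 2) (fun t => ∑ k : Fin n, fourier (k : ℤ) t • c k • x) =
      (n : ℝ≥0∞) ^ (1 / 2 : ℝ) * ‖x‖ₑ := by
  have h2 : (0 : ℝ) < 2 := by norm_num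
  have h : circleNorm (ENNReal.ofReal 2)
      (fun t => ∑ k : Fin n, fourier (k : ℤ) t • c k • x) ^ (2 : ℝ) =
      ((n : ℝ≥0∞) ^ (1 / 2 : ℝ) * ‖x‖ₑ) ^ (2 : ℝ) := by
    rw [circleNorm_rpow_eq h2, ENNReal.mul_rpow_of_nonneg _ _ h2.le, ← ENNReal.rpow_mul]
    norm_num
    have e : ∀ t : UnitAddCircle, ‖∑ k : Fin n, (fourier (k : ℤ) t : ℂ) • c k • x‖ₑ ^ 2 =
        ‖∑ k : Fin n, (fourier (k : ℤ) t * c k : ℂ)‖ₑ ^ 2 * ‖x‖ₑ ^ 2 := fun t => by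
      simp_rw [smul_smul, ← sum_smul, enorm_smul, mul_pow]
    have e' : ∫⁻ t : UnitAddCircle, ‖∑ k : Fin n, (fourier (k : ℤ) t * c k : ℂ)‖ₑ ^ 2
        ∂haarAddCircle = n := by
      rw [← ofReal_integral_norm_pow (by fun_prop), integral_norm_sq_unimodular hc,
        ENNReal.ofReal_natCast]
    rw [← e', ← lintegral_mul_const' _ _ (by finiteness)]
    refine lintegral_congr fun t => ?_
    rw [← e]
    rfl
  exact (ENNReal.rpow_left_injective h2.ne') h

lemma rademacherNorm_const (n : ℕ) (x : X) :
    rademacherNorm (fun _ : Fin n => x) = (n : ℝ≥0∞) ^ (1 / 2 : ℝ) * ‖x‖ₑ := by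
  rw [rademacherNorm_eq, show (2 : ℝ≥0∞) = ENNReal.ofReal 2 by simp]
  refine le_antisymm ?_ ?_
  · exact eLpNorm_steinhausSum_le two_pos _ fun c hc => (circleNorm_two_unimodular hc x).le
  · have := le_eLpNorm_steinhausSum (L := 1) two_pos (fun _ : Fin n => x) fun c hc =>
      by rw [circleNorm_two_unimodular hc x, ENNReal.coe_one, one_mul]
    simpa using this

end Parseval

section FejerNorm

/-- Interpolation between `L^1` norm `1` and supremum at most `N`. -/
lemma circleNorm_circleFejer_le {N : ℕ} (hN : 1 ≤ N) {s : ℝ≥0∞} (hs : 1 ≤ s) :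
    circleNorm s (circleFejer N) ≤ (N : ℝ≥0∞) ^ (1 - s⁻¹.toReal) := by
  have hN0 : (0 : ℝ) < N := by exact_mod_cast hN
  rcases eq_or_ne s ∞ with rfl | hs'
  · unfold circleNorm
    refine (eLpNorm_le_of_ae_bound (C := N) (Filter.Eventually.of_forall fun t => ?_)).trans_eq ?_
    · rw [Real.norm_of_nonneg (circleFejer_nonneg _ _)]
      exact circleFejer_le N t
    · simp
  · have hs1 : 1 ≤ s.toReal := by
      rw [← ENNReal.toReal_one]; exact ENNReal.toReal_mono hs' hs
    have hs0 : 0 < s.toReal := by linarith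
    rw [← ENNReal.rpow_le_rpow_iff hs0]
    have h := circleNorm_rpow_eq hs0 (circleFejer N)
    rw [ENNReal.ofReal_toReal hs'] at h
    rw [h, ← ENNReal.rpow_mul]
    have e : (1 - s⁻¹.toReal) * s.toReal = s.toReal - 1 := by
      rw [ENNReal.toReal_inv]; field_simp
    rw [e]
    calc ∫⁻ t, ‖circleFejer N t‖ₑ ^ s.toReal ∂haarAddCircle
        ≤ ∫⁻ t, ENNReal.ofReal ((N : ℝ) ^ (s.toReal - 1) * circleFejer N t) ∂haarAddCircle := by
          refine lintegral_mono fun t => ?_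
          have h0 := circleFejer_nonneg N t
          rw [← ofReal_norm, Real.norm_of_nonneg h0, ENNReal.ofReal_rpow_of_nonneg h0 hs0.le]
          refine ENNReal.ofReal_le_ofReal ?_
          rcases h0.eq_or_lt with h1 | h1
          · rw [← h1, Real.zero_rpow hs0.ne', mul_zero]
          · calc circleFejer N t ^ s.toReal
                = circleFejer N t ^ (s.toReal - 1) * circleFejer N t := by
                  rw [← Real.rpow_add_one h1.ne']; congr 1; ring
              _ ≤ _ := mul_le_mul_of_nonneg_right
                  (Real.rpow_le_rpow h0 (circleFejer_le N t) (by linarith)) h0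
      _ = ENNReal.ofReal ((N : ℝ) ^ (s.toReal - 1)) := by
          rw [← ofReal_integral_eq_lintegral_ofReal, integral_const_mul, integral_circleFejer hN,
            mul_one]
          · exact Continuous.integrable_haar (continuous_const.mul (continuous_circleFejer N))
          · exact Filter.Eventually.of_forall fun t =>
              mul_nonneg (by positivity) (circleFejer_nonneg _ _)
      _ = _ := by rw [← ENNReal.ofReal_rpow_of_pos hN0, ENNReal.ofReal_natCast]

variable {X : Type*} [NormedAddCommGroup X] [NormedSpace ℂ X]

/-- A lower bound of order `N ^ (1 - 1 / p)` for the Dirichlet kernel, valid also at `p = 1` and `p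
= ∞`, where it need not be sharp. The kernel is paired with a Fejér kernel of order `2 * N`: the
pairing has size at least `N / 2`, and the `L^{p'}` norm of the Fejér kernel is at most `2 N ^ (1 /
p)`. -/
lemma natCast_le_circleNorm_dirichlet [CompleteSpace X] {N : ℕ} (hN : 1 ≤ N) {p : ℝ≥0∞}
    (hp : 1 ≤ p) (x : X) :
    (N : ℝ≥0∞) * ‖x‖ₑ ≤ 4 * (N : ℝ≥0∞) ^ p⁻¹.toReal *
      circleNorm p (fun t => ∑ k : Fin N, fourier (-(k : ℤ)) t • x) := by
  have hc := ENNReal.HolderConjugate.conjExponent hp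
  have hc' : 1 ≤ p.conjExponent := by rw [ENNReal.conjExponent]; exact le_self_add
  set f : UnitAddCircle → X := fun t => ∑ k : Fin N, fourier (-(k : ℤ)) t • x with hf
  have hfc : Continuous f := continuous_trigSum _ _ _
  set K : UnitAddCircle → ℂ := fun t => (circleFejer (2 * N) t : ℂ) with hK
  have hKc : Continuous K := Complex.continuous_ofReal.comp (continuous_circleFejer _)
  have hint : ∫ t, K t • f t ∂haarAddCircle = (∑ k : Fin N, (fejerCoeff (2 * N) k : ℂ)) • x := by
    simp only [hf, smul_sum, smul_smul]
    rw [integral_finsetSum _ fun k _ => Continuous.integrable_haar (by fun_prop), sum_smul]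
    refine sum_congr rfl fun k _ => ?_
    rw [integral_smul_const, ← integral_fourier_mul_circleFejer]
    simp only [hK, mul_comm]
  have hsum : (N : ℝ) / 2 ≤ ‖∑ k : Fin N, (fejerCoeff (2 * N) k : ℂ)‖ := by
    rw [← Complex.ofReal_sum, Complex.norm_real]
    refine le_trans ?_ (le_abs_self _)
    calc (N : ℝ) / 2 = ∑ k : Fin N, (1 / 2 : ℝ) := by simp; ring
      _ ≤ _ := sum_le_sum fun k _ => le_fejerCoeff (by omega) (by omega)
  have hKn : circleNorm p.conjExponent K ≤ 2 * (N : ℝ≥0∞) ^ p⁻¹.toReal := by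
    have e : circleNorm p.conjExponent K = circleNorm p.conjExponent (circleFejer (2 * N)) := by
      unfold circleNorm
      refine eLpNorm_congr_norm_ae (Filter.Eventually.of_forall fun t => ?_)
      simp only [hK, Complex.norm_real]
    rw [e]
    refine (circleNorm_circleFejer_le (by omega) hc').trans ?_
    rw [toReal_inv_conjExponent hp, sub_sub_cancel, Nat.cast_mul,
      ENNReal.mul_rpow_of_nonneg _ _ ENNReal.toReal_nonneg]
    gcongr
    rw [Nat.cast_ofNat]
    refine (ENNReal.rpow_le_rpow_of_exponent_le (by norm_num) (?_ : _ ≤ (1 : ℝ))).trans_eq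
      (ENNReal.rpow_one _)
    rw [← ENNReal.toReal_one]
    exact ENNReal.toReal_mono ENNReal.one_ne_top (ENNReal.inv_le_one.2 hp)
  have hH : ‖(∑ k : Fin N, (fejerCoeff (2 * N) k : ℂ)) • x‖ₑ ≤
      circleNorm p.conjExponent K * circleNorm p f := by
    rw [← hint]
    refine (enorm_integral_le_lintegral_enorm _).trans ?_
    have := hc.symm
    have h := eLpNorm_smul_le_mul_eLpNorm (p := p.conjExponent) (q := p) (r := 1)
      (μ := (haarAddCircle : Measure UnitAddCircle))
      hfc.aestronglyMeasurable hKc.aestronglyMeasurable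
    rw [eLpNorm_one_eq_lintegral_enorm] at h
    exact h
  have hfin : (N : ℝ≥0∞) * ‖x‖ₑ ≤ 2 * ‖(∑ k : Fin N, (fejerCoeff (2 * N) k : ℂ)) • x‖ₑ := by
    rw [enorm_smul, ← mul_assoc]
    gcongr
    rw [← ofReal_norm, ← ENNReal.ofReal_natCast, ← ENNReal.ofReal_ofNat,
      ← ENNReal.ofReal_mul (by norm_num)]
    exact ENNReal.ofReal_le_ofReal (by linarith)
  calc _ ≤ _ := hfin
    _ ≤ 2 * (2 * (N : ℝ≥0∞) ^ p⁻¹.toReal * circleNorm p f) := by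
        gcongr
        exact hH.trans (by gcongr)
    _ = _ := by ring

end FejerNorm

/-! ### Assembling the two halves -/

section Main

variable {X : Type*} [NormedAddCommGroup X] [NormedSpace ℂ X]

lemma HasDiscreteFourierType.conj {r : ℝ≥0∞} (hr : 1 < r) (hr' : r < ∞)
    (h : HasDiscreteFourierType X (r.toReal / (r.toReal - 1))) :
    HasFourierType X r.conjExponent ∧ (2 ≤ r → HasCotype X r) := by
  have hr1 : 1 < r.toReal := by
    rw [← ENNReal.toReal_one]; exact (ENNReal.toReal_lt_toReal ENNReal.one_ne_top hr'.ne).2 hr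
  have hr0 : 0 < r.toReal - 1 := by linarith
  have hv : 1 < r.toReal / (r.toReal - 1) := by rw [one_lt_div hr0]; linarith
  have hconj : r.toReal / (r.toReal - 1) / (r.toReal / (r.toReal - 1) - 1) = r.toReal := by
    have : r.toReal / (r.toReal - 1) - 1 = 1 / (r.toReal - 1) := by field_simp; ring
    rw [this]; field_simp
  refine ⟨?_, fun h2 => ?_⟩
  · have h1 := h.hasFourierType hv
    rw [hconj, ENNReal.ofReal_toReal hr'.ne, ← conjExponent_toReal hr hr'] at h1
    rw [HasFourierType, conjExponent_conjExponent hr.le]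
    exact h1
  · have h2' : 2 ≤ r.toReal := by
      have := ENNReal.toReal_mono hr'.ne h2
      simpa using this
    have h1 := h.hasCotype hv (by rw [div_le_iff₀ hr0]; linarith)
    rwa [hconj, ENNReal.ofReal_toReal hr'.ne] at h1

theorem upper_decompositions_consequences [CompleteSpace X] [Nontrivial X] {p q : ℝ≥0∞}
    (hp : 1 ≤ p) (hq : 1 ≤ q) (h : HasUpperDecompositions X q p) :
    q ≤ min p.conjExponent 2 ∧ HasType X q ∧
      ∀ r : ℝ≥0∞, 2 * q.conjExponent / min p 2 < r → r < ∞ →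
        HasFourierType X r.conjExponent ∧ HasCotype X r := by
  have hp0 : p ≠ 0 := (zero_lt_one.trans_le hp).ne'
  have hq0 : q ≠ 0 := (zero_lt_one.trans_le hq).ne'
  obtain ⟨U, hU⟩ := h.circleNorm_le hp0 hq0
  obtain ⟨K, hK⟩ := rademacherNorm_le_eLpNorm_one (X := X)
  obtain ⟨x, hx⟩ := exists_ne (0 : X)
  have hx0 : ‖x‖ₑ ≠ 0 := by rwa [Ne, enorm_eq_zero]
  have hx1 : ‖x‖ₑ ≠ ∞ := enorm_ne_top
  have htype : ∀ (n : ℕ) (x : Fin n → X),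
      rademacherNorm x ≤ (K * U : ℝ≥0) * ellNorm q (fun k => ‖x k‖ₑ) := by
    intro n x
    refine (hK n x).trans ?_
    rw [ENNReal.coe_mul, mul_assoc]
    gcongr
    rw [← ENNReal.ofReal_one]
    refine eLpNorm_steinhausSum_le one_pos x fun c hc => ?_
    rw [ENNReal.ofReal_one]
    refine (circleNorm_mono hp (continuous_trigSum _ _ _)).trans
      ((hU natCast_injective_fin _).trans_eq ?_)
    simp_rw [enorm_smul, ← ofReal_norm (c _), hc, ENNReal.ofReal_one, one_mul]
  have hq2 : q ≤ 2 := by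
    refine toReal_inv_le_toReal_inv two_ne_zero ?_ hq0
    rw [ENNReal.toReal_inv, ENNReal.toReal_ofNat, ← one_div]
    refine le_of_forall_natCast_rpow_le (C := (K * U : ℝ≥0)) ENNReal.coe_ne_top fun N hN => ?_
    have h1 := htype N fun _ => x
    rw [rademacherNorm_const, ellNorm_const hN hq0, ← mul_assoc] at h1
    exact (ENNReal.mul_le_mul_iff_left hx0 hx1).1 h1
  have hq' : q ≠ ∞ := (hq2.trans_lt ENNReal.ofNat_lt_top).ne
  refine ⟨le_min ?_ hq2, ⟨K * U + 1, by positivity, fun n x => (htype n x).trans ?_⟩, ?_⟩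
  · have hp' : p.conjExponent ≠ 0 := by
      rw [ENNReal.conjExponent]; exact (zero_lt_one.trans_le le_self_add).ne'
    refine toReal_inv_le_toReal_inv hp' ?_ hq0
    -- It remains to see `1 ≤ 1 / p + 1 / q`, which comes from the growth in `N` of the two bounds
    -- for the Dirichlet kernel.
    rw [toReal_inv_conjExponent hp, sub_le_iff_le_add']
    refine le_of_forall_natCast_rpow_le (C := 4 * U) (by finiteness) fun N hN => ?_
    have h1 := natCast_le_circleNorm_dirichlet hN hp x
    have h2 := hU (n := fun k : Fin N => -(k : ℤ))
      (fun i j hij => natCast_injective_fin (neg_injective hij)) fun _ => x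
    rw [ellNorm_const hN hq0] at h2
    rw [ENNReal.rpow_one]
    refine (ENNReal.mul_le_mul_iff_left hx0 hx1).1 (h1.trans ?_)
    calc _ ≤ 4 * (N : ℝ≥0∞) ^ p⁻¹.toReal * (U * ((N : ℝ≥0∞) ^ q⁻¹.toReal * ‖x‖ₑ)) := by gcongr
      _ = _ := by
          rw [ENNReal.rpow_add_of_nonneg _ _ ENNReal.toReal_nonneg ENNReal.toReal_nonneg]
          ring
  · gcongr
    exact le_self_add
  · intro r hr hr'
    -- The interpolation argument needs only `r > q'`, which the assumed range implies.
    have hqr : q.conjExponent < r := by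
      refine lt_of_le_of_lt ?_ hr
      rw [ENNReal.le_div_iff_mul_le, mul_comm]
      · gcongr
        exact min_le_right _ _
      · exact Or.inl (by simp [hp0])
      · exact Or.inl (by simp)
    -- For `q = 1` the exponent `q'` is infinite and there is no finite `r` to treat.
    have hq1 : 1 < q := by
      refine lt_of_le_of_ne hq fun h1 => ?_
      rw [← h1, ENNReal.conjExponent, tsub_self, ENNReal.inv_zero, add_top] at hqr
      exact not_top_lt hqr
    have hqt : 1 < q.toReal := by
      rw [← ENNReal.toReal_one]; exact (ENNReal.toReal_lt_toReal ENNReal.one_ne_top hq').2 hq1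
    have hqt2 : q.toReal ≤ 2 := by simpa using ENNReal.toReal_mono (by simp) hq2
    rw [conjExponent_toReal hq1 (lt_top_iff_ne_top.2 hq'),
      ENNReal.ofReal_lt_iff_lt_toReal (div_nonneg (by linarith) (by linarith)) hr'.ne] at hqr
    have hqc : 0 < q.toReal - 1 := by linarith
    rw [div_lt_iff₀ hqc] at hqr
    have hrt2 : 2 < r.toReal := by nlinarith
    have h2r : 2 ≤ r := by
      rw [← ENNReal.ofReal_toReal hr'.ne, ← ENNReal.ofReal_ofNat]
      exact ENNReal.ofReal_le_ofReal hrt2.le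
    have hrc : 0 < r.toReal - 1 := by linarith
    have hD : HasDiscreteFourierType X (r.toReal / (r.toReal - 1)) := by
      refine hasDiscreteFourierType_of_l1 (q := q.toReal) (U := 4 * U) ?_ ?_ hqt2 (by positivity)
        fun N hN y => sum_norm_dft_le_of_circleNorm_le hp hq hq' hU y
      · rw [one_lt_div hrc]; linarith
      · rw [div_lt_iff₀ hrc]; linarith
    obtain ⟨h1, h2⟩ := hD.conj (lt_of_lt_of_le (by norm_num) h2r) hr'
    exact ⟨h1, h2 h2r⟩

theorem lower_decompositions_consequences [CompleteSpace X] [Nontrivial X] {p q : ℝ≥0∞}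
    (hp : 1 < p) (hp' : p < ∞) (hq : 1 ≤ q) (h : HasLowerDecompositions X q p) :
    max p.conjExponent 2 ≤ q ∧ HasCotype X q ∧
      ∀ r : ℝ≥0∞, 2 * q / min p.conjExponent 2 < r → r < ∞ →
        HasFourierType X r.conjExponent ∧ HasType X r.conjExponent := by
  have hp0 : p ≠ 0 := (zero_lt_one.trans hp).ne'
  have hq0 : q ≠ 0 := (zero_lt_one.trans_le hq).ne'
  obtain ⟨L, hL⟩ := h.le_circleNorm hp0 hq0
  -- An even moment of order at least `p`: the lower bound holds a fortiori in `L^s`, and Kahane's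
  -- inequality brings it down to `L^2`. This is where `p < ∞` enters.
  obtain ⟨s, K, hs, hps, hK⟩ := eLpNorm_steinhausSum_le_rademacherNorm (X := X) hp'.ne
  obtain ⟨x, hx⟩ := exists_ne (0 : X)
  have hx0 : ‖x‖ₑ ≠ 0 := by rwa [Ne, enorm_eq_zero]
  have hx1 : ‖x‖ₑ ≠ ∞ := enorm_ne_top
  have hcotype : ∀ (n : ℕ) (x : Fin n → X),
      ellNorm q (fun k => ‖x k‖ₑ) ≤ (L * K : ℝ≥0) * rademacherNorm x := by
    intro n x
    have h1 : ellNorm q (fun k => ‖x k‖ₑ) ≤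
        L * eLpNorm (steinhausSum x) (ENNReal.ofReal s) (torusHaar n) := by
      refine le_eLpNorm_steinhausSum hs x fun c hc => ?_
      have h2 := hL natCast_injective_fin fun k => c k • x k
      simp_rw [enorm_smul, ← ofReal_norm (c _), hc, ENNReal.ofReal_one, one_mul] at h2
      refine h2.trans ?_
      gcongr
      exact circleNorm_mono hps (continuous_trigSum _ _ _)
    refine h1.trans ?_
    rw [ENNReal.coe_mul, mul_assoc]
    gcongr
    exact hK n x
  have hq2 : 2 ≤ q := by
    refine toReal_inv_le_toReal_inv hq0 ?_ two_ne_zero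
    rw [show (2 : ℝ≥0∞)⁻¹.toReal = (1 / 2 : ℝ) by
      rw [ENNReal.toReal_inv, ENNReal.toReal_ofNat, one_div]]
    refine le_of_forall_natCast_rpow_le (C := (L * K : ℝ≥0)) ENNReal.coe_ne_top fun N hN => ?_
    have h1 := hcotype N fun _ => x
    rw [rademacherNorm_const, ellNorm_const hN hq0, ← mul_assoc] at h1
    exact (ENNReal.mul_le_mul_iff_left hx0 hx1).1 h1
  refine ⟨max_le ?_ hq2, ⟨L * K + 1, by positivity, fun n x => (hcotype n x).trans ?_⟩, ?_⟩
  · have hp'' : p.conjExponent ≠ 0 := by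
      rw [ENNReal.conjExponent]; exact (zero_lt_one.trans_le le_self_add).ne'
    refine toReal_inv_le_toReal_inv hq0 ?_ hp''
    rw [toReal_inv_conjExponent hp.le]
    refine le_of_forall_natCast_rpow_le (C := 4 * L) (by finiteness) fun N hN => ?_
    -- The test function is `circleFejer (2 * N)` times `x`: it has `N` coefficients of norm at
    -- least `‖x‖ / 2`, against an `L^p` norm of order at most `N ^ (1 - 1 / p)`.
    have h1 := hL (ι := Ioo (-(2 * N : ℕ) : ℤ) (2 * N : ℕ)) (n := fun n => (n : ℤ))
      Subtype.val_injective fun n => (fejerCoeff (2 * N) n : ℂ) • x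
    have hmem : ∀ k : Fin N, (k : ℤ) ∈ Ioo (-(2 * N : ℕ) : ℤ) (2 * N : ℕ) := fun k => by
      rw [mem_Ioo]; constructor <;> omega
    have h2 : ellNorm q (fun _ : Fin N => ((1 / 2 : ℝ≥0) : ℝ≥0∞) * ‖x‖ₑ) ≤
        ellNorm q (fun n : Ioo (-(2 * N : ℕ) : ℤ) (2 * N : ℕ) =>
          ‖(fejerCoeff (2 * N) n : ℂ) • x‖ₑ) := by
      refine le_trans (ellNorm_mono q fun k => ?_) (ellNorm_comp_le
        (g := fun k : Fin N => (⟨(k : ℤ), hmem k⟩ : Ioo (-(2 * N : ℕ) : ℤ) (2 * N : ℕ)))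
        (fun i j hij => natCast_injective_fin (congrArg Subtype.val hij)) q _)
      rw [enorm_smul]
      gcongr
      rw [← ofReal_norm, Complex.norm_real, ← ENNReal.ofReal_coe_nnreal]
      exact ENNReal.ofReal_le_ofReal
        ((le_fejerCoeff (n := k) (by omega) (by omega)).trans (le_abs_self _))
    have h3 : circleNorm p (fun t => ∑ n : Ioo (-(2 * N : ℕ) : ℤ) (2 * N : ℕ),
        fourier (n : ℤ) t • (fejerCoeff (2 * N) n : ℂ) • x) ≤
        2 * (N : ℝ≥0∞) ^ (1 - p⁻¹.toReal) * ‖x‖ₑ := by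
      have e : (fun t : UnitAddCircle => ∑ n : Ioo (-(2 * N : ℕ) : ℤ) (2 * N : ℕ),
          (fourier (n : ℤ) t : ℂ) • (fejerCoeff (2 * N) n : ℂ) • x) =
          fun t => (circleFejer (2 * N) t : ℂ) • x := by
        ext t
        rw [sum_coe_sort (Ioo (-(2 * N : ℕ) : ℤ) (2 * N : ℕ)) fun n : ℤ => (fourier n t : ℂ) •
          (fejerCoeff (2 * N) n : ℂ) • x, circleFejer_eq_sum, sum_smul]
        simp_rw [smul_smul]
      rw [e]
      have e2 : circleNorm p (fun t => (circleFejer (2 * N) t : ℂ) • x) =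
          circleNorm p (circleFejer (2 * N)) * ‖x‖ₑ := by
        unfold circleNorm
        rw [mul_comm (eLpNorm _ _ _), ← enorm_norm x, ← eLpNorm_const_smul]
        refine eLpNorm_congr_norm_ae (Filter.Eventually.of_forall fun t => ?_)
        rw [norm_smul, Complex.norm_real, Pi.smul_apply, norm_smul, norm_norm, mul_comm]
      rw [e2]
      gcongr
      refine (circleNorm_circleFejer_le (by omega) hp.le).trans ?_
      have hpi : p⁻¹.toReal ≤ 1 := by
        rw [← ENNReal.toReal_one]
        exact ENNReal.toReal_mono ENNReal.one_ne_top (ENNReal.inv_le_one.2 hp.le)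
      rw [Nat.cast_mul, ENNReal.mul_rpow_of_nonneg _ _ (by linarith)]
      gcongr
      rw [Nat.cast_ofNat]
      refine (ENNReal.rpow_le_rpow_of_exponent_le (by norm_num) (?_ : _ ≤ (1 : ℝ))).trans_eq
        (ENNReal.rpow_one _)
      linarith [(ENNReal.toReal_nonneg : 0 ≤ p⁻¹.toReal)]
    have h4 := h2.trans (h1.trans (mul_le_mul_right h3 _))
    rw [ellNorm_const hN hq0] at h4
    refine (ENNReal.mul_le_mul_iff_left hx0 hx1).1 ?_
    have e2 : (2 : ℝ≥0∞) * ((1 / 2 : ℝ≥0) : ℝ≥0∞) = 1 := by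
      rw [← ENNReal.coe_ofNat, ← ENNReal.coe_mul]
      norm_num
    calc (N : ℝ≥0∞) ^ q⁻¹.toReal * ‖x‖ₑ
        = 2 * ((N : ℝ≥0∞) ^ q⁻¹.toReal * (((1 / 2 : ℝ≥0) : ℝ≥0∞) * ‖x‖ₑ)) := by
          rw [mul_left_comm, ← mul_assoc 2, e2, one_mul]
      _ ≤ 2 * (L * (2 * (N : ℝ≥0∞) ^ (1 - p⁻¹.toReal) * ‖x‖ₑ)) := by gcongr
      _ = _ := by ring
  · gcongr
    exact le_self_add
  · intro r hr hr'
    have hqr : q < r := by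
      refine lt_of_le_of_lt ?_ hr
      rw [ENNReal.le_div_iff_mul_le, mul_comm]
      · gcongr
        exact min_le_right _ _
      · refine Or.inl ?_
        rw [ENNReal.conjExponent]
        exact (lt_min (zero_lt_one.trans_le le_self_add) two_pos).ne'
      · exact Or.inl (by simp)
    have hq' : q ≠ ∞ := (hqr.trans hr').ne
    have h2r : 2 ≤ r := hq2.trans hqr.le
    have hqt2 : 2 ≤ q.toReal := by simpa using ENNReal.toReal_mono hq' hq2
    have hqrt : q.toReal < r.toReal := (ENNReal.toReal_lt_toReal hq' hr'.ne).2 hqr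
    have hrc : 0 < r.toReal - 1 := by linarith
    have hqc : 0 < q.toReal - 1 := by linarith
    have hv : 1 < r.toReal / (r.toReal - 1) := by rw [one_lt_div hrc]; linarith
    -- On the dual the starting exponent is `q' ≤ 2`, and `r > q` says `r' < q'`, as the
    -- interpolation requires.
    have hD : HasDiscreteFourierType (X →L[ℂ] ℂ) (r.toReal / (r.toReal - 1)) := by
      refine hasDiscreteFourierType_of_l1 (q := q.toReal / (q.toReal - 1)) (U := 2 * (4 * L)) hv
        ?_ ?_ (by positivity) fun N hN φ => sum_norm_dft_dual_le
          ((Real.holderConjugate_iff_eq_conjExponent (by linarith)).2 rfl)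
          (fun u hu => ellNorm_dft_le_of_le_circleNorm hq hq' hL u hu) φ
      · rw [div_lt_div_iff₀ hrc hqc]; nlinarith
      · rw [div_le_iff₀ hqc]; linarith
    have h1r : 1 < r := lt_of_lt_of_le (by norm_num) h2r
    have hF := ((hD.of_dual hv).conj h1r hr').1
    refine ⟨hF, hF.hasType ?_ ?_⟩
    · rw [ENNReal.conjExponent]; exact (zero_lt_one.trans_le le_self_add).ne'
    · rwa [conjExponent_conjExponent h1r.le]

end Main

end FourierDecomp
end

theorem proposition2p8 {X : Type*} [NormedAddCommGroup X] [NormedSpace ℂ X] [CompleteSpace X]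
    [Nontrivial X] :
    (∀ p q : ℝ≥0∞, 1 ≤ p → 1 ≤ q → FourierDecomp.HasUpperDecompositions X q p →
      q ≤ min p.conjExponent 2 ∧
      FourierDecomp.HasType X q ∧
      ∀ r : ℝ≥0∞, 2 * q.conjExponent / min p 2 < r → r < ∞ →
        FourierDecomp.HasFourierType X r.conjExponent ∧ FourierDecomp.HasCotype X r) ∧
    (∀ p q : ℝ≥0∞, 1 < p → p < ∞ → 1 ≤ q → FourierDecomp.HasLowerDecompositions X q p →
      max p.conjExponent 2 ≤ q ∧
      FourierDecomp.HasCotype X q ∧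
      ∀ r : ℝ≥0∞, 2 * q / min p.conjExponent 2 < r → r < ∞ →
        FourierDecomp.HasFourierType X r.conjExponent ∧
        FourierDecomp.HasType X r.conjExponent) :=
  ⟨fun _ _ hp hq h => FourierDecomp.upper_decompositions_consequences hp hq h,
    fun _ _ hp hp' hq h => FourierDecomp.lower_decompositions_consequences hp hp' hq h⟩
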